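/- Let $d\ge 3$, $n\ge 2$, $\tau\ge 4$ be integers and let $C_1,\dots,C_\tau\subset\mathbb P^2$ be smooth complex plane curves of degree $d$, any two of which intersect transversally. For a point $P$ let $k_P$ be the number of curves $C_i$ through $P$, and let $t_r$ be the number of points $P$ with $k_P=r$. Assume that $t_\tau=0$, i.e. that no point lies on all $\tau$ curves. Put $D=\sum_i C_i$, let $\mathrm{Esing}(D)$ be the set of points $P$ with $k_P\ge 3$, let $\pi:Z\to\mathbb P^2$ be the blow-up at the points of $\mathrm{Esing}(D)$, and let $E_P$ be the exceptional curve over $P$. Then the $\mathbb Q$-divisor $$K=\pi^*K_{\mathbb P^2}+\sum_{P\in\mathrm{Esing}(D)}E_P+\frac{n-1}{n}\Big(\sum_{P\in\mathrm{Esing}(D)}E_P+\pi^*D-\sum_{P\in\mathrm{Esing}(D)}k_PE_P\Big)$$ on $Z$ is nef and big (here $K_{\mathbb P^2}=-\operatorname{div}(G)$ for an arbitrary nonzero cubic form $G$). Moreover, write $C_i=\{F_i=0\}$ with forms $F_i$ of degree $d$. Then the abelian $(\mathbb Z/n\mathbb Z)^{\tau-1}$-cover of $\mathbb P^2$ branched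 with order $n$ along $D$ whose function field is obtained from $\mathbb C(\mathbb P^2)$ by adjoining all $n$-th roots of the functions $F_i/F_j$ is of general type; that is, its smooth projective models have Kodaira dimension $2$. -/

import Mathlib

open scoped LinearAlgebra.Projectivization TensorProduct

noncomputable section

namespace PlaneArrangement

/-! ### The complex projective plane: function field and local rings -/

/-- The field `ℂ(x, y)` of rational functions on the complex projective plane. -/
abbrev PlaneField : Type := FractionRing (MvPolynomial (Fin 2) ℂ)

/-- The complex projective plane (its closed points). -/
abbrev Plane : Type := ℙ ℂ (Fin 3 → ℂ)

/-- The homogeneous coordinates `(1 : x : y)` of the generic point of the plane. -/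
def coord : Fin 3 → PlaneField :=
  ![1, algebraMap (MvPolynomial (Fin 2) ℂ) PlaneField (MvPolynomial.X 0),
    algebraMap (MvPolynomial (Fin 2) ℂ) PlaneField (MvPolynomial.X 1)]

/-- The value of a form at the generic point `(1 : x : y)`. If `A` and `B` are forms of the same
degree, then `generic A / generic B` is the rational function `A / B` on the plane. -/
def generic (A : MvPolynomial (Fin 3) ℂ) : PlaneField := MvPolynomial.aeval coord A

/-- The gradient of a polynomial in the three homogeneous coordinates. -/
def gradient (A : MvPolynomial (Fin 3) ℂ) (p : Fin 3 → ℂ) : Fin 3 → ℂ :=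
  fun i => MvPolynomial.eval p (MvPolynomial.pderiv i A)

/-- The form `A` vanishes at the point `P` of the plane. -/
def Vanishes (A : MvPolynomial (Fin 3) ℂ) (P : Plane) : Prop :=
  MvPolynomial.eval P.rep A = 0

theorem aeval_mul_of_isHomogeneous {E : Type*} [Field E] [Algebra ℂ E] {k : ℕ}
    {A : MvPolynomial (Fin 3) ℂ} (hA : A.IsHomogeneous k) (c : E) (g : Fin 3 → E) :
    MvPolynomial.aeval (fun i => c * g i) A = c ^ k * MvPolynomial.aeval g A := by
  rw [MvPolynomial.aeval_def, MvPolynomial.aeval_def, MvPolynomial.eval₂_eq',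
    MvPolynomial.eval₂_eq', Finset.mul_sum]
  refine Finset.sum_congr rfl fun e he => ?_
  have hk : ∑ i, e i = k := by
    have h := hA.degree_eq_sum_deg_support he
    rw [h]
    exact (Finset.sum_subset (Finset.subset_univ _) fun i _ hi => by simpa using hi).symm
  simp only [mul_pow, Finset.prod_mul_distrib, Finset.prod_pow_eq_pow_sum, hk]
  ring

theorem generic_ne_zero {k : ℕ} {A : MvPolynomial (Fin 3) ℂ} (hA : A.IsHomogeneous k)
    (h0 : A ≠ 0) : generic A ≠ 0 := by
  intro h
  apply h0
  let E := FractionRing (MvPolynomial (Fin 3) ℂ)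
  let t : Fin 3 → E := fun i => algebraMap (MvPolynomial (Fin 3) ℂ) E (MvPolynomial.X i)
  have ht : t 0 ≠ 0 := by
    simp [t, MvPolynomial.X_ne_zero]
  let g : Fin 3 → MvPolynomial (Fin 2) ℂ := ![1, MvPolynomial.X 0, MvPolynomial.X 1]
  have h1 : MvPolynomial.aeval g A = 0 := by
    apply IsFractionRing.injective (MvPolynomial (Fin 2) ℂ) PlaneField
    rw [map_zero, ← h, generic, ← MvPolynomial.aeval_algebraMap_apply]
    congr 2
    funext i
    fin_cases i <;> simp [g, coord]
  let φ : MvPolynomial (Fin 2) ℂ →ₐ[ℂ] E := MvPolynomial.aeval ![t 1 / t 0, t 2 / t 0]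
  have h2 : MvPolynomial.aeval (fun i => φ (g i)) A = 0 := by
    have h3 := congrArg φ h1
    rw [map_zero] at h3
    rw [← h3, MvPolynomial.comp_aeval_apply]
  have h4 : MvPolynomial.aeval t A = 0 := by
    have h5 : t = fun i => t 0 * φ (g i) := by
      funext i
      fin_cases i <;> simp [g, φ, mul_div_cancel₀ _ ht]
    rw [h5, aeval_mul_of_isHomogeneous hA, h2, mul_zero]
  apply IsFractionRing.injective (MvPolynomial (Fin 3) ℂ) E
  rw [map_zero, ← h4]
  change _ = MvPolynomial.aeval (algebraMap (MvPolynomial (Fin 3) ℂ) E ∘ MvPolynomial.X) A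
  rw [MvPolynomial.aeval_algebraMap_apply, MvPolynomial.aeval_X_left_apply]

theorem generic_ne_zero_of_not_vanishes {k : ℕ} {A : MvPolynomial (Fin 3) ℂ}
    (hA : A.IsHomogeneous k) {P : Plane} (hP : ¬ Vanishes A P) : generic A ≠ 0 :=
  generic_ne_zero hA fun h => hP (by simp [Vanishes, h])

/-- The local ring of the plane at the point `P`: all fractions `A / B` of forms of the same
degree with `B(P) ≠ 0`, as a subring of the function field. -/
def localSubringAt (P : Plane) : Subring PlaneField where
  carrier := {f | ∃ (k : ℕ) (A B : MvPolynomial (Fin 3) ℂ), A.IsHomogeneous k ∧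
    B.IsHomogeneous k ∧ ¬ Vanishes B P ∧ f = generic A / generic B}
  mul_mem' := by
    rintro _ _ ⟨k, A, B, hA, hB, hP, rfl⟩ ⟨k', A', B', hA', hB', hP', rfl⟩
    refine ⟨k + k', A * A', B * B', hA.mul hA', hB.mul hB', ?_, ?_⟩
    · simpa [Vanishes] using And.intro hP hP'
    · simp only [generic, map_mul]
      rw [div_mul_div_comm]
  one_mem' := ⟨0, 1, 1, MvPolynomial.isHomogeneous_one _ _, MvPolynomial.isHomogeneous_one _ _,
    by simp [Vanishes], by simp [generic]⟩
  add_mem' := by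
    rintro _ _ ⟨k, A, B, hA, hB, hP, rfl⟩ ⟨k', A', B', hA', hB', hP', rfl⟩
    refine ⟨k + k', A * B' + B * A', B * B', (hA.mul hB').add (hB.mul hA'), hB.mul hB', ?_, ?_⟩
    · simpa [Vanishes] using And.intro hP hP'
    · have h := generic_ne_zero_of_not_vanishes hB hP
      have h' := generic_ne_zero_of_not_vanishes hB' hP'
      rw [div_add_div _ _ h h']
      simp only [generic, map_mul, map_add]
  zero_mem' := ⟨0, 0, 1, MvPolynomial.isHomogeneous_zero _ _ _,
    MvPolynomial.isHomogeneous_one _ _, by simp [Vanishes], by simp [generic]⟩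
  neg_mem' := by
    rintro _ ⟨k, A, B, hA, hB, hP, rfl⟩
    exact ⟨k, -A, B, hA.neg, hB, hP, by
      simp only [generic, map_neg]
      exact (neg_div _ _).symm⟩

theorem localSubringAt_isUnit (P : Plane) {k : ℕ} {A B : MvPolynomial (Fin 3) ℂ}
    (hA : A.IsHomogeneous k) (hB : B.IsHomogeneous k) (hAP : ¬ Vanishes A P)
    (hBP : ¬ Vanishes B P) (f : localSubringAt P)
    (hf : (f : PlaneField) = generic A / generic B) : IsUnit f := by
  refine IsUnit.of_mul_eq_one ⟨generic B / generic A, k, B, A, hB, hA, hAP, rfl⟩ ?_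
  apply Subtype.ext
  have h := generic_ne_zero_of_not_vanishes hA hAP
  have h' := generic_ne_zero_of_not_vanishes hB hBP
  change (f : PlaneField) * (generic B / generic A) = 1
  rw [hf]
  field_simp

instance localSubringAt_isLocalRing (P : Plane) : IsLocalRing (localSubringAt P) := by
  refine IsLocalRing.of_isUnit_or_isUnit_one_sub_self fun f => ?_
  obtain ⟨k, A, B, hA, hB, hP, hf⟩ := f.2
  by_cases hAP : Vanishes A P
  · right
    refine localSubringAt_isUnit P (hB.sub hA) hB ?_ hP _ ?_
    · simp only [Vanishes, map_sub] at hAP hP ⊢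
      rwa [hAP, sub_zero]
    · have h := generic_ne_zero_of_not_vanishes hB hP
      change (1 : PlaneField) - (f : PlaneField) = _
      rw [hf, eq_div_iff h, sub_mul, one_mul, div_mul_cancel₀ _ h]
      simp only [generic, map_sub]
  · left
    exact localSubringAt_isUnit P hA hB hAP hP f hf

/-- The local ring of the plane at the point `P`. -/
def localRingAt (P : Plane) : LocalSubring PlaneField :=
  { toSubring := localSubringAt P }

/-! ### Blowing up points

A projective surface with function field `K` is described, as in Zariski's theory of models, by the
set of its local rings at closed points, which are local subrings of `K`. -/

/-- The affine chart `O[m/u]` of the blow-up of the maximal ideal `m` of the local ring `O`. -/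
def blowUpChart {K : Type*} [Field K] (O : LocalSubring K) (u : K) : Subring K :=
  Subring.closure ((O.toSubring : Set K) ∪
    {f | ∃ a ∈ IsLocalRing.maximalIdeal O.toSubring, f = (a : K) / u})

/-- `R` is the local ring, at a closed point of the exceptional divisor, of the blow-up of the
closed point of the local ring `O`. -/
def IsQuadraticTransform {K : Type*} [Field K] (O R : LocalSubring K) : Prop :=
  ∃ u ∈ IsLocalRing.maximalIdeal O.toSubring, u ≠ 0 ∧
    ∃ (N : Ideal (blowUpChart O (u : K))) (_ : N.IsMaximal),
      (∃ v ∈ N, (v : K) = (u : K)) ∧ R = LocalSubring.ofPrime (blowUpChart O (u : K)) N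

/-- The blow-up of the plane at the points of `S`, given by its local rings at closed points. -/
def blowUp (S : Set Plane) : Set (LocalSubring PlaneField) :=
  {R | ∃ P : Plane, (P ∉ S ∧ R = localRingAt P) ∨
    (P ∈ S ∧ IsQuadraticTransform (localRingAt P) R)}

/-! ### Divisors on a surface -/

section Surface

variable {K : Type*} [Field K]

/-- The prime divisors (integral curves) of the surface `Z`; such a divisor is represented by the
local ring of `Z` at its generic point, a discrete valuation ring of the function field. -/
def PrimeDivisor (Z : Set (LocalSubring K)) : Type _ :=
  {V : LocalSubring K // ∃ R ∈ Z, ∃ (q : Ideal R.toSubring) (_ : q.IsPrime),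
    q.height = 1 ∧ V = LocalSubring.ofPrime R.toSubring q}

/-- `f` is a unit times the `k`-th power of a uniformizer of the valuation ring `V`. -/
def HasOrd (V : LocalSubring K) (f : K) (k : ℤ) : Prop :=
  ∃ π u : V.toSubring, IsLocalRing.maximalIdeal V.toSubring = Ideal.span {π} ∧ IsUnit u ∧
    f = (π : K) ^ k * (u : K)

open Classical in
/-- The order of the nonzero rational function `f` along the prime divisor with local ring `V`. -/
def ord (V : LocalSubring K) (f : K) : ℤ :=
  if h : ∃ k, HasOrd V f k then h.choose else 0

/-- `ℚ`-divisors on `Z`, given by their coefficients along the prime divisors; the functions that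
are divisors are those of finite support. -/
abbrev QDivisor (Z : Set (LocalSubring K)) : Type _ := PrimeDivisor Z → ℚ

/-- `ℚ`-linear equivalence: some positive multiple of the difference is a principal divisor. -/
def QLinearlyEquivalent {Z : Set (LocalSubring K)} (A B : QDivisor Z) : Prop :=
  ∃ m : ℕ, 0 < m ∧ ∃ g : K, g ≠ 0 ∧ ∀ V : PrimeDivisor Z, m * A V = m * B V + ord V.1 g

open Classical in
/-- The ideal, in the local ring `R` of a closed point, of the curve with generic local ring `V`
(the unit ideal if the curve does not pass through the point). -/
def curveIdeal (R V : LocalSubring K) : Ideal R.toSubring :=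
  if h : R.toSubring ≤ V.toSubring then
    (IsLocalRing.maximalIdeal V.toSubring).comap (Subring.inclusion h) else ⊤

/-- The intersection multiplicity, at the closed point with local ring `R`, of two distinct
curves: the length of `R / (f, g)`, where `f` and `g` are local equations of the curves. -/
def localIntersection (R V W : LocalSubring K) : ℕ :=
  (Module.length R.toSubring (R.toSubring ⧸ (curveIdeal R V ⊔ curveIdeal R W))).toNat

/-- The intersection number of two distinct curves on `Z`. -/
def curveIntersection {Z : Set (LocalSubring K)} (V W : PrimeDivisor Z) : ℕ :=
  ∑ᶠ R ∈ Z, localIntersection R V.1 W.1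

/-- `q` is the intersection number of the `ℚ`-divisor `A` with the curve `C`: replace `A` by a
`ℚ`-linearly equivalent divisor whose support does not contain `C`, and count the local
intersections with `C`. On a smooth projective surface such a replacement always exists, and the
number does not depend on it. -/
def HasIntersectionNumber {Z : Set (LocalSubring K)} (A : QDivisor Z) (C : PrimeDivisor Z)
    (q : ℚ) : Prop :=
  ∃ B : QDivisor Z, QLinearlyEquivalent B A ∧ B C = 0 ∧
    q = ∑ᶠ V : PrimeDivisor Z, B V * curveIntersection V C

/-- A `ℚ`-divisor is nef if its intersection number with every integral curve is nonnegative. -/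
def IsNef {Z : Set (LocalSubring K)} (A : QDivisor Z) : Prop :=
  ∀ C : PrimeDivisor Z, ∃ q : ℚ, HasIntersectionNumber A C q ∧ 0 ≤ q

/-- `f` is a global section of the sheaf of the divisor `A`: zero, or `div f + A ≥ 0`. -/
def IsSection {Z : Set (LocalSubring K)} (A : QDivisor Z) (f : K) : Prop :=
  f = 0 ∨ ∀ V : PrimeDivisor Z, 0 ≤ (ord V.1 f : ℚ) + A V

/-- A `ℚ`-divisor `A` on a complex surface is big if its Iitaka dimension is two: for some `m > 0`
such that `mA` is an integral divisor, the image of the rational map given by the global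
sections of `mA` has dimension two, that is, the quotients of its sections contain two
algebraically independent functions with a common denominator. -/
def IsBig [Algebra ℂ K] {Z : Set (LocalSubring K)} (A : QDivisor Z) : Prop :=
  ∃ m : ℕ, 0 < m ∧ (∀ V : PrimeDivisor Z, ∃ a : ℤ, m * A V = a) ∧
    ∃ s₀ s₁ s₂ : K, IsSection ((m : ℚ) • A) s₀ ∧ IsSection ((m : ℚ) • A) s₁ ∧
      IsSection ((m : ℚ) • A) s₂ ∧ s₀ ≠ 0 ∧ AlgebraicIndependent ℂ ![s₁ / s₀, s₂ / s₀]

end Surface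

/-! ### Surfaces of general type -/

section GeneralType

variable (L : Type*) [Field L] [Algebra ℂ L]

/-- Rational `m`-canonical forms on a surface with function field `L`: the one-dimensional space
of `m`-fold tensors of rational 2-forms. -/
abbrev PluricanonicalForm (m : ℕ) : Type _ := ⨂[L]^m (⋀[L]^2 (Ω[L⁄ℂ]))

/-- The form `(da₁ ∧ db₁) ⊗ ⋯ ⊗ (daₘ ∧ dbₘ)`. -/
def productForm {m : ℕ} (a b : Fin m → L) : PluricanonicalForm L m :=
  PiTensorProduct.tprod L fun i =>
    exteriorPower.ιMulti L 2 ![KaehlerDifferential.D ℂ L (a i), KaehlerDifferential.D ℂ L (b i)]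

/-- The rational `m`-canonical form `ω` is regular at the valuation ring `A`, that is, it comes
from the `m`-th tensor power of the 2-forms of `A` over `ℂ`. -/
def IsRegularAt {m : ℕ} (A : ValuationSubring L) (ω : PluricanonicalForm L m) : Prop :=
  ω ∈ Submodule.span A.toSubring
    {η : PluricanonicalForm L m | ∃ a b : Fin m → L,
      (∀ i, a i ∈ A) ∧ (∀ i, b i ∈ A) ∧ η = productForm L a b}

/-- Regular `m`-canonical forms: those regular at every valuation ring of `L` over `ℂ`. For every
smooth projective surface `X` with function field `L` these are the global sections of the
`m`-th power of the canonical sheaf of `X`. Indeed every valuation ring of `L` over `ℂ` contains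
the local ring of `X` at its center, and the local rings at the prime divisors of `X` are
themselves such valuation rings. -/
def IsRegularForm {m : ℕ} (ω : PluricanonicalForm L m) : Prop :=
  ∀ A : ValuationSubring L, (∀ c : ℂ, algebraMap ℂ L c ∈ A) → IsRegularAt L A ω

/-- A (smooth projective) surface with function field `L` is of general type: its Kodaira
dimension is two, that is, for some `m > 0` the image of the `m`-canonical map has dimension two.
This is a birational invariant, so it depends only on `L`. -/
def IsOfGeneralType : Prop :=
  ∃ m : ℕ, 0 < m ∧ ∃ (ω : PluricanonicalForm L m) (f g : L), ω ≠ 0 ∧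
    IsRegularForm L ω ∧ IsRegularForm L (f • ω) ∧ IsRegularForm L (g • ω) ∧
      AlgebraicIndependent ℂ ![f, g]

end GeneralType

/-! ### Arrangements of plane curves -/

/-- The forms `F i` of degree `d` define smooth plane curves that intersect pairwise
transversally. -/
structure IsTransversalArrangement (d : ℕ) {τ : ℕ} (F : Fin τ → MvPolynomial (Fin 3) ℂ) :
    Prop where
  homogeneous : ∀ i, (F i).IsHomogeneous d
  smooth : ∀ i, ∀ p : Fin 3 → ℂ, p ≠ 0 → MvPolynomial.eval p (F i) = 0 → gradient (F i) p ≠ 0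
  transversal : ∀ i j, i ≠ j → ∀ p : Fin 3 → ℂ, p ≠ 0 → MvPolynomial.eval p (F i) = 0 →
    MvPolynomial.eval p (F j) = 0 → LinearIndependent ℂ ![gradient (F i) p, gradient (F j) p]

section Arrangement

variable {τ : ℕ} (F : Fin τ → MvPolynomial (Fin 3) ℂ)

/-- The number `k_P` of curves of the arrangement through the point `P`. -/
def multiplicity (P : Plane) : ℕ := {i : Fin τ | Vanishes (F i) P}.ncard

/-- The number `t_r` of points through which exactly `r` curves of the arrangement pass. -/
def numPoints (r : ℕ) : ℕ∞ := {P : Plane | multiplicity F P = r}.encard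

/-- The essential singularities: the points in which at least three curves meet. -/
def essentialSing : Set Plane := {P | 3 ≤ multiplicity F P}

/-- The pull-back to the surface `Z` over the plane of the plane curve (with multiplicities)
defined by a nonzero form `A` of degree `e`. A local equation at a point is `A / X_i ^ e`, where
`X_i` is any coordinate that does not vanish there; its order is the largest of the orders of
the three functions `A / X_0 ^ e`, `A / X_1 ^ e`, `A / X_2 ^ e`. -/
def pullbackCurve (Z : Set (LocalSubring PlaneField)) (A : MvPolynomial (Fin 3) ℂ) : QDivisor Z :=
  fun V => ((Finset.univ.sup' Finset.univ_nonempty fun i : Fin 3 =>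
    ord V.1 (MvPolynomial.aeval (fun j => coord j / coord i) A) : ℤ) : ℚ)

open Classical in
/-- The exceptional curve `E_P` over the blown-up point `P`: it is the one prime divisor of `Z`
whose local ring dominates the local ring of the plane at `P`. -/
def exceptional (Z : Set (LocalSubring PlaneField)) (P : Plane) : QDivisor Z :=
  fun V => if localRingAt P ≤ V.1 then 1 else 0

/-- The `ℚ`-divisor
`K = π^* K_{ℙ²} + ∑ E_P + (n - 1) / n * (∑ E_P + π^* D - ∑ k_P E_P)`
on the blow-up of the plane at the essential singularities of the arrangement `D`, where the
canonical divisor `K_{ℙ²}` is represented by `-div G` for a nonzero cubic form `G`. -/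
def divisorK (n : ℕ) (G : MvPolynomial (Fin 3) ℂ) : QDivisor (blowUp (essentialSing F)) :=
  -pullbackCurve _ G + (∑ᶠ P ∈ essentialSing F, exceptional _ P) +
    (((n : ℚ) - 1) / n) •
      ((∑ᶠ P ∈ essentialSing F, exceptional _ P) + (∑ i, pullbackCurve _ (F i)) -
        ∑ᶠ P ∈ essentialSing F, (multiplicity F P : ℚ) • exceptional _ P)

/-- The function field of the abelian cover of the plane with group `(ℤ/n)^(τ - 1)` that is branched
with order `n` along the curves of the arrangement: it arises from the function field of the
plane by adjoining all `n`-th roots of the functions `F i / F j`. The cover itself is the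
normalization of the plane in this field. -/
def coverField (n : ℕ) : IntermediateField PlaneField (AlgebraicClosure PlaneField) :=
  IntermediateField.adjoin PlaneField
    {y | ∃ i j : Fin τ, y ^ n = algebraMap PlaneField (AlgebraicClosure PlaneField)
      (generic (F i) / generic (F j))}

end Arrangement

end PlaneArrangement

end

/-! Write `l = (n - 1) / n`. For all rational weights `x_j` with `d ∑ x_j = d τ l - 3`, the divisor
`K` is `ℚ`-linearly equivalent to `∑ x_j π^*C_j - ∑ (l (k_P - 1) - 1) E_P`
(`exists_qLinearlyEquivalent`), because a suitable product of powers of `G` and the `F_j` has degree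
zero. Since the curves are smooth, `π^*C_j` contains `E_P` with multiplicity one if `P ∈ C_j` and
zero otherwise. Positivity of `K` thus becomes a matter of choosing weights.

Nefness. For each integral curve `C` there are nonnegative weights for which the representative is
effective and does not contain `C`; then its intersection with `C` is a sum of nonnegative terms. If
`C` is not exceptional, it is a component of at most one `C_j`, which gets weight zero while the
others share the degree equally (`nef_at_curve`). If `C = E_P`, one weight on the curves through `P`
makes the coefficient of `E_P` vanish, and the remaining curves, which exist because `t_τ = 0`,
carry the rest of the degree (`nef_at_exceptional`).

Bigness. The weights `l - (1 + l) / τ` give an effective divisor, again by `t_τ = 0`, but use less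
than the available degree. In `n τ K` forms of degree `τ d (2n - 1) - 3 n τ > 0` are left over, and
they give sections whose ratios include both affine coordinates (`isSection_divisorK`).

General type. The same leftover forms `B` give the forms `B / ∏ F_j^(2n-1) (dx ∧ dy)^(nτ)` on the
cover. Their regularity is checked at every valuation ring, without a resolution
(`IsLocalArrangement.hasLocalForm`): taking `n`-th roots of quotients of local equations extracts
from `dx ∧ dy` a factor `a` with `a^(nτ)` divisible by `∏ f_j^(2n-1)`.

All this needs the prime divisors of the blow-up. They are the localizations of a chart at a prime
polynomial and the exceptional valuations (`primeDivisor_cases`), where the exceptional valuation is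
the order of vanishing at the point (`mem_maximalIdeal_pow_of_le_ord`). -/

open scoped LinearAlgebra.Projectivization TensorProduct

noncomputable section

namespace PlaneArrangement

/-! ### Discrete valuation rings in a field and the function `ord`. -/

section Discrete

variable {K : Type*} [Field K]

/-- The local subring `V` is the valuation ring of a discrete valuation of the field `K` with
uniformizer `ϖ`. -/
structure IsDiscrete (V : LocalSubring K) (ϖ : K) : Prop where
  mem : ϖ ∈ V.toSubring
  inv_notMem : ϖ⁻¹ ∉ V.toSubring
  exists_zpow : ∀ f : K, f ≠ 0 → ∃ (k : ℤ) (u : K), u ≠ 0 ∧ u ∈ V.toSubring ∧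
    u⁻¹ ∈ V.toSubring ∧ f = ϖ ^ k * u

theorem isUnit_iff_inv_mem {V : LocalSubring K} {f : V.toSubring} (hf : (f : K) ≠ 0) :
    IsUnit f ↔ (f : K)⁻¹ ∈ V.toSubring := by
  constructor
  · intro h
    obtain ⟨g, hg⟩ := h.exists_right_inv
    have h1 : (f : K) * g = 1 := congrArg Subtype.val hg
    rw [← eq_inv_of_mul_eq_one_right h1]
    exact g.2
  · intro h
    refine IsUnit.of_mul_eq_one ⟨_, h⟩ (Subtype.ext ?_)
    exact mul_inv_cancel₀ hf

namespace IsDiscrete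

variable {V : LocalSubring K} {ϖ : K}

theorem ne_zero (h : IsDiscrete V ϖ) : ϖ ≠ 0 := fun h0 =>
  h.inv_notMem (by rw [h0, inv_zero]; exact V.toSubring.zero_mem)

theorem zpow_mul_mem_iff (h : IsDiscrete V ϖ) {k : ℤ} {u : K} (h0 : u ≠ 0)
    (hu : u ∈ V.toSubring) (hu' : u⁻¹ ∈ V.toSubring) : ϖ ^ k * u ∈ V.toSubring ↔ 0 ≤ k := by
  constructor
  · intro hk
    by_contra! hneg
    apply h.inv_notMem
    have h1 : ϖ⁻¹ = ϖ ^ (-k - 1).toNat * (ϖ ^ k * u * u⁻¹) := by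
      rw [mul_inv_cancel_right₀ h0, ← zpow_natCast, ← zpow_add₀ h.ne_zero,
        Int.toNat_of_nonneg (by omega), ← zpow_neg_one]
      congr 1
      ring
    rw [h1]
    exact mul_mem (pow_mem h.mem _) (mul_mem hk hu')
  · intro hk
    lift k to ℕ using hk
    rw [zpow_natCast]
    exact mul_mem (pow_mem h.mem _) hu

theorem maximalIdeal_eq (h : IsDiscrete V ϖ) :
    IsLocalRing.maximalIdeal V.toSubring = Ideal.span {⟨ϖ, h.mem⟩} := by
  ext f
  rw [IsLocalRing.mem_maximalIdeal, mem_nonunits_iff, Ideal.mem_span_singleton]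
  by_cases hf : (f : K) = 0
  · have : f = 0 := Subtype.ext hf
    simp [this]
  · rw [isUnit_iff_inv_mem hf]
    obtain ⟨k, u, h0, hu, hu', hk⟩ := h.exists_zpow _ hf
    have hk0 : 0 ≤ k := (h.zpow_mul_mem_iff h0 hu hu').1 (hk ▸ f.2)
    have hinv : (f : K)⁻¹ = ϖ ^ (-k) * u⁻¹ := by rw [hk, mul_inv, zpow_neg]
    rw [hinv, h.zpow_mul_mem_iff (inv_ne_zero h0) hu' (by rwa [inv_inv])]
    constructor
    · intro hk1
      refine ⟨⟨ϖ ^ (k - 1) * u, (h.zpow_mul_mem_iff h0 hu hu').2 (by omega)⟩, Subtype.ext ?_⟩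
      change (f : K) = ϖ * (ϖ ^ (k - 1) * u)
      rw [hk, ← mul_assoc, ← zpow_one_add₀ h.ne_zero]
      congr 2
      ring
    · rintro ⟨g, hg⟩ hk1
      have hk2 : k = 0 := by omega
      have h1 : (f : K) = ϖ * g := congrArg Subtype.val hg
      apply h.inv_notMem
      have h2 : ϖ⁻¹ = g * u⁻¹ := by
        rw [hk2, zpow_zero, one_mul] at hk
        rw [← hk, h1, mul_inv, mul_comm ϖ⁻¹, ← mul_assoc, mul_inv_cancel₀, one_mul]
        rintro h3
        rw [h3, mul_zero] at h1
        exact hf h1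
      rw [h2]
      exact mul_mem g.2 hu'

theorem hasOrd_zpow_mul (h : IsDiscrete V ϖ) (k : ℤ) {u : K} (h0 : u ≠ 0)
    (hu : u ∈ V.toSubring) (hu' : u⁻¹ ∈ V.toSubring) : HasOrd V (ϖ ^ k * u) k :=
  ⟨⟨ϖ, h.mem⟩, ⟨u, hu⟩, h.maximalIdeal_eq, (isUnit_iff_inv_mem h0).2 hu', rfl⟩

/-- Any two uniformizers are associated, so the unspecified one in `HasOrd` can be exchanged for
`ϖ`. This makes the choice in `ord` harmless. -/
theorem exists_of_hasOrd (h : IsDiscrete V ϖ) {f : K} {k : ℤ} (hf : HasOrd V f k) :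
    ∃ u : K, u ≠ 0 ∧ u ∈ V.toSubring ∧ u⁻¹ ∈ V.toSubring ∧ f = ϖ ^ k * u := by
  obtain ⟨π, u, hπ, hu, rfl⟩ := hf
  rw [h.maximalIdeal_eq, Ideal.span_singleton_eq_span_singleton] at hπ
  obtain ⟨v, hv⟩ := hπ
  have hv' : (π : K) = ϖ * (v : V.toSubring) := (congrArg Subtype.val hv).symm
  have hw : IsUnit ((v ^ k : V.toSubringˣ) * u : V.toSubring) := (Units.isUnit _).mul hu
  have hval : (((v ^ k : V.toSubringˣ) : V.toSubring) : K) = ((v : V.toSubring) : K) ^ k := by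
    have := map_zpow (Units.map (V.toSubring.subtype : V.toSubring →* K)) v k
    have h2 := congrArg Units.val this
    rw [Units.val_zpow_eq_zpow_val] at h2
    exact h2
  have hne : ((((v ^ k : V.toSubringˣ) : V.toSubring) * u : V.toSubring) : K) ≠ 0 := by
    intro h3
    exact hw.ne_zero (Subtype.ext h3)
  refine ⟨_, hne, Subtype.prop _, (isUnit_iff_inv_mem hne).1 hw, ?_⟩
  change _ = ϖ ^ k * ((((v ^ k : V.toSubringˣ) : V.toSubring) : K) * u)
  rw [hval, hv', mul_zpow, mul_assoc]

theorem zpow_mul_injective (h : IsDiscrete V ϖ) {k l : ℤ} {u v : K} (hu0 : u ≠ 0)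
    (hu : u ∈ V.toSubring) (hu' : u⁻¹ ∈ V.toSubring) (hv0 : v ≠ 0)
    (hv : v ∈ V.toSubring) (hv' : v⁻¹ ∈ V.toSubring) (he : ϖ ^ k * u = ϖ ^ l * v) : k = l := by
  have key : ∀ {k l : ℤ} {u v : K}, u ≠ 0 → u ∈ V.toSubring → u⁻¹ ∈ V.toSubring → v ≠ 0 →
      v ∈ V.toSubring → v⁻¹ ∈ V.toSubring → ϖ ^ k * u = ϖ ^ l * v → l ≤ k := by
    intro k l u v hu0 hu hu' hv0 hv hv' he
    have h1 : v = ϖ ^ (k - l) * u := by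
      rw [zpow_sub₀ h.ne_zero, div_mul_eq_mul_div, he, mul_div_cancel_left₀ _
        (zpow_ne_zero _ h.ne_zero)]
    rw [h1, h.zpow_mul_mem_iff hu0 hu hu'] at hv
    omega
  exact le_antisymm (key hv0 hv hv' hu0 hu hu' he.symm) (key hu0 hu hu' hv0 hv hv' he)

theorem ord_zpow_mul (h : IsDiscrete V ϖ) (k : ℤ) {u : K} (h0 : u ≠ 0)
    (hu : u ∈ V.toSubring) (hu' : u⁻¹ ∈ V.toSubring) : ord V (ϖ ^ k * u) = k := by
  have hex : ∃ k', HasOrd V (ϖ ^ k * u) k' := ⟨k, h.hasOrd_zpow_mul k h0 hu hu'⟩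
  rw [ord, dif_pos hex]
  obtain ⟨v, hv0, hv, hv', he⟩ := h.exists_of_hasOrd hex.choose_spec
  exact (h.zpow_mul_injective h0 hu hu' hv0 hv hv' he).symm

theorem ord_mul (h : IsDiscrete V ϖ) {f g : K} (hf : f ≠ 0) (hg : g ≠ 0) :
    ord V (f * g) = ord V f + ord V g := by
  obtain ⟨k, u, hu0, hu, hu', rfl⟩ := h.exists_zpow f hf
  obtain ⟨l, v, hv0, hv, hv', rfl⟩ := h.exists_zpow g hg
  rw [h.ord_zpow_mul k hu0 hu hu', h.ord_zpow_mul l hv0 hv hv', mul_mul_mul_comm,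
    ← zpow_add₀ h.ne_zero]
  exact h.ord_zpow_mul _ (mul_ne_zero hu0 hv0) (mul_mem hu hv)
    (by rw [mul_inv]; exact mul_mem hu' hv')

theorem ord_one (h : IsDiscrete V ϖ) : ord V (1 : K) = 0 := by
  have := h.ord_mul (one_ne_zero (α := K)) one_ne_zero
  rw [mul_one] at this
  omega

theorem ord_inv (h : IsDiscrete V ϖ) {f : K} (hf : f ≠ 0) : ord V f⁻¹ = -ord V f := by
  have := h.ord_mul hf (inv_ne_zero hf)
  rw [mul_inv_cancel₀ hf, h.ord_one] at this
  omega

theorem ord_div (h : IsDiscrete V ϖ) {f g : K} (hf : f ≠ 0) (hg : g ≠ 0) :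
    ord V (f / g) = ord V f - ord V g := by
  rw [div_eq_mul_inv, h.ord_mul hf (inv_ne_zero hg), h.ord_inv hg, sub_eq_add_neg]

theorem ord_pow (h : IsDiscrete V ϖ) {f : K} (hf : f ≠ 0) (k : ℕ) :
    ord V (f ^ k) = k * ord V f := by
  induction k with
  | zero => simp [h.ord_one]
  | succ k ih =>
    rw [pow_succ, h.ord_mul (pow_ne_zero _ hf) hf, ih]
    push_cast
    ring

theorem ord_zpow (h : IsDiscrete V ϖ) {f : K} (hf : f ≠ 0) (k : ℤ) :
    ord V (f ^ k) = k * ord V f := by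
  obtain ⟨k, rfl | rfl⟩ := k.eq_nat_or_neg
  · rw [zpow_natCast, h.ord_pow hf]
  · rw [zpow_neg, zpow_natCast, h.ord_inv (pow_ne_zero _ hf), h.ord_pow hf, neg_mul]

theorem ord_prod (h : IsDiscrete V ϖ) {ι : Type*} (s : Finset ι) {f : ι → K}
    (hf : ∀ i ∈ s, f i ≠ 0) : ord V (∏ i ∈ s, f i) = ∑ i ∈ s, ord V (f i) := by
  classical
  induction s using Finset.induction_on with
  | empty => simp [h.ord_one]
  | insert a s ha ih =>
    rw [Finset.prod_insert ha, Finset.sum_insert ha,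
      h.ord_mul (hf a (Finset.mem_insert_self _ _))
        (Finset.prod_ne_zero_iff.2 fun i hi => hf i (Finset.mem_insert_of_mem hi)),
      ih fun i hi => hf i (Finset.mem_insert_of_mem hi)]

theorem ord_nonneg_iff (h : IsDiscrete V ϖ) {f : K} (hf : f ≠ 0) :
    0 ≤ ord V f ↔ f ∈ V.toSubring := by
  obtain ⟨k, u, hu0, hu, hu', rfl⟩ := h.exists_zpow f hf
  rw [h.ord_zpow_mul k hu0 hu hu', h.zpow_mul_mem_iff hu0 hu hu']

theorem ord_pos_iff (h : IsDiscrete V ϖ) {f : K} (hf : f ≠ 0) :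
    0 < ord V f ↔ f⁻¹ ∉ V.toSubring := by
  rw [← h.ord_nonneg_iff (inv_ne_zero hf), h.ord_inv hf]
  omega

end IsDiscrete

end Discrete

/-! ### Localization of a domain at a prime element, inside a field. -/

section PrimeLocal

variable {D K : Type*} [CommRing D] [Field K] (θ : D →+* K)

theorem map_ne_zero_of_not_dvd {θ : D →+* K} (hθ : Function.Injective θ) {π b : D}
    (hb : ¬ π ∣ b) : θ b ≠ 0 := by
  rw [map_ne_zero_iff θ hθ]
  rintro rfl
  exact hb (dvd_zero π)

/-- The fractions `θ a / θ b` with `b` not divisible by the prime element `π`. -/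
def primeSubring (hθ : Function.Injective θ) {π : D} (hπ : Prime π) : Subring K where
  carrier := {f | ∃ a b : D, ¬ π ∣ b ∧ f = θ a / θ b}
  mul_mem' := by
    rintro _ _ ⟨a, b, hb, rfl⟩ ⟨a', b', hb', rfl⟩
    exact ⟨a * a', b * b', fun h => (hπ.dvd_or_dvd h).elim hb hb', by
      rw [map_mul, map_mul, div_mul_div_comm]⟩
  one_mem' := ⟨1, 1, hπ.not_dvd_one, by simp⟩
  add_mem' := by
    rintro _ _ ⟨a, b, hb, rfl⟩ ⟨a', b', hb', rfl⟩
    refine ⟨a * b' + b * a', b * b', fun h => (hπ.dvd_or_dvd h).elim hb hb', ?_⟩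
    rw [div_add_div _ _ (map_ne_zero_of_not_dvd hθ hb) (map_ne_zero_of_not_dvd hθ hb')]
    simp only [map_mul, map_add]
  zero_mem' := ⟨0, 1, hπ.not_dvd_one, by simp⟩
  neg_mem' := by
    rintro _ ⟨a, b, hb, rfl⟩
    exact ⟨-a, b, hb, by rw [map_neg, neg_div]⟩

instance primeSubring_isLocalRing (hθ : Function.Injective θ) {π : D} (hπ : Prime π) :
    IsLocalRing (primeSubring θ hθ hπ) := by
  refine IsLocalRing.of_isUnit_or_isUnit_one_sub_self fun f => ?_
  have key : ∀ (g : primeSubring θ hθ hπ) (a b : D), ¬ π ∣ a → ¬ π ∣ b →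
      (g : K) = θ a / θ b → IsUnit g := by
    intro g a b ha hb hg
    refine IsUnit.of_mul_eq_one ⟨θ b / θ a, b, a, ha, rfl⟩ (Subtype.ext ?_)
    change (g : K) * (θ b / θ a) = 1
    have h1 := map_ne_zero_of_not_dvd hθ ha
    have h2 := map_ne_zero_of_not_dvd hθ hb
    rw [hg]
    field_simp
  obtain ⟨a, b, hb, hf⟩ := f.2
  by_cases ha : π ∣ a
  · right
    refine key _ (b - a) b (fun h => hb ((dvd_sub_left ha).1 h)) hb ?_
    change (1 : K) - f = _
    have h2 := map_ne_zero_of_not_dvd hθ hb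
    rw [hf, map_sub, sub_div, div_self h2]
  · left
    exact key f a b ha hb hf

/-- The localization of `D` at the prime element `π`, as a local subring of `K`. -/
def primeLocal (hθ : Function.Injective θ) {π : D} (hπ : Prime π) : LocalSubring K :=
  { toSubring := primeSubring θ hθ hπ }

variable {θ} (hθ : Function.Injective θ) {π : D} (hπ : Prime π)

theorem mem_primeLocal {f : K} :
    f ∈ (primeLocal θ hθ hπ).toSubring ↔ ∃ a b : D, ¬ π ∣ b ∧ f = θ a / θ b := Iff.rfl

theorem map_mem_primeLocal (a : D) : θ a ∈ (primeLocal θ hθ hπ).toSubring :=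
  ⟨a, 1, hπ.not_dvd_one, by simp⟩

theorem inv_map_mem_primeLocal {b : D} (hb : ¬ π ∣ b) :
    (θ b)⁻¹ ∈ (primeLocal θ hθ hπ).toSubring :=
  ⟨1, b, hb, by simp⟩

theorem inv_map_mem_primeLocal_iff {b : D} (h0 : b ≠ 0) :
    (θ b)⁻¹ ∈ (primeLocal θ hθ hπ).toSubring ↔ ¬ π ∣ b := by
  refine ⟨?_, inv_map_mem_primeLocal hθ hπ⟩
  rintro ⟨c, e, he, h⟩ hb
  have h1 := map_ne_zero_of_not_dvd hθ he
  have h2 : θ b ≠ 0 := (map_ne_zero_iff θ hθ).2 h0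
  apply he
  have h3 : e = b * c := by
    apply hθ
    rw [eq_div_iff h1] at h
    rw [map_mul, ← h, mul_inv_cancel_left₀ h2]
  rw [h3]
  exact hb.mul_right c

/-- Prime factors are unique only up to units; this lets a finite list of factors account for all
divisors in a support. -/
theorem primeLocal_congr {π' : D} (hπ' : Prime π') (h : Associated π π') :
    primeLocal θ hθ hπ = primeLocal θ hθ hπ' := by
  apply LocalSubring.toSubring_injective
  ext f
  rw [mem_primeLocal, mem_primeLocal]
  simp only [h.dvd_iff_dvd_left]

variable [IsDomain D] [WfDvdMonoid D] (hfrac : ∀ f : K, ∃ a b : D, b ≠ 0 ∧ f = θ a / θ b)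
include hfrac

theorem isDiscrete_primeLocal : IsDiscrete (primeLocal θ hθ hπ) (θ π) where
  mem := map_mem_primeLocal hθ hπ π
  inv_notMem h := (inv_map_mem_primeLocal_iff hθ hπ hπ.ne_zero).1 h dvd_rfl
  exists_zpow f hf := by
    obtain ⟨a, b, hb, rfl⟩ := hfrac f
    have ha : a ≠ 0 := by
      rintro rfl
      simp at hf
    obtain ⟨k, a', ha', rfl⟩ := WfDvdMonoid.max_power_factor ha hπ.irreducible
    obtain ⟨l, b', hb', rfl⟩ := WfDvdMonoid.max_power_factor hb hπ.irreducible
    have h1 := map_ne_zero_of_not_dvd hθ ha'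
    have h2 := map_ne_zero_of_not_dvd hθ hb'
    have h3 : θ π ≠ 0 := (map_ne_zero_iff θ hθ).2 hπ.ne_zero
    refine ⟨k - l, θ a' / θ b', div_ne_zero h1 h2, ⟨a', b', hb', rfl⟩,
      ⟨b', a', ha', inv_div _ _⟩, ?_⟩
    rw [zpow_sub₀ h3, zpow_natCast, zpow_natCast, div_mul_div_comm]
    simp only [map_mul, map_pow]

theorem le_ord_primeLocal_iff {a : D} (ha : a ≠ 0) (k : ℕ) :
    (k : ℤ) ≤ ord (primeLocal θ hθ hπ) (θ a) ↔ π ^ k ∣ a := by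
  have hd := isDiscrete_primeLocal hθ hπ hfrac
  obtain ⟨l, a', ha', rfl⟩ := WfDvdMonoid.max_power_factor ha hπ.irreducible
  have h1 : ord (primeLocal θ hθ hπ) (θ (π ^ l * a')) = l := by
    have := hd.ord_zpow_mul l (map_ne_zero_of_not_dvd hθ ha') (map_mem_primeLocal hθ hπ a')
      (inv_map_mem_primeLocal hθ hπ ha')
    rwa [zpow_natCast, ← map_pow, ← map_mul] at this
  rw [h1, Nat.cast_le]
  constructor
  · intro h
    exact (pow_dvd_pow π h).mul_right a'
  · intro h
    by_contra! hlt
    apply ha'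
    have h2 : π ^ l * π ∣ π ^ l * a' := by
      rw [← pow_succ]
      exact (pow_dvd_pow π hlt).trans h
    exact (mul_dvd_mul_iff_left (pow_ne_zero l hπ.ne_zero)).1 h2

theorem ord_primeLocal_pos_iff {a : D} (ha : a ≠ 0) :
    0 < ord (primeLocal θ hθ hπ) (θ a) ↔ π ∣ a := by
  have := le_ord_primeLocal_iff hθ hπ hfrac ha 1
  rw [pow_one] at this
  rw [← this]
  exact Iff.rfl

end PrimeLocal

/-! ### Affine charts, homogenization, and local rings in affine coordinates. -/

section Charts

theorem coord_ne_zero (i : Fin 3) : coord i ≠ 0 := by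
  have h := IsFractionRing.injective (MvPolynomial (Fin 2) ℂ) PlaneField
  fin_cases i
  · simp [coord]
  · simp [coord, MvPolynomial.X_ne_zero]
  · simp [coord, MvPolynomial.X_ne_zero]

/-- The coordinate ring of the affine plane where the `i`-th homogeneous coordinate is not zero,
as a subring of the function field. -/
def chart (i : Fin 3) : MvPolynomial (Fin 2) ℂ →ₐ[ℂ] PlaneField :=
  MvPolynomial.aeval fun a => coord (i.succAbove a) / coord i

/-- Setting the `i`-th homogeneous coordinate equal to one. -/
def dehom (i : Fin 3) : MvPolynomial (Fin 3) ℂ →ₐ[ℂ] MvPolynomial (Fin 2) ℂ :=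
  MvPolynomial.aeval (i.insertNth 1 MvPolynomial.X)

@[simp]
theorem dehom_X_self (i : Fin 3) : dehom i (MvPolynomial.X i) = 1 := by
  simp [dehom]

@[simp]
theorem dehom_X_succAbove (i : Fin 3) (a : Fin 2) :
    dehom i (MvPolynomial.X (i.succAbove a)) = MvPolynomial.X a := by
  simp [dehom]

theorem chart_dehom (i : Fin 3) (A : MvPolynomial (Fin 3) ℂ) :
    chart i (dehom i A) = MvPolynomial.aeval (fun j => coord j / coord i) A := by
  rw [dehom, MvPolynomial.comp_aeval_apply]
  congr 2
  funext j
  refine i.succAboveCases ?_ (fun a => ?_) j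
  · simp [div_self (coord_ne_zero i)]
  · simp [chart]

theorem generic_eq (i : Fin 3) {k : ℕ} {A : MvPolynomial (Fin 3) ℂ} (hA : A.IsHomogeneous k) :
    generic A = coord i ^ k * chart i (dehom i A) := by
  rw [chart_dehom, ← aeval_mul_of_isHomogeneous hA]
  simp only [mul_div_cancel₀ _ (coord_ne_zero i)]
  rfl

theorem exists_dehom_eq (i : Fin 3) (a : MvPolynomial (Fin 2) ℂ) :
    ∃ (k : ℕ) (A : MvPolynomial (Fin 3) ℂ), A.IsHomogeneous k ∧ dehom i A = a := by
  induction a using MvPolynomial.induction_on with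
  | C c => exact ⟨0, MvPolynomial.C c, MvPolynomial.isHomogeneous_C _ _, by simp [dehom]⟩
  | add a b ha hb =>
    obtain ⟨k, A, hA, rfl⟩ := ha
    obtain ⟨l, B, hB, rfl⟩ := hb
    refine ⟨k + l, A * MvPolynomial.X i ^ l + MvPolynomial.X i ^ k * B,
      (hA.mul (MvPolynomial.isHomogeneous_X_pow i l)).add
        ((MvPolynomial.isHomogeneous_X_pow i k).mul hB), by simp⟩
  | mul_X a j ha =>
    obtain ⟨k, A, hA, rfl⟩ := ha
    exact ⟨k + 1, A * MvPolynomial.X (i.succAbove j), hA.mul (MvPolynomial.isHomogeneous_X _ _),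
      by simp⟩

theorem exists_dehom_eq_pair (i : Fin 3) (a b : MvPolynomial (Fin 2) ℂ) :
    ∃ (k : ℕ) (A B : MvPolynomial (Fin 3) ℂ), A.IsHomogeneous k ∧ B.IsHomogeneous k ∧
      dehom i A = a ∧ dehom i B = b := by
  obtain ⟨k, A, hA, rfl⟩ := exists_dehom_eq i a
  obtain ⟨l, B, hB, rfl⟩ := exists_dehom_eq i b
  exact ⟨k + l, A * MvPolynomial.X i ^ l, MvPolynomial.X i ^ k * B,
    hA.mul (MvPolynomial.isHomogeneous_X_pow i l), (MvPolynomial.isHomogeneous_X_pow i k).mul hB,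
    by simp, by simp⟩

theorem chart_injective (i : Fin 3) : Function.Injective (chart i) := by
  rw [injective_iff_map_eq_zero]
  intro a ha
  obtain ⟨k, A, hA, rfl⟩ := exists_dehom_eq i a
  by_contra h0
  have hA0 : A ≠ 0 := by
    rintro rfl
    simp at h0
  apply generic_ne_zero hA hA0
  rw [generic_eq i hA, ha, mul_zero]

theorem dehom_ne_zero (i : Fin 3) {k : ℕ} {A : MvPolynomial (Fin 3) ℂ} (hA : A.IsHomogeneous k)
    (h0 : A ≠ 0) : dehom i A ≠ 0 := by
  intro h
  apply generic_ne_zero hA h0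
  rw [generic_eq i hA, h, map_zero, mul_zero]

theorem chart_zero_eq (a : MvPolynomial (Fin 2) ℂ) :
    chart 0 a = algebraMap (MvPolynomial (Fin 2) ℂ) PlaneField a := by
  have h : chart 0 = IsScalarTower.toAlgHom ℂ (MvPolynomial (Fin 2) ℂ) PlaneField := by
    apply MvPolynomial.algHom_ext
    intro j
    fin_cases j <;> simp [chart, coord]
  rw [h]
  rfl

theorem generic_div_generic (i : Fin 3) {k : ℕ} {A B : MvPolynomial (Fin 3) ℂ}
    (hA : A.IsHomogeneous k) (hB : B.IsHomogeneous k) :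
    generic A / generic B = chart i (dehom i A) / chart i (dehom i B) := by
  rw [generic_eq i hA, generic_eq i hB, mul_div_mul_left _ _ (pow_ne_zero _ (coord_ne_zero i))]

/-- The function field is the fraction field of chart `0`. A fraction there homogenizes to a
quotient of forms of equal degree, and this can be dehomogenized in any chart. -/
theorem exists_chart_div (i : Fin 3) (f : PlaneField) :
    ∃ a b : MvPolynomial (Fin 2) ℂ, b ≠ 0 ∧ f = chart i a / chart i b := by
  obtain ⟨a, b, hb, rfl⟩ := IsFractionRing.div_surjective (A := MvPolynomial (Fin 2) ℂ) f
  obtain ⟨k, A, B, hA, hB, rfl, rfl⟩ := exists_dehom_eq_pair 0 a b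
  refine ⟨dehom i A, dehom i B, dehom_ne_zero i hB ?_, ?_⟩
  · rintro rfl
    simp at hb
  · rw [← chart_zero_eq, ← chart_zero_eq, ← generic_div_generic 0 hA hB,
      ← generic_div_generic i hA hB]

/-- The affine coordinates of a point at which the `i`-th homogeneous coordinate is not zero. -/
def affinePoint (i : Fin 3) (p : Fin 3 → ℂ) : Fin 2 → ℂ := fun a => p (i.succAbove a) / p i

theorem eval_dehom (i : Fin 3) (q : Fin 2 → ℂ) (A : MvPolynomial (Fin 3) ℂ) :
    MvPolynomial.eval q (dehom i A) = MvPolynomial.eval (i.insertNth (1 : ℂ) q) A := by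
  have h : (MvPolynomial.aeval q).comp (dehom i) =
      (MvPolynomial.aeval (i.insertNth (1 : ℂ) q) : MvPolynomial (Fin 3) ℂ →ₐ[ℂ] ℂ) := by
    apply MvPolynomial.algHom_ext
    intro j
    refine i.succAboveCases ?_ (fun a => ?_) j
    · simp
    · simp
  exact DFunLike.congr_fun h A

theorem eval_eq_pow_mul {i : Fin 3} {p : Fin 3 → ℂ} (hp : p i ≠ 0) {k : ℕ}
    {A : MvPolynomial (Fin 3) ℂ} (hA : A.IsHomogeneous k) :
    MvPolynomial.eval p A = p i ^ k * MvPolynomial.eval (affinePoint i p) (dehom i A) := by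
  rw [eval_dehom]
  have h := aeval_mul_of_isHomogeneous hA (p i) (i.insertNth (1 : ℂ) (affinePoint i p))
  simp only [MvPolynomial.aeval_eq_eval] at h
  refine Eq.trans ?_ h
  congr 2
  funext j
  refine i.succAboveCases ?_ (fun a => ?_) j
  · simp
  · simp [affinePoint, mul_div_cancel₀ _ hp]

theorem eval_dehom_eq_zero_iff {i : Fin 3} {p : Fin 3 → ℂ} (hp : p i ≠ 0) {k : ℕ}
    {A : MvPolynomial (Fin 3) ℂ} (hA : A.IsHomogeneous k) :
    MvPolynomial.eval (affinePoint i p) (dehom i A) = 0 ↔ MvPolynomial.eval p A = 0 := by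
  rw [eval_eq_pow_mul hp hA, mul_eq_zero, or_iff_right (pow_ne_zero _ hp)]

theorem mem_localRingAt {P : Plane} {i : Fin 3} (hi : P.rep i ≠ 0) {f : PlaneField} :
    f ∈ (localRingAt P).toSubring ↔ ∃ a b : MvPolynomial (Fin 2) ℂ,
      MvPolynomial.eval (affinePoint i P.rep) b ≠ 0 ∧ f = chart i a / chart i b := by
  constructor
  · rintro ⟨k, A, B, hA, hB, hP, rfl⟩
    exact ⟨dehom i A, dehom i B, by rwa [Ne, eval_dehom_eq_zero_iff hi hB],
      generic_div_generic i hA hB⟩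
  · rintro ⟨a, b, hb, rfl⟩
    obtain ⟨k, A, B, hA, hB, rfl, rfl⟩ := exists_dehom_eq_pair i a b
    exact ⟨k, A, B, hA, hB, by rwa [Vanishes, ← eval_dehom_eq_zero_iff hi hB],
      (generic_div_generic i hA hB).symm⟩

theorem exists_rep_ne_zero (P : Plane) : ∃ i, P.rep i ≠ 0 := by
  by_contra! h
  exact P.rep_nonzero (funext h)

end Charts

/-! ### The blow-up of a point in coordinates; order along the exceptional curve. -/

section BlowUpChart

open MvPolynomial

/-- First order Taylor expansion of a polynomial in two variables. -/
theorem exists_taylor (q : Fin 2 → ℂ) (a : MvPolynomial (Fin 2) ℂ) :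
    ∃ α β : MvPolynomial (Fin 2) ℂ,
      a = C (eval q a) + (X 0 - C (q 0)) * α + (X 1 - C (q 1)) * β := by
  induction a using MvPolynomial.induction_on with
  | C c => exact ⟨0, 0, by simp⟩
  | add a b ha hb =>
    obtain ⟨α, β, h⟩ := ha
    obtain ⟨α', β', h'⟩ := hb
    refine ⟨α + α', β + β', ?_⟩
    rw [map_add, map_add]
    linear_combination h + h'
  | mul_X a j ha =>
    obtain ⟨α, β, h⟩ := ha
    rw [map_mul, eval_X, map_mul]
    fin_cases j
    · exact ⟨α * X 0 + C (eval q a), β * X 0, by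
        simp only [Fin.zero_eta]; linear_combination X 0 * h⟩
    · exact ⟨α * X 1, β * X 1 + C (eval q a), by
        simp only [Fin.mk_one]; linear_combination X 1 * h⟩

theorem eval_pderiv_of_taylor {q : Fin 2 → ℂ} {a α β : MvPolynomial (Fin 2) ℂ} {c : ℂ}
    (h : a = C c + (X 0 - C (q 0)) * α + (X 1 - C (q 1)) * β) :
    eval q (pderiv 0 a) = eval q α ∧ eval q (pderiv 1 a) = eval q β := by
  rw [h]
  constructor <;> simp [Derivation.leibniz, pderiv_X]

/-- The ideal of polynomials vanishing at `q`. -/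
def pointIdeal (q : Fin 2 → ℂ) : Ideal (MvPolynomial (Fin 2) ℂ) :=
  Ideal.span {X 0 - C (q 0), X 1 - C (q 1)}

theorem mem_pointIdeal {q : Fin 2 → ℂ} {a : MvPolynomial (Fin 2) ℂ} :
    a ∈ pointIdeal q ↔ eval q a = 0 := by
  constructor
  · intro h
    obtain ⟨u, v, rfl⟩ := Ideal.mem_span_pair.1 h
    simp
  · intro h
    obtain ⟨α, β, h'⟩ := exists_taylor q a
    rw [h', h, map_zero, zero_add]
    exact Ideal.mem_span_pair.2 ⟨α, β, by ring⟩

/-- The substitution `x ↦ x`, `y ↦ x y`. -/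
def blowSubst : MvPolynomial (Fin 2) ℂ →ₐ[ℂ] MvPolynomial (Fin 2) ℂ := aeval ![X 0, X 0 * X 1]

/-- The effect of `blowSubst` on exponents. -/
def blowExponent (e : Fin 2 →₀ ℕ) : Fin 2 →₀ ℕ := e + Finsupp.single 0 (e 1)

theorem blowExponent_injective : Function.Injective blowExponent := by
  intro e e' h
  have h0 := DFunLike.congr_fun h 0
  have h1 := DFunLike.congr_fun h 1
  simp only [blowExponent, Finsupp.add_apply, Finsupp.single_eq_same, ne_eq, one_ne_zero,
    not_false_eq_true, Finsupp.single_eq_of_ne, add_zero] at h0 h1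
  ext j
  fin_cases j
  · simp only [Fin.zero_eta]; omega
  · simpa using h1

theorem blowSubst_monomial (e : Fin 2 →₀ ℕ) (c : ℂ) :
    blowSubst (monomial e c) = monomial (blowExponent e) c := by
  rw [blowSubst, aeval_monomial, monomial_eq, algebraMap_eq, Finsupp.prod_fintype _ _ (by simp),
    Finsupp.prod_fintype _ _ (by simp)]
  simp [blowExponent, Fin.prod_univ_two]
  exact Or.inl (by ring)

theorem coeff_blowSubst (e : Fin 2 →₀ ℕ) (a : MvPolynomial (Fin 2) ℂ) :
    coeff (blowExponent e) (blowSubst a) = coeff e a := by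
  induction a using MvPolynomial.induction_on' with
  | monomial e' c =>
    rw [blowSubst_monomial, coeff_monomial, coeff_monomial]
    simp only [blowExponent_injective.eq_iff]
  | add a b ha hb => rw [map_add, coeff_add, coeff_add, ha, hb]

/-- Translation of the origin to the point `q`. -/
def shift (q : Fin 2 → ℂ) : MvPolynomial (Fin 2) ℂ →ₐ[ℂ] MvPolynomial (Fin 2) ℂ :=
  aeval fun j => X j + C (q j)

theorem shift_neg_shift (q : Fin 2 → ℂ) (a : MvPolynomial (Fin 2) ℂ) :
    shift (-q) (shift q a) = a := by
  have h : (shift (-q)).comp (shift q) = AlgHom.id ℂ _ := by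
    apply algHom_ext
    intro j
    simp [shift]
  exact DFunLike.congr_fun h a

/-- The monomial `x^a y^b` goes to `x^(a+b) y^b`, and distinct monomials stay distinct. Hence
nothing cancels, and the power of `x` in the image is the least total degree of a monomial. -/
theorem mem_pow_of_X_pow_dvd {k : ℕ} {a : MvPolynomial (Fin 2) ℂ}
    (h : X 0 ^ k ∣ blowSubst a) :
    a ∈ Ideal.span {X 0, X 1} ^ k := by
  rw [a.as_sum]
  refine Ideal.sum_mem _ fun e he => ?_
  have hk : k ≤ e 0 + e 1 := by
    obtain ⟨b, hb⟩ := h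
    by_contra! hlt
    rw [mem_support_iff, ← coeff_blowSubst, hb, X_pow_eq_monomial, coeff_monomial_mul',
      if_neg] at he
    · exact he rfl
    · intro h2
      have := h2 0
      simp [blowExponent] at this
      omega
  refine Ideal.pow_le_pow_right hk ?_
  rw [monomial_eq, Finsupp.prod_fintype _ _ (by simp), Fin.prod_univ_two, pow_add]
  exact Ideal.mul_mem_left _ _ (Ideal.mul_mem_mul
    (Ideal.pow_mem_pow (Ideal.subset_span (by simp)) _)
    (Ideal.pow_mem_pow (Ideal.subset_span (by simp)) _))

theorem mem_pointIdeal_pow {q : Fin 2 → ℂ} {k : ℕ} {a : MvPolynomial (Fin 2) ℂ}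
    (h : X 0 ^ k ∣ blowSubst (shift q a)) : a ∈ pointIdeal q ^ k := by
  have h1 := Ideal.mem_map_of_mem (shift (-q)) (mem_pow_of_X_pow_dvd h)
  rw [shift_neg_shift, Ideal.map_pow, Ideal.map_span] at h1
  convert h1 using 3
  simp [pointIdeal, Set.image_pair, shift, sub_eq_add_neg]

theorem blowSubst_injective : Function.Injective blowSubst := by
  intro a b h
  ext e
  rw [← coeff_blowSubst, h, coeff_blowSubst]

theorem shift_injective (q : Fin 2 → ℂ) : Function.Injective (shift q) :=
  Function.LeftInverse.injective (shift_neg_shift q)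

theorem exists_X_pow_mul_eq_blowSubst (b : MvPolynomial (Fin 2) ℂ) :
    ∃ (k : ℕ) (a : MvPolynomial (Fin 2) ℂ), X 0 ^ k * b = blowSubst a := by
  induction b using MvPolynomial.induction_on with
  | C c => exact ⟨0, C c, by simp [blowSubst]⟩
  | add b b' hb hb' =>
    obtain ⟨k, a, h⟩ := hb
    obtain ⟨k', a', h'⟩ := hb'
    refine ⟨k + k', X 0 ^ k' * a + X 0 ^ k * a', ?_⟩
    have hX : blowSubst (X 0) = X 0 := by simp [blowSubst]
    rw [map_add, map_mul, map_mul, map_pow, map_pow, hX, ← h, ← h']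
    ring
  | mul_X b j hb =>
    obtain ⟨k, a, h⟩ := hb
    -- With one more factor `x`, the product `x * x` is the image of `x ^ 2`, and `x * y` is the
    -- image of `y`.
    refine ⟨k + 1, a * ![X 0 ^ 2, X 1] j, ?_⟩
    rw [map_mul, ← h]
    fin_cases j <;> simp [blowSubst] <;> ring

/-- The affine chart with coordinates `x - q₀` and `(y - q₁) / (x - q₀)` of the blow-up of the
point `q` in the `i`-th affine chart of the plane. -/
def blowChart (i : Fin 3) (q : Fin 2 → ℂ) : MvPolynomial (Fin 2) ℂ →ₐ[ℂ] PlaneField :=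
  aeval ![chart i (X 0 - C (q 0)), chart i (X 1 - C (q 1)) / chart i (X 0 - C (q 0))]

theorem X_sub_C_ne_zero (j : Fin 2) (c : ℂ) : (X j - C c : MvPolynomial (Fin 2) ℂ) ≠ 0 := by
  intro h
  have := congrArg (eval fun _ => c + 1) h
  simp at this

theorem blowChart_blowSubst (i : Fin 3) (q : Fin 2 → ℂ) (a : MvPolynomial (Fin 2) ℂ) :
    blowChart i q (blowSubst (shift q a)) = chart i a := by
  have h : ((blowChart i q).comp blowSubst).comp (shift q) = chart i := by
    apply algHom_ext
    intro j
    have h0 : chart i (X 0 - C (q 0)) ≠ 0 :=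
      (map_ne_zero_iff _ (chart_injective i)).2 (X_sub_C_ne_zero _ _)
    fin_cases j
    · simp [shift, blowSubst, blowChart, ← algebraMap_eq]
    · have : chart i (X 0 - C (q 0)) * (chart i (X 1 - C (q 1)) / chart i (X 0 - C (q 0))) =
        chart i (X 1 - C (q 1)) := mul_div_cancel₀ _ h0
      simp [shift, blowSubst, blowChart, ← algebraMap_eq] at this ⊢
      rw [this, sub_add_cancel]
  exact DFunLike.congr_fun h a

theorem blowChart_injective (i : Fin 3) (q : Fin 2 → ℂ) : Function.Injective (blowChart i q) := by
  rw [injective_iff_map_eq_zero]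
  intro b hb
  obtain ⟨k, a, h⟩ := exists_X_pow_mul_eq_blowSubst b
  have h1 : a = shift q (shift (-q) a) := by
    have := shift_neg_shift (-q) a
    rw [neg_neg] at this
    exact this.symm
  have h2 : chart i (shift (-q) a) = 0 := by
    rw [← blowChart_blowSubst i q, ← h1, ← h, map_mul, hb, mul_zero]
  rw [map_eq_zero_iff _ (chart_injective i)] at h2
  rw [h1, h2, map_zero, map_zero] at h
  exact (mul_eq_zero.1 h).resolve_left (pow_ne_zero _ (X_ne_zero _))

theorem exists_blowChart_div (i : Fin 3) (q : Fin 2 → ℂ) (f : PlaneField) :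
    ∃ a b : MvPolynomial (Fin 2) ℂ, b ≠ 0 ∧ f = blowChart i q a / blowChart i q b := by
  obtain ⟨a, b, hb, rfl⟩ := exists_chart_div i f
  refine ⟨blowSubst (shift q a), blowSubst (shift q b), ?_, ?_⟩
  · rwa [Ne, map_eq_zero_iff _ blowSubst_injective, map_eq_zero_iff _ (shift_injective q)]
  · rw [blowChart_blowSubst, blowChart_blowSubst]

theorem X_dvd_blowSubst_shift_iff (q : Fin 2 → ℂ) (a : MvPolynomial (Fin 2) ℂ) :
    X 0 ∣ blowSubst (shift q a) ↔ eval q a = 0 := by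
  constructor
  · intro h
    have := mem_pointIdeal_pow (k := 1) (by rwa [pow_one])
    rwa [pow_one, mem_pointIdeal] at this
  · intro h
    obtain ⟨α, β, h'⟩ := exists_taylor q a
    rw [h', h]
    simp only [map_zero, zero_add, map_add, map_mul]
    refine dvd_add (Dvd.dvd.mul_right ?_ _) (Dvd.dvd.mul_right ?_ _) <;>
      simp [shift, blowSubst, ← algebraMap_eq]

/-- The local ring at the generic point of the exceptional curve of the blow-up of the point `q`
in the `i`-th affine chart of the plane. -/
def blowLocal (i : Fin 3) (q : Fin 2 → ℂ) : LocalSubring PlaneField :=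
  primeLocal (blowChart i q).toRingHom (blowChart_injective i q) (X_prime (i := (0 : Fin 2)))

theorem exists_isDiscrete_blowLocal (i : Fin 3) (q : Fin 2 → ℂ) :
    ∃ ϖ, IsDiscrete (blowLocal i q) ϖ :=
  ⟨_, isDiscrete_primeLocal _ _ (exists_blowChart_div i q)⟩

theorem le_ord_blowLocal_iff (i : Fin 3) (q : Fin 2 → ℂ) {a : MvPolynomial (Fin 2) ℂ}
    (ha : a ≠ 0) (k : ℕ) :
    (k : ℤ) ≤ ord (blowLocal i q) (chart i a) ↔ X 0 ^ k ∣ blowSubst (shift q a) := by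
  rw [← blowChart_blowSubst i q]
  refine le_ord_primeLocal_iff (θ := (blowChart i q).toRingHom) _ _ (exists_blowChart_div i q) ?_ k
  rwa [Ne, map_eq_zero_iff _ blowSubst_injective, map_eq_zero_iff _ (shift_injective q)]

theorem ord_blowLocal_pos_iff (i : Fin 3) (q : Fin 2 → ℂ) {a : MvPolynomial (Fin 2) ℂ}
    (ha : a ≠ 0) : 0 < ord (blowLocal i q) (chart i a) ↔ eval q a = 0 := by
  have := le_ord_blowLocal_iff i q ha 1
  rw [pow_one, X_dvd_blowSubst_shift_iff] at this
  rw [← this]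
  exact Iff.rfl

theorem mem_pointIdeal_pow_of_le_ord (i : Fin 3) (q : Fin 2 → ℂ) {a : MvPolynomial (Fin 2) ℂ}
    (ha : a ≠ 0) {k : ℕ} (h : (k : ℤ) ≤ ord (blowLocal i q) (chart i a)) :
    a ∈ pointIdeal q ^ k :=
  mem_pointIdeal_pow ((le_ord_blowLocal_iff i q ha k).1 h)

/-- Order at least two would put `a` into the square of the point ideal, and by the Leibniz rule
both first derivatives would vanish at `q`. -/
theorem ord_blowLocal_eq_one (i : Fin 3) (q : Fin 2 → ℂ) {a : MvPolynomial (Fin 2) ℂ}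
    (h0 : eval q a = 0) (h1 : ∃ j, eval q (pderiv j a) ≠ 0) :
    ord (blowLocal i q) (chart i a) = 1 := by
  have ha : a ≠ 0 := by
    rintro rfl
    simp at h1
  have hpos := (ord_blowLocal_pos_iff i q ha).2 h0
  refine le_antisymm ?_ hpos
  by_contra! hlt
  have h2 : a ∈ pointIdeal q ^ 2 := mem_pointIdeal_pow_of_le_ord i q ha hlt
  obtain ⟨j, hj⟩ := h1
  apply hj
  rw [pow_two] at h2
  refine Submodule.mul_induction_on h2 (fun b hb c hc => ?_) (fun b c hb hc => ?_)
  · rw [mem_pointIdeal] at hb hc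
    rw [Derivation.leibniz]
    simp [hb, hc]
  · rw [map_add, map_add, hb, hc, add_zero]

end BlowUpChart

/-! ### Smoothness and transversality in affine coordinates; finiteness of the essential
singularities. -/

section AffineGeometry

open MvPolynomial

theorem pderiv_dehom (i : Fin 3) (a : Fin 2) (A : MvPolynomial (Fin 3) ℂ) :
    pderiv a (dehom i A) = dehom i (pderiv (i.succAbove a) A) := by
  induction A using MvPolynomial.induction_on with
  | C c => simp [dehom, ← algebraMap_eq]
  | add A B hA hB => rw [map_add, map_add, hA, hB, map_add, map_add]
  | mul_X A j hA =>
    rw [map_mul, Derivation.leibniz, Derivation.leibniz, hA]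
    refine i.succAboveCases ?_ (fun b => ?_) j
    · simp [pderiv_X_of_ne (Fin.succAbove_ne i a).symm]
    · by_cases hb : b = a
      · subst hb
        simp
      · have h1 : i.succAbove b ≠ i.succAbove a := fun h => hb (Fin.succAbove_right_injective h)
        simp [pderiv_X_of_ne hb, pderiv_X_of_ne h1]

/-- The gradient of a form with `i`-th homogeneous coordinate set to one. -/
theorem gradient_insertNth (i : Fin 3) (q : Fin 2 → ℂ) (A : MvPolynomial (Fin 3) ℂ) (a : Fin 2) :
    gradient A (i.insertNth (1 : ℂ) q) (i.succAbove a) = eval q (pderiv a (dehom i A)) := by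
  rw [pderiv_dehom, eval_dehom]
  rfl

/-- Euler's formula at a zero of the form recovers the missing partial derivative from the two
affine ones, so no information is lost in a chart. -/
theorem gradient_insertNth_self (i : Fin 3) (q : Fin 2 → ℂ) {k : ℕ} {A : MvPolynomial (Fin 3) ℂ}
    (hA : A.IsHomogeneous k) (h0 : eval q (dehom i A) = 0) :
    gradient A (i.insertNth (1 : ℂ) q) i =
      -∑ a, q a * eval q (pderiv a (dehom i A)) := by
  have h := congrArg (eval (i.insertNth (1 : ℂ) q)) hA.sum_X_mul_pderiv
  rw [map_nsmul, ← eval_dehom i q A, h0, smul_zero, map_sum, Fin.sum_univ_succAbove _ i] at h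
  simp only [map_mul, eval_X, Fin.insertNth_apply_same, Fin.insertNth_apply_succAbove,
    one_mul] at h
  rw [eq_neg_iff_add_eq_zero, ← h]
  congr 1
  refine Finset.sum_congr rfl fun a _ => ?_
  rw [← gradient_insertNth]
  rfl

theorem insertNth_one_ne_zero (i : Fin 3) (q : Fin 2 → ℂ) :
    (i.insertNth (1 : ℂ) q : Fin 3 → ℂ) ≠ 0 := by
  intro h
  have := congrFun h i
  simp at this

theorem exists_eval_eq_zero {π : MvPolynomial (Fin 2) ℂ} (h : ¬ IsUnit π) :
    ∃ q, eval q π = 0 := by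
  obtain ⟨M, hM, hπ⟩ := exists_max_ideal_of_mem_nonunits h
  obtain ⟨q, rfl⟩ := isMaximal_iff_eq_vanishingIdeal_singleton.1 hM
  rw [mem_vanishingIdeal_singleton_iff, aeval_eq_eval] at hπ
  exact ⟨q, hπ⟩

theorem pointIdeal_eq (q : Fin 2 → ℂ) : pointIdeal q = vanishingIdeal ℂ {q} := by
  ext a
  rw [mem_pointIdeal, mem_vanishingIdeal_singleton_iff, aeval_eq_eval]

theorem pointIdeal_isMaximal (q : Fin 2 → ℂ) : (pointIdeal q).IsMaximal :=
  isMaximal_iff_eq_vanishingIdeal_singleton.2 ⟨q, pointIdeal_eq q⟩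

theorem exists_eq_pointIdeal {M : Ideal (MvPolynomial (Fin 2) ℂ)} (hM : M.IsMaximal) :
    ∃ q, M = pointIdeal q := by
  obtain ⟨q, rfl⟩ := isMaximal_iff_eq_vanishingIdeal_singleton.1 hM
  exact ⟨q, (pointIdeal_eq q).symm⟩

theorem pointIdeal_injective : Function.Injective pointIdeal := by
  intro q q' h
  funext j
  have : (X j - C (q j)) ∈ pointIdeal q' := by
    rw [← h, mem_pointIdeal]
    simp
  rw [mem_pointIdeal] at this
  simp only [map_sub, eval_X, eval_C] at this
  exact (sub_eq_zero.1 this).symm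

/-- Otherwise `0 < (π) < p < pointIdeal q` is a chain of primes of length three in a ring of
dimension two. -/
theorem eq_pointIdeal_of_span_lt {π : MvPolynomial (Fin 2) ℂ} (hπ : Prime π)
    {p : Ideal (MvPolynomial (Fin 2) ℂ)} [p.IsPrime] (h : Ideal.span {π} < p)
    {q : Fin 2 → ℂ} (hq : p ≤ pointIdeal q) : p = pointIdeal q := by
  by_contra hne
  have := pointIdeal_isMaximal q
  have h1 : (Ideal.span {π}).IsPrime := (Ideal.span_singleton_prime hπ.ne_zero).2 hπ
  have h2 := Ideal.height_add_one_le_of_lt_of_isPrime (lt_of_le_of_ne hq hne)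
  have h3 := Ideal.height_add_one_le_of_lt_of_isPrime h
  have h4 : (⊥ : Ideal (MvPolynomial (Fin 2) ℂ)) < Ideal.span {π} := by
    rw [bot_lt_iff_ne_bot, Ne, Ideal.span_singleton_eq_bot]
    exact hπ.ne_zero
  have h5 := Ideal.height_add_one_le_of_lt_of_isPrime h4
  have h6 := Ideal.height_le_ringKrullDim_of_isPrime (I := pointIdeal q)
  rw [ringKrullDim_of_isNoetherianRing, ringKrullDim_eq_zero_of_field, Nat.card_fin, zero_add] at h6
  have h7 : (pointIdeal q).height ≤ 2 := WithBot.coe_le_coe.1 h6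
  have h8 : (3 : ℕ∞) ≤ (pointIdeal q).height := by
    calc (3 : ℕ∞) = 0 + 1 + 1 + 1 := by norm_num
      _ ≤ _ := by
        refine le_trans ?_ h2
        gcongr
        refine le_trans ?_ h3
        gcongr
        exact le_trans (by gcongr; exact bot_le) h5
  exact absurd (h8.trans h7) (by decide)

/-- Each common zero gives a minimal prime of `(f, g)`, and a Noetherian ring has only finitely many
of these. Indeed a minimal prime below the point ideal contains a prime element, cannot be generated
by it as `f` and `g` have no common factor, and so equals the point ideal. -/
theorem finite_common_zeros {f g : MvPolynomial (Fin 2) ℂ} (hf : f ≠ 0)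
    (hfg : ∀ π, Prime π → π ∣ f → ¬ π ∣ g) :
    {q : Fin 2 → ℂ | eval q f = 0 ∧ eval q g = 0}.Finite := by
  refine Set.Finite.of_finite_image (f := pointIdeal) ?_ pointIdeal_injective.injOn
  refine (Ideal.finite_minimalPrimes_of_isNoetherianRing _ (Ideal.span {f, g})).subset ?_
  rintro _ ⟨q, ⟨h1, h2⟩, rfl⟩
  have := pointIdeal_isMaximal q
  have hle : Ideal.span {f, g} ≤ pointIdeal q := by
    rw [Ideal.span_le]
    rintro x (rfl | rfl)
    · exact mem_pointIdeal.2 h1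
    · exact mem_pointIdeal.2 h2
  obtain ⟨p, hp, hpq⟩ := Ideal.exists_minimalPrimes_le hle
  have hprime : p.IsPrime := hp.1.1
  have hfp : f ∈ p := hp.1.2 (Ideal.subset_span (by simp))
  have hgp : g ∈ p := hp.1.2 (Ideal.subset_span (by simp))
  obtain ⟨π, hπp, hπ⟩ := hprime.exists_mem_prime_of_ne_bot (by
    rintro rfl
    exact hf (by simpa using hfp))
  have hlt : Ideal.span {π} < p := by
    refine lt_of_le_of_ne ((Ideal.span_singleton_le_iff_mem _).2 hπp) ?_
    rintro rfl
    exact hfg π hπ (Ideal.mem_span_singleton.1 hfp) (Ideal.mem_span_singleton.1 hgp)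
  rwa [← eq_pointIdeal_of_span_lt hπ hlt hpq]

variable {d τ : ℕ} {F : Fin τ → MvPolynomial (Fin 3) ℂ}

namespace IsTransversalArrangement

theorem ne_zero (hF : IsTransversalArrangement d F) (j : Fin τ) : F j ≠ 0 := by
  intro h
  refine hF.smooth j (Function.const _ 1) (by simp [funext_iff]) (by simp [h]) ?_
  funext a
  simp [gradient, h]

theorem generic_ne_zero (hF : IsTransversalArrangement d F) (j : Fin τ) : generic (F j) ≠ 0 :=
  PlaneArrangement.generic_ne_zero (hF.homogeneous j) (hF.ne_zero j)

theorem dehom_ne_zero (hF : IsTransversalArrangement d F) (i : Fin 3) (j : Fin τ) :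
    dehom i (F j) ≠ 0 :=
  PlaneArrangement.dehom_ne_zero i (hF.homogeneous j) (hF.ne_zero j)

theorem exists_pderiv_ne_zero (hF : IsTransversalArrangement d F) (i : Fin 3) {j : Fin τ}
    {q : Fin 2 → ℂ} (h0 : eval q (dehom i (F j)) = 0) :
    ∃ a, eval q (pderiv a (dehom i (F j))) ≠ 0 := by
  by_contra! h
  refine hF.smooth j _ (insertNth_one_ne_zero i q) (by rwa [← eval_dehom]) ?_
  funext b
  refine i.succAboveCases ?_ (fun a => ?_) b
  · rw [gradient_insertNth_self i q (hF.homogeneous j) h0]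
    simp [h]
  · rw [gradient_insertNth, h, Pi.zero_apply]

theorem jacobian_ne_zero (hF : IsTransversalArrangement d F) (i : Fin 3) {j k : Fin τ}
    (hjk : j ≠ k) {q : Fin 2 → ℂ} (hj : eval q (dehom i (F j)) = 0)
    (hk : eval q (dehom i (F k)) = 0) :
    eval q (pderiv 0 (dehom i (F j))) * eval q (pderiv 1 (dehom i (F k))) -
      eval q (pderiv 1 (dehom i (F j))) * eval q (pderiv 0 (dehom i (F k))) ≠ 0 := by
  intro h
  have hli := hF.transversal j k hjk _ (insertNth_one_ne_zero i q) (by rwa [← eval_dehom])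
    (by rwa [← eval_dehom])
  rw [LinearIndependent.pair_iff] at hli
  have key : ∀ s t : ℂ, (∀ a, s * eval q (pderiv a (dehom i (F j))) +
      t * eval q (pderiv a (dehom i (F k))) = 0) → s = 0 ∧ t = 0 := by
    intro s t hst
    apply hli
    funext b
    refine i.succAboveCases ?_ (fun a => ?_) b
    · simp only [Pi.add_apply, Pi.smul_apply, smul_eq_mul, Pi.zero_apply,
        gradient_insertNth_self i q (hF.homogeneous _) hj,
        gradient_insertNth_self i q (hF.homogeneous _) hk, Fin.sum_univ_two]
      linear_combination -q 0 * hst 0 - q 1 * hst 1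
    · simp only [Pi.add_apply, Pi.smul_apply, smul_eq_mul, Pi.zero_apply, gradient_insertNth]
      exact hst a
  -- If the determinant vanishes, its entries give two linear relations between the gradients. By
  -- independence they force both partial derivatives of `F j` to be zero, and then the coefficients
  -- `1, 0` give a relation too.
  have h0 := key (eval q (pderiv 0 (dehom i (F k)))) (-eval q (pderiv 0 (dehom i (F j)))) (by
    intro a
    fin_cases a
    · simp only [Fin.zero_eta]; ring
    · simp only [Fin.mk_one]; linear_combination -h)
  have h1 := key (eval q (pderiv 1 (dehom i (F k)))) (-eval q (pderiv 1 (dehom i (F j)))) (by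
    intro a
    fin_cases a
    · simp only [Fin.zero_eta]; linear_combination h
    · simp only [Fin.mk_one]; ring)
  have h2 := key 1 0 (by
    intro a
    fin_cases a
    · simpa using h0.2
    · simpa using h1.2)
  exact one_ne_zero h2.1

/-- At a zero of a common factor `π`, which exists by the Nullstellensatz, both gradients are
multiples of the gradient of `π`, against transversality. -/
theorem not_dvd_of_dvd (hF : IsTransversalArrangement d F) (i : Fin 3) {j k : Fin τ}
    (hjk : j ≠ k) {π : MvPolynomial (Fin 2) ℂ} (hπ : Prime π) (hj : π ∣ dehom i (F j)) :
    ¬ π ∣ dehom i (F k) := by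
  intro hk
  obtain ⟨q, hq⟩ := exists_eval_eq_zero hπ.not_isUnit
  obtain ⟨a, ha⟩ := hj
  obtain ⟨b, hb⟩ := hk
  refine hF.jacobian_ne_zero i hjk (q := q) ?_ ?_ ?_
  · rw [ha, map_mul, hq, zero_mul]
  · rw [hb, map_mul, hq, zero_mul]
  · rw [ha, hb]
    simp only [Derivation.leibniz, smul_eq_mul, map_add, map_mul, hq]
    ring

end IsTransversalArrangement

theorem eq_mk_insertNth {P : Plane} {i : Fin 3} (hi : P.rep i ≠ 0) :
    P = Projectivization.mk ℂ (i.insertNth (1 : ℂ) (affinePoint i P.rep))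
      (insertNth_one_ne_zero i _) := by
  conv_lhs => rw [← P.mk_rep]
  rw [Projectivization.mk_eq_mk_iff']
  refine ⟨P.rep i, ?_⟩
  funext b
  refine i.succAboveCases ?_ (fun a => ?_) b
  · simp
  · simp [affinePoint, mul_div_cancel₀ _ hi]

theorem affinePoint_injOn (i : Fin 3) :
    Set.InjOn (fun P : Plane => affinePoint i P.rep) {P | P.rep i ≠ 0} := by
  intro P hP Q hQ h
  rw [eq_mk_insertNth hP, eq_mk_insertNth hQ]
  simp only at h
  simp only [h]

theorem exists_affinePoint_eq (i : Fin 3) (q : Fin 2 → ℂ) :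
    ∃ P : Plane, P.rep i ≠ 0 ∧ affinePoint i P.rep = q := by
  obtain ⟨a, ha⟩ := Projectivization.exists_smul_eq_mk_rep ℂ _ (insertNth_one_ne_zero i q)
  refine ⟨Projectivization.mk ℂ _ (insertNth_one_ne_zero i q), ?_, ?_⟩
  · rw [← ha]
    simp [Units.smul_def]
  · rw [← ha]
    funext b
    simp [affinePoint, Units.smul_def]

theorem vanishes_iff {P : Plane} {i : Fin 3} (hi : P.rep i ≠ 0) {k : ℕ}
    {A : MvPolynomial (Fin 3) ℂ} (hA : A.IsHomogeneous k) :
    Vanishes A P ↔ eval (affinePoint i P.rep) (dehom i A) = 0 :=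
  (eval_dehom_eq_zero_iff hi hA).symm

theorem finite_essentialSing (hF : IsTransversalArrangement d F) : (essentialSing F).Finite := by
  have hfin : ∀ (i : Fin 3) (j k : Fin τ), j ≠ k →
      {P : Plane | P.rep i ≠ 0 ∧ Vanishes (F j) P ∧ Vanishes (F k) P}.Finite := by
    intro i j k hjk
    refine Set.Finite.of_finite_image (f := fun P : Plane => affinePoint i P.rep) ?_
      ((affinePoint_injOn i).mono fun P hP => hP.1)
    refine (finite_common_zeros (hF.dehom_ne_zero i j) fun π hπ hj =>
      hF.not_dvd_of_dvd i hjk hπ hj).subset ?_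
    rintro _ ⟨P, ⟨hi, hj, hk⟩, rfl⟩
    exact ⟨(vanishes_iff hi (hF.homogeneous j)).1 hj, (vanishes_iff hi (hF.homogeneous k)).1 hk⟩
  have hU : (⋃ (i : Fin 3) (j : Fin τ) (k : Fin τ) (_ : j ≠ k),
      {P : Plane | P.rep i ≠ 0 ∧ Vanishes (F j) P ∧ Vanishes (F k) P}).Finite :=
    Set.finite_iUnion fun i => Set.finite_iUnion fun j => Set.finite_iUnion fun k =>
      Set.finite_iUnion fun hjk => hfin i j k hjk
  refine hU.subset fun P hP => ?_
  obtain ⟨i, hi⟩ := exists_rep_ne_zero P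
  have h1 : 1 < {j : Fin τ | Vanishes (F j) P}.ncard :=
    lt_of_lt_of_le (by norm_num) (show 3 ≤ multiplicity F P from hP)
  obtain ⟨j, hj, k, hk, hjk⟩ := (Set.one_lt_ncard (Set.toFinite _)).1 h1
  simp only [Set.mem_iUnion]
  exact ⟨i, j, k, hjk, hi, hj, hk⟩

theorem multiplicity_lt_of_numPoints_eq_zero (ht : numPoints F τ = 0) (P : Plane) :
    multiplicity F P < τ := by
  refine lt_of_le_of_ne ?_ fun h => ?_
  · have := Set.ncard_le_card {j : Fin τ | Vanishes (F j) P}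
    rwa [Nat.card_fin] at this
  · rw [numPoints, Set.encard_eq_zero] at ht
    exact (Set.ext_iff.1 ht P).1 h

theorem exists_not_vanishes (ht : numPoints F τ = 0) (P : Plane) : ∃ j, ¬ Vanishes (F j) P := by
  by_contra! h
  apply (multiplicity_lt_of_numPoints_eq_zero ht P).ne
  have : {j : Fin τ | Vanishes (F j) P} = Set.univ := Set.eq_univ_of_forall h
  rw [multiplicity, this, Set.ncard_univ, Nat.card_fin]

end AffineGeometry

/-! ### Localizations at height one primes as local subrings. -/

section LocalSubrings

variable {K : Type*} [Field K]

theorem mem_ofPrime {A : Subring K} {q : Ideal A} [q.IsPrime] {f : K} :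
    f ∈ (LocalSubring.ofPrime A q).toSubring ↔ ∃ a s : A, s ∉ q ∧ f = a / s := by
  constructor
  · intro hf
    obtain ⟨a, s, h⟩ := IsLocalization.exists_mk'_eq q.primeCompl
      (⟨f, hf⟩ : (LocalSubring.ofPrime A q).toSubring)
    have hs : ((s : A) : K) ≠ 0 := by
      intro h0
      exact s.2 ((Subtype.ext h0 : (s : A) = 0) ▸ q.zero_mem)
    have h1 := IsLocalization.mk'_spec (LocalSubring.ofPrime A q).toSubring a s
    rw [h] at h1
    exact ⟨a, s, s.2, (eq_div_iff hs).2 (congrArg Subtype.val h1)⟩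
  · rintro ⟨a, s, hs, rfl⟩
    have hs0 : (s : K) ≠ 0 := by
      intro h0
      exact hs ((Subtype.ext h0 : s = 0) ▸ q.zero_mem)
    have h1 := IsLocalization.mk'_spec (LocalSubring.ofPrime A q).toSubring a
      (⟨s, hs⟩ : q.primeCompl)
    have h2 : ((IsLocalization.mk' (LocalSubring.ofPrime A q).toSubring a
        (⟨s, hs⟩ : q.primeCompl) : (LocalSubring.ofPrime A q).toSubring) : K) * s = a :=
      congrArg Subtype.val h1
    rw [← (eq_div_iff hs0).2 h2]
    exact Subtype.prop _

theorem inv_mem_ofPrime {A : Subring K} {q : Ideal A} [q.IsPrime] {s : A} (hs : s ∉ q) :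
    (s : K)⁻¹ ∈ (LocalSubring.ofPrime A q).toSubring :=
  mem_ofPrime.2 ⟨1, s, hs, by simp⟩

theorem mem_maximalIdeal_iff {V : LocalSubring K} {f : V.toSubring} (hf : (f : K) ≠ 0) :
    f ∈ IsLocalRing.maximalIdeal V.toSubring ↔ (f : K)⁻¹ ∉ V.toSubring := by
  rw [IsLocalRing.mem_maximalIdeal, mem_nonunits_iff, isUnit_iff_inv_mem hf]

theorem inv_notMem_of_mem_prime {A : Subring K} {q : Ideal A} [hq : q.IsPrime] {s : A}
    (hs : s ∈ q) (h0 : (s : K) ≠ 0) : (s : K)⁻¹ ∉ (LocalSubring.ofPrime A q).toSubring := by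
  intro h
  obtain ⟨a, t, ht, he⟩ := mem_ofPrime.1 h
  apply ht
  have ht0 : (t : K) ≠ 0 := by
    intro h0
    exact ht ((Subtype.ext h0 : t = 0) ▸ q.zero_mem)
  have : t = a * s := by
    apply Subtype.ext
    change (t : K) = a * s
    rw [eq_div_iff ht0] at he
    rw [← he]
    field_simp
  rw [this]
  exact q.mul_mem_left _ hs

theorem localSubring_le_iff {O V : LocalSubring K} :
    O ≤ V ↔ O.toSubring ≤ V.toSubring ∧
      ∀ f ∈ O.toSubring, f ≠ 0 → f⁻¹ ∈ V.toSubring → f⁻¹ ∈ O.toSubring := by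
  rw [LocalSubring.le_def]
  constructor
  · rintro ⟨h, hl⟩
    refine ⟨h, fun f hf h0 hi => ?_⟩
    have := hl.map_nonunit ⟨f, hf⟩ ((isUnit_iff_inv_mem (V := V) (f := ⟨f, h hf⟩) h0).2 hi)
    exact (isUnit_iff_inv_mem (V := O) (f := ⟨f, hf⟩) h0).1 this
  · rintro ⟨h, hl⟩
    refine ⟨h, ⟨fun f hf => ?_⟩⟩
    have h0 : (f : K) ≠ 0 := by
      intro h0
      have : f = 0 := Subtype.ext h0
      rw [this, map_zero] at hf
      exact not_isUnit_zero hf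
    exact (isUnit_iff_inv_mem h0).2 (hl f f.2 h0
      ((isUnit_iff_inv_mem (V := V) (f := ⟨f, h f.2⟩) h0).1 hf))

theorem eq_of_le_of_height_eq_one {R : Type*} [CommRing R] [IsDomain R] {p q : Ideal R}
    [p.IsPrime] [q.IsPrime] (hq : q.height = 1) (h : p ≤ q) (hp : p ≠ ⊥) : p = q := by
  by_contra hne
  have h1 := Ideal.height_add_one_le_of_lt_of_isPrime (lt_of_le_of_ne h hne)
  rw [hq] at h1
  have h2 : p.height = 0 := by
    by_contra h0
    have h3 : 1 ≤ p.height := Order.one_le_iff_ne_zero.2 h0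
    have h4 : (1 : ℕ∞) + 1 ≤ 1 := le_trans (by gcongr) h1
    exact absurd h4 (by decide)
  exact hp (Ideal.height_eq_zero_iff_eq_bot.1 h2)

/-- The contraction of the maximal ideal of `V` to a subring. -/
def center {R : Subring K} {V : LocalSubring K} (h : R ≤ V.toSubring) : Ideal R :=
  (IsLocalRing.maximalIdeal V.toSubring).comap (Subring.inclusion h)

instance {R : Subring K} {V : LocalSubring K} (h : R ≤ V.toSubring) : (center h).IsPrime :=
  Ideal.comap_isPrime _ _

theorem mem_center {R : Subring K} {V : LocalSubring K} (h : R ≤ V.toSubring) {f : R}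
    (hf : (f : K) ≠ 0) : f ∈ center h ↔ (f : K)⁻¹ ∉ V.toSubring :=
  mem_maximalIdeal_iff (V := V) (f := Subring.inclusion h f) hf

/-- The maximal ideal of `V = R_q` contracts to a nonzero prime of the factorial ring `D`, which
contains a prime element `π`; then `V` lies in `W = D_(π)`. The center of `W` on `R` is nonzero and
contained in `q`, hence equal to `q` by height one. So an element of `R` that is a unit in `W` is
already a unit in `V`, and `W` lies in `V`. -/
theorem exists_eq_primeLocal {D : Type*} [CommRing D] [IsDomain D] [UniqueFactorizationMonoid D]
    {θ : D →+* K} (hθ : Function.Injective θ) {R : Subring K} {q : Ideal R} [q.IsPrime]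
    (hq : q.height = 1) (hD : ∀ a, θ a ∈ (LocalSubring.ofPrime R q).toSubring)
    (hfrac : ∀ f ∈ (LocalSubring.ofPrime R q).toSubring, ∃ a b : D,
      (θ b)⁻¹ ∈ (LocalSubring.ofPrime R q).toSubring ∧ b ≠ 0 ∧ f = θ a / θ b) :
    ∃ (π : D) (hπ : Prime π), LocalSubring.ofPrime R q = primeLocal θ hθ hπ := by
  set V := LocalSubring.ofPrime R q with hV
  have hRV : R ≤ V.toSubring := LocalSubring.le_ofPrime R q
  have hθ0 : ∀ {a : D}, a ≠ 0 → θ a ≠ 0 := fun {a} ha => (map_ne_zero_iff θ hθ).2 ha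
  let p : Ideal D := (IsLocalRing.maximalIdeal V.toSubring).comap (θ.codRestrict V.toSubring hD)
  have hp : p.IsPrime := Ideal.comap_isPrime _ _
  have mem_p : ∀ {a : D}, a ≠ 0 → (a ∈ p ↔ (θ a)⁻¹ ∉ V.toSubring) := fun {a} ha =>
    mem_maximalIdeal_iff (V := V) (f := θ.codRestrict V.toSubring hD a) (hθ0 ha)
  have hp0 : p ≠ ⊥ := by
    obtain ⟨r, hr, hr0⟩ := Submodule.exists_mem_ne_zero_of_ne_bot
      (Ideal.ne_bot_of_height_eq_one hq)
    have hr0' : (r : K) ≠ 0 := fun h => hr0 (Subtype.ext h)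
    have hrV := inv_notMem_of_mem_prime hr hr0'
    obtain ⟨a, b, hb, hb0, hab⟩ := hfrac r (hRV r.2)
    have ha : a ≠ 0 := by
      rintro rfl
      simp [hab] at hr0'
    intro hbot
    apply ha
    rw [← Ideal.mem_bot, ← hbot, mem_p ha]
    intro hinv
    apply hrV
    rw [hab, inv_div, div_eq_mul_inv]
    exact mul_mem (hD b) hinv
  obtain ⟨π, hπp, hπ⟩ := hp.exists_mem_prime_of_ne_bot hp0
  refine ⟨π, hπ, ?_⟩
  set W := primeLocal θ hθ hπ with hW
  have hVW : V.toSubring ≤ W.toSubring := by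
    intro f hf
    obtain ⟨a, b, hb, hb0, rfl⟩ := hfrac f hf
    refine ⟨a, b, fun hdvd => ?_, rfl⟩
    exact (mem_p hb0).1 (Ideal.mem_of_dvd p hdvd hπp) hb
  have hRW := hRV.trans hVW
  have hcenter : center hRW = q := by
    refine eq_of_le_of_height_eq_one hq (fun r hr => ?_) ?_
    · by_contra hrq
      have h0 : (r : K) ≠ 0 := by
        intro h0
        exact hrq ((Subtype.ext h0 : r = 0) ▸ q.zero_mem)
      exact (mem_center hRW h0).1 hr (hVW (inv_mem_ofPrime hrq))
    -- The center is nonzero: writing `π` as a fraction over `R`, its numerator is a nonunit in `W`.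
    · obtain ⟨a, s, hs, has⟩ := mem_ofPrime.1 (hD π)
      have hs0 : (s : K) ≠ 0 := by
        intro h0
        exact hs ((Subtype.ext h0 : s = 0) ▸ q.zero_mem)
      have ha : (a : K) = θ π * s := by
        rw [has, div_mul_cancel₀ _ hs0]
      have ha0 : (a : K) ≠ 0 := by
        rw [ha]
        exact mul_ne_zero (hθ0 hπ.ne_zero) hs0
      intro hbot
      apply ha0
      have : a ∈ center hRW := by
        rw [mem_center hRW ha0]
        intro hinv
        apply (inv_map_mem_primeLocal_iff hθ hπ hπ.ne_zero).1 _ dvd_rfl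
        have h1 : (θ π)⁻¹ = s * (a : K)⁻¹ := by
          rw [ha, mul_inv, mul_comm, mul_assoc, inv_mul_cancel₀ hs0, mul_one]
        rw [h1]
        exact mul_mem (hRW s.2) hinv
      rw [hbot, Ideal.mem_bot] at this
      rw [this]
      rfl
  apply LocalSubring.toSubring_injective
  refine le_antisymm hVW ?_
  rintro _ ⟨a, b, hb, rfl⟩
  rw [div_eq_mul_inv]
  refine mul_mem (hD a) ?_
  have hb0 : b ≠ 0 := by
    rintro rfl
    exact hb (dvd_zero π)
  obtain ⟨r, s, hs, hrs⟩ := mem_ofPrime.1 (hD b)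
  have hs0 : (s : K) ≠ 0 := by
    intro h0
    exact hs ((Subtype.ext h0 : s = 0) ▸ q.zero_mem)
  have hr : (r : K) = θ b * s := by rw [hrs, div_mul_cancel₀ _ hs0]
  have hr0 : (r : K) ≠ 0 := by
    rw [hr]
    exact mul_ne_zero (hθ0 hb0) hs0
  have hrq : r ∉ q := by
    rw [← hcenter, mem_center hRW hr0, not_not, hr, mul_inv]
    exact mul_mem (inv_map_mem_primeLocal hθ hπ hb) (hVW (inv_mem_ofPrime hs))
  rw [hrs, inv_div, div_eq_mul_inv]
  exact mul_mem (hRV s.2) (inv_mem_ofPrime hrq)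

end LocalSubrings

/-! ### Local rings along plane curves and along exceptional curves. -/

section PrimeDivisors

open MvPolynomial

/-- The local ring of the `i`-th affine chart of the plane along an irreducible curve. -/
def curveLocal (i : Fin 3) {π : MvPolynomial (Fin 2) ℂ} (hπ : Prime π) : LocalSubring PlaneField :=
  primeLocal (chart i).toRingHom (chart_injective i) hπ

theorem isDiscrete_curveLocal (i : Fin 3) {π : MvPolynomial (Fin 2) ℂ} (hπ : Prime π) :
    IsDiscrete (curveLocal i hπ) (chart i π) :=
  isDiscrete_primeLocal _ _ (exists_chart_div i)

variable {P : Plane} {i : Fin 3}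

theorem chart_mem_localRingAt (hi : P.rep i ≠ 0) (a : MvPolynomial (Fin 2) ℂ) :
    chart i a ∈ (localRingAt P).toSubring :=
  (mem_localRingAt hi).2 ⟨a, 1, by simp, by simp⟩

theorem inv_chart_mem_localRingAt (hi : P.rep i ≠ 0) {b : MvPolynomial (Fin 2) ℂ}
    (hb : eval (affinePoint i P.rep) b ≠ 0) : (chart i b)⁻¹ ∈ (localRingAt P).toSubring :=
  (mem_localRingAt hi).2 ⟨1, b, hb, by simp⟩

theorem chart_ne_zero_of_eval {q : Fin 2 → ℂ} {b : MvPolynomial (Fin 2) ℂ}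
    (hb : eval q b ≠ 0) : chart i b ≠ 0 := by
  rw [map_ne_zero_iff _ (chart_injective i)]
  rintro rfl
  simp at hb

/-- Clearing denominators that do not vanish at `P` turns fractions over the local ring at `P` into
fractions of polynomials. The criterion serves both at points that are not blown up and off the
exceptional curve of a blow-up. -/
theorem exists_curveLocal_of_frac (hi : P.rep i ≠ 0) {R : Subring PlaneField} {q : Ideal R}
    [q.IsPrime] (hq : q.height = 1)
    (hO : (localRingAt P).toSubring ≤ (LocalSubring.ofPrime R q).toSubring)
    (hfrac : ∀ f ∈ (LocalSubring.ofPrime R q).toSubring, ∃ r ∈ (localRingAt P).toSubring,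
      ∃ s ∈ (localRingAt P).toSubring, s ≠ 0 ∧
        s⁻¹ ∈ (LocalSubring.ofPrime R q).toSubring ∧ f = r / s) :
    ∃ (π : MvPolynomial (Fin 2) ℂ) (hπ : Prime π), LocalSubring.ofPrime R q = curveLocal i hπ := by
  refine exists_eq_primeLocal (chart_injective i) hq
    (fun a => hO (chart_mem_localRingAt hi a)) fun f hf => ?_
  obtain ⟨r, hr, s, hs, hs0, hsV, rfl⟩ := hfrac f hf
  obtain ⟨a, b, hb, rfl⟩ := (mem_localRingAt hi).1 hr
  obtain ⟨c, e, he, rfl⟩ := (mem_localRingAt hi).1 hs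
  have hc0 : chart i c ≠ 0 := fun h => hs0 (by rw [h, zero_div])
  have hb0 := chart_ne_zero_of_eval (i := i) hb
  have he0 := chart_ne_zero_of_eval (i := i) he
  have hbc : chart i (b * c) ≠ 0 := by
    rw [map_mul]
    exact mul_ne_zero hb0 hc0
  refine ⟨a * e, b * c, ?_, fun h => hbc (by rw [h, map_zero]), ?_⟩
  · change (chart i (b * c))⁻¹ ∈ _
    have : (chart i (b * c))⁻¹ = (chart i b)⁻¹ * ((chart i c / chart i e)⁻¹ * (chart i e)⁻¹) := by
      rw [map_mul]
      field_simp
    rw [this]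
    exact mul_mem (hO (inv_chart_mem_localRingAt hi hb))
      (mul_mem hsV (hO (inv_chart_mem_localRingAt hi he)))
  · change _ = chart i (a * e) / chart i (b * c)
    rw [map_mul, map_mul, div_div_div_eq]

theorem exists_eq_curveLocal (hi : P.rep i ≠ 0) {q : Ideal (localRingAt P).toSubring}
    [q.IsPrime] (hq : q.height = 1) :
    ∃ (π : MvPolynomial (Fin 2) ℂ) (hπ : Prime π),
      LocalSubring.ofPrime (localRingAt P).toSubring q = curveLocal i hπ := by
  refine exists_curveLocal_of_frac hi hq (LocalSubring.le_ofPrime _ q) fun f hf => ?_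
  obtain ⟨r, s, hs, rfl⟩ := mem_ofPrime.1 hf
  refine ⟨r, r.2, s, s.2, fun h0 => ?_, inv_mem_ofPrime hs, rfl⟩
  exact hs ((Subtype.ext h0 : s = 0) ▸ q.zero_mem)

/-- The local ring at the generic point of the exceptional curve over `P`. -/
def excLocal (i : Fin 3) (P : Plane) : LocalSubring PlaneField := blowLocal i (affinePoint i P.rep)

theorem ord_excLocal_chart_nonneg (i : Fin 3) (P : Plane) {a : MvPolynomial (Fin 2) ℂ}
    (ha : a ≠ 0) : 0 ≤ ord (excLocal i P) (chart i a) := by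
  have := (le_ord_blowLocal_iff i (affinePoint i P.rep) ha 0).2 (by simp)
  exact this

theorem ord_excLocal_chart_eq_zero {a : MvPolynomial (Fin 2) ℂ}
    (ha : eval (affinePoint i P.rep) a ≠ 0) : ord (excLocal i P) (chart i a) = 0 := by
  have ha0 : a ≠ 0 := by
    rintro rfl
    simp at ha
  have h1 := ord_excLocal_chart_nonneg i P ha0
  have h2 := (ord_blowLocal_pos_iff i (affinePoint i P.rep) ha0).not.2 ha
  exact le_antisymm (not_lt.1 h2) h1

theorem exists_isDiscrete_excLocal (i : Fin 3) (P : Plane) : ∃ ϖ, IsDiscrete (excLocal i P) ϖ :=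
  exists_isDiscrete_blowLocal i _

theorem localRingAt_toSubring_le_excLocal (hi : P.rep i ≠ 0) :
    (localRingAt P).toSubring ≤ (excLocal i P).toSubring := by
  intro f hf
  obtain ⟨ϖ, hϖ⟩ := exists_isDiscrete_excLocal i P
  obtain ⟨a, b, hb, rfl⟩ := (mem_localRingAt hi).1 hf
  by_cases ha : a = 0
  · rw [ha, map_zero, zero_div]
    exact zero_mem _
  · have ha0 : chart i a ≠ 0 := (map_ne_zero_iff _ (chart_injective i)).2 ha
    have hb0 := chart_ne_zero_of_eval (i := i) hb
    rw [← hϖ.ord_nonneg_iff (div_ne_zero ha0 hb0), hϖ.ord_div ha0 hb0,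
      ord_excLocal_chart_eq_zero hb, sub_zero]
    exact ord_excLocal_chart_nonneg i P ha

theorem ord_excLocal_pos_iff (hi : P.rep i ≠ 0) {f : (localRingAt P).toSubring}
    (hf : (f : PlaneField) ≠ 0) :
    0 < ord (excLocal i P) (f : PlaneField) ↔
      f ∈ IsLocalRing.maximalIdeal (localRingAt P).toSubring := by
  obtain ⟨ϖ, hϖ⟩ := exists_isDiscrete_excLocal i P
  rw [mem_maximalIdeal_iff hf]
  constructor
  · intro h hinv
    exact (hϖ.ord_pos_iff hf).1 h (localRingAt_toSubring_le_excLocal hi hinv)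
  · intro h
    obtain ⟨a, b, hb, hab⟩ := (mem_localRingAt hi).1 f.2
    have ha0 : chart i a ≠ 0 := by
      intro h0
      rw [hab, h0, zero_div] at hf
      exact hf rfl
    have hb0 := chart_ne_zero_of_eval (i := i) hb
    have ha : a ≠ 0 := by
      rintro rfl
      simp at ha0
    rw [hab, hϖ.ord_div ha0 hb0, ord_excLocal_chart_eq_zero hb, sub_zero]
    refine (ord_blowLocal_pos_iff i (affinePoint i P.rep) ha).2 ?_
    by_contra hne
    apply h
    rw [hab, inv_div]
    exact (mem_localRingAt hi).2 ⟨b, a, hne, rfl⟩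

/-- Up to a unit denominator this is the polynomial statement `mem_pointIdeal_pow_of_le_ord`. It
says that the exceptional valuation is bounded by the order with respect to powers of the maximal
ideal, which controls divisibility by `u` in the blow-up chart. -/
theorem mem_maximalIdeal_pow_of_le_ord (hi : P.rep i ≠ 0) {f : (localRingAt P).toSubring}
    (hf : (f : PlaneField) ≠ 0) {k : ℕ} (hk : (k : ℤ) ≤ ord (excLocal i P) (f : PlaneField)) :
    f ∈ IsLocalRing.maximalIdeal (localRingAt P).toSubring ^ k := by
  obtain ⟨ϖ, hϖ⟩ := exists_isDiscrete_excLocal i P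
  obtain ⟨a, b, hb, hab⟩ := (mem_localRingAt hi).1 f.2
  have ha0 : chart i a ≠ 0 := by
    intro h0
    rw [hab, h0, zero_div] at hf
    exact hf rfl
  have hb0 := chart_ne_zero_of_eval (i := i) hb
  have ha : a ≠ 0 := by
    rintro rfl
    simp at ha0
  rw [hab, hϖ.ord_div ha0 hb0, ord_excLocal_chart_eq_zero hb, sub_zero] at hk
  have h1 := mem_pointIdeal_pow_of_le_ord i (affinePoint i P.rep) ha hk
  let θ := (chart i).toRingHom.codRestrict (localRingAt P).toSubring (chart_mem_localRingAt hi)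
  have hle : (pointIdeal (affinePoint i P.rep)).map θ ≤
      IsLocalRing.maximalIdeal (localRingAt P).toSubring := by
    rw [Ideal.map_le_iff_le_comap]
    intro c hc
    rw [Ideal.mem_comap]
    by_cases hc0 : c = 0
    · rw [hc0, map_zero]
      exact Ideal.zero_mem _
    · have hθc : ((θ c : (localRingAt P).toSubring) : PlaneField) ≠ 0 :=
        (map_ne_zero_iff _ (chart_injective i)).2 hc0
      rw [← ord_excLocal_pos_iff hi hθc]
      exact (ord_blowLocal_pos_iff i (affinePoint i P.rep) hc0).2 (mem_pointIdeal.1 hc)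
  have h2 : θ a ∈ IsLocalRing.maximalIdeal (localRingAt P).toSubring ^ k := by
    refine Ideal.pow_right_mono hle k ?_
    rw [← Ideal.map_pow]
    exact Ideal.mem_map_of_mem θ h1
  have h3 : f = ⟨(chart i b)⁻¹, inv_chart_mem_localRingAt hi hb⟩ * θ a := by
    apply Subtype.ext
    change (f : PlaneField) = (chart i b)⁻¹ * chart i a
    rw [hab, div_eq_inv_mul]
  rw [h3]
  exact Ideal.mul_mem_left _ _ h2

theorem localRingAt_le_excLocal (hi : P.rep i ≠ 0) : localRingAt P ≤ excLocal i P := by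
  refine localSubring_le_iff.2 ⟨localRingAt_toSubring_le_excLocal hi, fun f hf h0 hinv => ?_⟩
  obtain ⟨ϖ, hϖ⟩ := exists_isDiscrete_excLocal i P
  by_contra hnot
  have h1 := (ord_excLocal_pos_iff hi (f := ⟨f, hf⟩) h0).2
    ((mem_maximalIdeal_iff (V := localRingAt P) (f := ⟨f, hf⟩) h0).2 hnot)
  exact (hϖ.ord_pos_iff h0).1 h1 hinv

section QuadraticTransform

variable {K : Type*} [Field K] {O : LocalSubring K} {u : K}

theorem le_blowUpChart : O.toSubring ≤ blowUpChart O u :=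
  fun _ hf => Subring.subset_closure (Or.inl hf)

theorem div_pow_mem_blowUpChart {k : ℕ} {a : O.toSubring}
    (ha : a ∈ IsLocalRing.maximalIdeal O.toSubring ^ k) : (a : K) / u ^ k ∈ blowUpChart O u := by
  induction k generalizing a with
  | zero => rw [pow_zero, div_one]; exact le_blowUpChart a.2
  | succ k ih =>
    rw [pow_succ] at ha
    refine Submodule.mul_induction_on ha (fun b hb c hc => ?_) (fun b c hb hc => ?_)
    · have : ((b * c : O.toSubring) : K) / u ^ (k + 1) = (b : K) / u ^ k * ((c : K) / u) := by
        rw [div_mul_div_comm, pow_succ]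
        rfl
      rw [this]
      exact mul_mem (ih hb) (Subring.subset_closure (Or.inr ⟨c, hc, rfl⟩))
    · have : ((b + c : O.toSubring) : K) / u ^ (k + 1) =
          (b : K) / u ^ (k + 1) + (c : K) / u ^ (k + 1) := by
        rw [← add_div]
        rfl
      rw [this]
      exact add_mem hb hc

/-- The union of the sets `m^k / u^k` is closed under the ring operations, since `u ∈ m` allows
passing to a common exponent. -/
theorem exists_eq_div_pow {u : O.toSubring} (hu : u ∈ IsLocalRing.maximalIdeal O.toSubring)
    (hu0 : (u : K) ≠ 0) {f : K} (hf : f ∈ blowUpChart O (u : K)) :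
    ∃ (k : ℕ) (a : O.toSubring), a ∈ IsLocalRing.maximalIdeal O.toSubring ^ k ∧
      f = (a : K) / (u : K) ^ k := by
  refine Subring.closure_induction (p := fun f _ => ∃ (k : ℕ) (a : O.toSubring),
    a ∈ IsLocalRing.maximalIdeal O.toSubring ^ k ∧ f = (a : K) / (u : K) ^ k)
    ?_ ?_ ?_ ?_ ?_ ?_ hf
  · rintro x (hx | ⟨a, ha, rfl⟩)
    · exact ⟨0, ⟨x, hx⟩, by simp, by simp⟩
    · exact ⟨1, a, by rwa [pow_one], by rw [pow_one]⟩
  · exact ⟨0, 0, by simp, by simp⟩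
  · exact ⟨0, 1, by simp, by simp⟩
  · rintro _ _ _ _ ⟨k, a, ha, rfl⟩ ⟨l, b, hb, rfl⟩
    refine ⟨k + l, a * u ^ l + u ^ k * b, ?_, ?_⟩
    · rw [pow_add]
      exact add_mem (Ideal.mul_mem_mul ha (Ideal.pow_mem_pow hu l))
        (Ideal.mul_mem_mul (Ideal.pow_mem_pow hu k) hb)
    · rw [div_add_div _ _ (pow_ne_zero _ hu0) (pow_ne_zero _ hu0), pow_add]
      rfl
  · rintro _ _ ⟨k, a, ha, rfl⟩
    exact ⟨k, -a, neg_mem ha, (neg_div _ _).symm⟩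
  · rintro _ _ _ _ ⟨k, a, ha, rfl⟩ ⟨l, b, hb, rfl⟩
    refine ⟨k + l, a * b, ?_, ?_⟩
    · rw [pow_add]
      exact Ideal.mul_mem_mul ha hb
    · rw [div_mul_div_comm, pow_add]
      rfl

end QuadraticTransform

end PrimeDivisors

/-! ### Classification of the prime divisors of the blow-up. -/

section Classification

open MvPolynomial

variable {P : Plane} {i : Fin 3}

section Chart

variable {u : (localRingAt P).toSubring}

theorem blowUpChart_le_excLocal (hi : P.rep i ≠ 0)
    (h1 : ord (excLocal i P) (u : PlaneField) = 1) (hu0 : (u : PlaneField) ≠ 0) :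
    blowUpChart (localRingAt P) (u : PlaneField) ≤ (excLocal i P).toSubring := by
  obtain ⟨ϖ, hϖ⟩ := exists_isDiscrete_excLocal i P
  refine Subring.closure_le.2 ?_
  rintro f (hf | ⟨a, ha, rfl⟩)
  · exact localRingAt_toSubring_le_excLocal hi hf
  · change (a : PlaneField) / u ∈ (excLocal i P).toSubring
    by_cases ha0 : (a : PlaneField) = 0
    · rw [ha0, zero_div]
      exact zero_mem _
    · rw [← hϖ.ord_nonneg_iff (div_ne_zero ha0 hu0), hϖ.ord_div ha0 hu0, h1]
      have := (ord_excLocal_pos_iff hi ha0).2 ha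
      omega

/-- For `f = a / u^k`, positive order means that `a` has order at least `k + 1`, so `a ∈ m^(k+1)`
and `a / u^(k+1)` still lies in the chart. Thus `u` is a local equation of the exceptional curve. -/
theorem exists_eq_mul_of_ord_pos (hi : P.rep i ≠ 0)
    (hu : u ∈ IsLocalRing.maximalIdeal (localRingAt P).toSubring)
    (h1 : ord (excLocal i P) (u : PlaneField) = 1) (hu0 : (u : PlaneField) ≠ 0)
    {f : PlaneField} (hf : f ∈ blowUpChart (localRingAt P) (u : PlaneField)) (hf0 : f ≠ 0)
    (hpos : 0 < ord (excLocal i P) f) :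
    ∃ g ∈ blowUpChart (localRingAt P) (u : PlaneField), f = u * g := by
  obtain ⟨ϖ, hϖ⟩ := exists_isDiscrete_excLocal i P
  obtain ⟨k, a, ha, rfl⟩ := exists_eq_div_pow hu hu0 hf
  have ha0 : (a : PlaneField) ≠ 0 := by
    intro h0
    rw [h0, zero_div] at hf0
    exact hf0 rfl
  rw [hϖ.ord_div ha0 (pow_ne_zero _ hu0), hϖ.ord_pow hu0, h1, mul_one] at hpos
  refine ⟨_, div_pow_mem_blowUpChart (k := k + 1)
    (mem_maximalIdeal_pow_of_le_ord hi ha0 (by push_cast; omega)), ?_⟩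
  rw [pow_succ]
  field_simp

end Chart

/-- The element `u` is a local equation of the exceptional curve. If `u` lies in `q`, then the
exceptional valuation ring has center `q` by height one, and `V` coincides with it. If not, `u` is
invertible in `V`, and `V` consists of fractions over the local ring of the plane. -/
theorem blowUpChart_primeDivisor (hi : P.rep i ≠ 0) {u : (localRingAt P).toSubring}
    (hu : u ∈ IsLocalRing.maximalIdeal (localRingAt P).toSubring) (hu0 : (u : PlaneField) ≠ 0)
    {B : Subring PlaneField} (hB : B = blowUpChart (localRingAt P) (u : PlaneField))
    {N : Ideal B} [hN : N.IsPrime] {v : B} (hvN : v ∈ N) (hv : (v : PlaneField) = u)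
    {R : LocalSubring PlaneField} (hR : R = LocalSubring.ofPrime B N)
    {q : Ideal R.toSubring} [q.IsPrime] (hq : q.height = 1) {V : LocalSubring PlaneField}
    (hV : V = LocalSubring.ofPrime R.toSubring q) :
    V = excLocal i P ∨
      ∃ (π : MvPolynomial (Fin 2) ℂ) (hπ : Prime π), V = curveLocal i hπ := by
  obtain ⟨ϖ, hϖ⟩ := exists_isDiscrete_excLocal i P
  set W := excLocal i P with hW
  have hOB : (localRingAt P).toSubring ≤ B := hB ▸ le_blowUpChart
  have memR : ∀ {f : PlaneField}, f ∈ R.toSubring ↔ ∃ a s : B, s ∉ N ∧ f = a / s := fun {f} => by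
    rw [hR, mem_ofPrime]
  have invR : ∀ {s : B}, s ∉ N → (s : PlaneField)⁻¹ ∈ R.toSubring := fun {s} hs => by
    rw [hR]
    exact inv_mem_ofPrime hs
  have memV : ∀ {f : PlaneField}, f ∈ V.toSubring ↔
      ∃ a s : R.toSubring, s ∉ q ∧ f = a / s := fun {f} => by
    rw [hV, mem_ofPrime]
  have invV : ∀ {s : R.toSubring}, s ∉ q → (s : PlaneField)⁻¹ ∈ V.toSubring := fun {s} hs => by
    rw [hV]
    exact inv_mem_ofPrime hs
  have div_mem : ∀ {k : ℕ} {a : (localRingAt P).toSubring},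
      a ∈ IsLocalRing.maximalIdeal (localRingAt P).toSubring ^ k →
        (a : PlaneField) / (u : PlaneField) ^ k ∈ B := fun {k a} ha => by
    rw [hB]
    exact div_pow_mem_blowUpChart ha
  have eq_div : ∀ {f : PlaneField}, f ∈ B → ∃ (k : ℕ) (a : (localRingAt P).toSubring),
      a ∈ IsLocalRing.maximalIdeal (localRingAt P).toSubring ^ k ∧
        f = (a : PlaneField) / (u : PlaneField) ^ k := fun {f} hf => by
    rw [hB] at hf
    exact exists_eq_div_pow hu hu0 hf
  -- If `u` had order at least two, then `1 / u = u / u^2` would lie in the chart, although `u`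
  -- belongs to the proper ideal `N`.
  have hord : ord W (u : PlaneField) = 1 := by
    have hpos := (ord_excLocal_pos_iff hi hu0).2 hu
    refine le_antisymm ?_ hpos
    by_contra! hlt
    have h2 := div_mem
      (mem_maximalIdeal_pow_of_le_ord (k := 2) hi hu0 hlt)
    have h3 : (u : PlaneField) / (u : PlaneField) ^ 2 * u = 1 := by field_simp
    apply (Ideal.ne_top_iff_one N).1 hN.ne_top
    have h4 := N.mul_mem_left ⟨_, h2⟩ hvN
    convert h4 using 1
    apply Subtype.ext
    change (1 : PlaneField) = (u : PlaneField) / (u : PlaneField) ^ 2 * v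
    rw [hv, h3]
  have hBW : B ≤ W.toSubring := hB ▸ blowUpChart_le_excLocal hi hord hu0
  have hne : ∀ {s : B}, s ∉ N → (s : PlaneField) ≠ 0 := by
    intro s hs h0
    exact hs ((Subtype.ext h0 : s = 0) ▸ N.zero_mem)
  -- Positive order would make `s` a multiple of `u`, hence an element of `N`.
  have hordN : ∀ {s : B}, s ∉ N → ord W (s : PlaneField) = 0 := by
    intro s hs
    refine le_antisymm ?_ ((hϖ.ord_nonneg_iff (hne hs)).2 (hBW s.2))
    by_contra! hpos
    obtain ⟨g, hg, hsg⟩ := exists_eq_mul_of_ord_pos hi hu hord hu0 (hB ▸ s.2) (hne hs) hpos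
    apply hs
    have h4 := N.mul_mem_left ⟨g, hB ▸ hg⟩ hvN
    convert h4 using 1
    apply Subtype.ext
    change (s : PlaneField) = g * v
    rw [hsg, hv, mul_comm]
  have hBR : B ≤ R.toSubring := hR ▸ LocalSubring.le_ofPrime B N
  have hOR := hOB.trans hBR
  have hRV : R.toSubring ≤ V.toSubring := hV ▸ LocalSubring.le_ofPrime _ q
  have hqne : ∀ {s : R.toSubring}, s ∉ q → (s : PlaneField) ≠ 0 := by
    intro s hs h0
    exact hs ((Subtype.ext h0 : s = 0) ▸ q.zero_mem)
  have hinvW : ∀ {f : PlaneField}, f ≠ 0 → ord W f = 0 → f⁻¹ ∈ W.toSubring := by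
    intro f hf h0
    rw [← hϖ.ord_nonneg_iff (inv_ne_zero hf), hϖ.ord_inv hf, h0, neg_zero]
  have hRW : R.toSubring ≤ W.toSubring := by
    intro f hf
    obtain ⟨b, s, hs, rfl⟩ := memR.1 hf
    rw [div_eq_mul_inv]
    exact mul_mem (hBW b.2) (hinvW (hne hs) (hordN hs))
  let uR : R.toSubring := ⟨u, hOR u.2⟩
  by_cases huq : uR ∈ q
  · left
    have hcenter : center hRW = q := by
      refine eq_of_le_of_height_eq_one hq (fun r hr => ?_) ?_
      · by_cases hr0 : (r : PlaneField) = 0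
        · rw [(Subtype.ext hr0 : r = 0)]
          exact q.zero_mem
        obtain ⟨b, s, hs, hbs⟩ := memR.1 r.2
        have hb0 : (b : PlaneField) ≠ 0 := by
          intro h0
          rw [hbs, h0, zero_div] at hr0
          exact hr0 rfl
        have hpos : 0 < ord W (r : PlaneField) :=
          (hϖ.ord_pos_iff hr0).2 ((mem_center hRW hr0).1 hr)
        rw [hbs, hϖ.ord_div hb0 (hne hs), hordN hs, sub_zero] at hpos
        obtain ⟨g, hg, hbg⟩ := exists_eq_mul_of_ord_pos hi hu hord hu0 (hB ▸ b.2) hb0 hpos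
        have h5 := q.mul_mem_left
          ⟨g * (s : PlaneField)⁻¹, mul_mem (hBR (hB ▸ hg)) (invR hs)⟩ huq
        convert h5 using 1
        apply Subtype.ext
        change (r : PlaneField) = g * (s : PlaneField)⁻¹ * u
        rw [hbs, hbg, div_eq_mul_inv]
        ring
      · intro hbot
        have : uR ∈ center hRW := by
          rw [mem_center (f := uR) hRW hu0]
          exact (hϖ.ord_pos_iff hu0).1 (by rw [hord]; norm_num)
        rw [hbot, Ideal.mem_bot] at this
        exact hu0 (congrArg Subtype.val this)
    have hVW : V.toSubring ≤ W.toSubring := by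
      intro f hf
      obtain ⟨r, t, ht, rfl⟩ := memV.1 hf
      rw [div_eq_mul_inv]
      refine mul_mem (hRW r.2) ?_
      have ht0 := hqne ht
      rw [← hcenter, mem_center hRW ht0, not_not] at ht
      exact ht
    -- Divided by the right power of `u`, a nonzero element of the local ring of the plane becomes a
    -- unit of `V`. Since every rational function is a quotient of such elements, the order alone
    -- decides membership in `V`.
    have key : ∀ x ∈ (localRingAt P).toSubring, x ≠ 0 → ∀ k : ℕ, ord W x = k →
        x / (u : PlaneField) ^ k ∈ V.toSubring ∧ (x / (u : PlaneField) ^ k)⁻¹ ∈ V.toSubring := by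
      intro x hx hx0 k hk
      have h6 := hBR (div_mem
        (mem_maximalIdeal_pow_of_le_ord (f := ⟨x, hx⟩) hi hx0 hk.ge))
      have h7 : x / (u : PlaneField) ^ k ≠ 0 := div_ne_zero hx0 (pow_ne_zero _ hu0)
      refine ⟨hRV h6, invV (s := ⟨_, h6⟩) ?_⟩
      rw [← hcenter, mem_center (f := ⟨_, h6⟩) hRW h7, not_not]
      apply hinvW h7
      rw [hϖ.ord_div hx0 (pow_ne_zero _ hu0), hϖ.ord_pow hu0, hord, hk]
      ring
    apply LocalSubring.toSubring_injective
    refine le_antisymm hVW fun f hf => ?_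
    by_cases hf0 : f = 0
    · rw [hf0]
      exact zero_mem _
    obtain ⟨a, b, hb, rfl⟩ := exists_chart_div i f
    have hb0 : chart i b ≠ 0 := (map_ne_zero_iff _ (chart_injective i)).2 hb
    have ha0 : chart i a ≠ 0 := by
      intro h0
      rw [h0, zero_div] at hf0
      exact hf0 rfl
    have ha : a ≠ 0 := by
      rintro rfl
      simp at ha0
    obtain ⟨k, hk⟩ := Int.eq_ofNat_of_zero_le (ord_excLocal_chart_nonneg i P ha)
    obtain ⟨l, hl⟩ := Int.eq_ofNat_of_zero_le (ord_excLocal_chart_nonneg i P hb)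
    have hkl : l ≤ k := by
      rw [← hϖ.ord_nonneg_iff hf0, hϖ.ord_div ha0 hb0, hk, hl] at hf
      omega
    have h8 : chart i a / chart i b = chart i a / (u : PlaneField) ^ k *
        (chart i b / (u : PlaneField) ^ l)⁻¹ * (u : PlaneField) ^ (k - l) := by
      rw [inv_div, pow_sub₀ _ hu0 hkl]
      have := pow_ne_zero k hu0
      have := pow_ne_zero l hu0
      field_simp
    rw [h8]
    exact mul_mem (mul_mem (key _ (chart_mem_localRingAt hi a) ha0 k hk).1
      (key _ (chart_mem_localRingAt hi b) hb0 l hl).2) (pow_mem (hRV (hOR u.2)) _)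
  · right
    have huV : (u : PlaneField)⁻¹ ∈ V.toSubring := invV (s := uR) huq
    have hOV := hOR.trans hRV
    rw [hV] at hOV ⊢
    refine exists_curveLocal_of_frac hi hq hOV fun f hf => ?_
    rw [← hV] at hf ⊢
    obtain ⟨r, t, ht, rfl⟩ := memV.1 hf
    obtain ⟨b, s, hs, hbs⟩ := memR.1 r.2
    obtain ⟨b', s', hs', hbs'⟩ := memR.1 t.2
    have hs0 := hne hs
    have hs0' := hne hs'
    have ht0 := hqne ht
    have hb0' : (b' : PlaneField) ≠ 0 := by
      intro h0
      rw [hbs', h0, zero_div] at ht0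
      exact ht0 rfl
    -- Cross-multiplication turns `(b / s) / (b' / s')` into `(b s') / (s b')`. Numerator and
    -- denominator lie in the chart, and powers of `u`, which is a unit of `V`, clear their
    -- denominators.
    obtain ⟨k, a, -, ha⟩ := eq_div (mul_mem b.2 s'.2)
    obtain ⟨l, c, -, hc⟩ := eq_div (mul_mem s.2 b'.2)
    have huk := pow_ne_zero k hu0
    have hul := pow_ne_zero l hu0
    have hc' : (c : PlaneField) = s * b' * (u : PlaneField) ^ l := by
      rw [hc, div_mul_cancel₀ _ hul]
    have hc0 : (c : PlaneField) ≠ 0 := by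
      rw [hc']
      exact mul_ne_zero (mul_ne_zero hs0 hb0') hul
    refine ⟨a * (u : PlaneField) ^ l, mul_mem a.2 (pow_mem u.2 _), c * (u : PlaneField) ^ k,
      mul_mem c.2 (pow_mem u.2 _), mul_ne_zero hc0 huk, ?_, ?_⟩
    · have h9 : ((c : PlaneField) * (u : PlaneField) ^ k)⁻¹ = (s : PlaneField)⁻¹ *
          ((t : PlaneField)⁻¹ * (s' : PlaneField)⁻¹) * ((u : PlaneField)⁻¹ ^ l *
          (u : PlaneField)⁻¹ ^ k) := by
        rw [hc', hbs', inv_pow, inv_pow]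
        field_simp
      rw [h9]
      exact mul_mem (mul_mem (hRV (invR hs))
        (mul_mem (invV ht) (hRV (invR hs'))))
        (mul_mem (pow_mem huV _) (pow_mem huV _))
    · have ha' : (a : PlaneField) = b * s' * (u : PlaneField) ^ k := by
        rw [ha, div_mul_cancel₀ _ huk]
      rw [hbs, hbs', ha', hc']
      field_simp

theorem quadraticTransform_primeDivisor (hi : P.rep i ≠ 0) {R : LocalSubring PlaneField}
    (hR : IsQuadraticTransform (localRingAt P) R) {q : Ideal R.toSubring} [q.IsPrime]
    (hq : q.height = 1) :
    LocalSubring.ofPrime R.toSubring q = excLocal i P ∨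
      ∃ (π : MvPolynomial (Fin 2) ℂ) (hπ : Prime π),
        LocalSubring.ofPrime R.toSubring q = curveLocal i hπ := by
  obtain ⟨u, hu, hu0, N, hN, ⟨v, hvN, hv⟩, hR⟩ := hR
  exact blowUpChart_primeDivisor hi hu (fun h => hu0 (Subtype.ext h)) rfl hvN hv hR hq rfl

/-- The prime divisors on the blow-up of the plane are the exceptional curves and the strict
transforms of irreducible curves. -/
theorem primeDivisor_cases {S : Set Plane} (V : PrimeDivisor (blowUp S)) :
    ∃ i, (∃ P ∈ S, P.rep i ≠ 0 ∧ V.1 = excLocal i P) ∨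
      ∃ (π : MvPolynomial (Fin 2) ℂ) (hπ : Prime π), V.1 = curveLocal i hπ := by
  obtain ⟨V, R, ⟨P, hP⟩, q, hq, hht, rfl⟩ := V
  obtain ⟨i, hi⟩ := exists_rep_ne_zero P
  rcases hP with ⟨hPS, rfl⟩ | ⟨hPS, hR⟩
  · exact ⟨i, Or.inr (exists_eq_curveLocal hi hht)⟩
  · rcases quadraticTransform_primeDivisor hi hR hht with h | h
    · exact ⟨i, Or.inl ⟨P, hPS, hi, h⟩⟩
    · exact ⟨i, Or.inr h⟩

theorem coord_div_eq_one_or_chart (i j : Fin 3) :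
    coord j / coord i = 1 ∨ ∃ a, coord j / coord i = chart i (X a) := by
  refine i.succAboveCases ?_ (fun a => ?_) j
  · exact Or.inl (div_self (coord_ne_zero i))
  · exact Or.inr ⟨a, by simp [chart]⟩

/-- If a discrete local ring dominates the local ring at `Q` and contains the `i`-th affine
chart, then `Q` lies in this chart and the coordinate functions of `Q` are not units. -/
theorem rep_ne_zero_of_localRingAt_le {Q : Plane} {V : LocalSubring PlaneField}
    (h : localRingAt Q ≤ V) (hV : ∀ a, chart i a ∈ V.toSubring) : Q.rep i ≠ 0 := by
  obtain ⟨hle, hloc⟩ := localSubring_le_iff.1 h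
  obtain ⟨j, hj⟩ := exists_rep_ne_zero Q
  -- The function `coord i / coord j` is regular at `Q`, and its inverse lies in `V`, so domination
  -- makes it a unit at `Q`.
  have hji : (coord i / coord j)⁻¹ ∈ V.toSubring := by
    rw [inv_div]
    obtain h1 | ⟨a, h1⟩ := coord_div_eq_one_or_chart i j
    · rw [h1]
      exact one_mem _
    · rw [h1]
      exact hV _
  have hij : coord i / coord j ∈ (localRingAt Q).toSubring :=
    ⟨1, X i, X j, isHomogeneous_X _ _, isHomogeneous_X _ _, by simpa [Vanishes] using hj,
      by simp [generic]⟩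
  have hinv := hloc _ hij (div_ne_zero (coord_ne_zero i) (coord_ne_zero j)) hji
  intro h0
  have hval : coord i / coord j = chart j (dehom j (X i)) := by
    rw [chart_dehom, aeval_X]
  have hX0 : dehom j (X i) ≠ 0 :=
    dehom_ne_zero j (isHomogeneous_X _ _) (X_ne_zero _)
  have hpos : 0 < ord (excLocal j Q) (coord i / coord j) := by
    rw [hval]
    refine (ord_blowLocal_pos_iff j _ hX0).2 ?_
    rw [eval_dehom_eq_zero_iff hj (isHomogeneous_X _ _), eval_X, h0]
  have := (ord_excLocal_pos_iff hj (f := ⟨_, hij⟩)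
    (div_ne_zero (coord_ne_zero i) (coord_ne_zero j))).1 hpos
  exact (mem_maximalIdeal_iff (V := localRingAt Q) (f := ⟨_, hij⟩)
    (div_ne_zero (coord_ne_zero i) (coord_ne_zero j))).1 this hinv

theorem inv_chart_notMem_of_localRingAt_le {Q : Plane} {V : LocalSubring PlaneField}
    (h : localRingAt Q ≤ V) (hi : Q.rep i ≠ 0) {a : MvPolynomial (Fin 2) ℂ} (ha : a ≠ 0)
    (h0 : eval (affinePoint i Q.rep) a = 0) : (chart i a)⁻¹ ∉ V.toSubring := by
  intro hinv
  have ha0 : chart i a ≠ 0 := (map_ne_zero_iff _ (chart_injective i)).2 ha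
  have hmem := (localSubring_le_iff.1 h).2 _ (chart_mem_localRingAt hi a) ha0 hinv
  have hpos := (ord_excLocal_pos_iff hi (f := ⟨_, chart_mem_localRingAt hi a⟩) ha0).1
    ((ord_blowLocal_pos_iff i _ ha).2 h0)
  exact (mem_maximalIdeal_iff (V := localRingAt Q)
    (f := ⟨_, chart_mem_localRingAt hi a⟩) ha0).1 hpos hmem

theorem chart_mem_curveLocal (i : Fin 3) {π : MvPolynomial (Fin 2) ℂ} (hπ : Prime π)
    (a : MvPolynomial (Fin 2) ℂ) : chart i a ∈ (curveLocal i hπ).toSubring :=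
  map_mem_primeLocal (θ := (chart i).toRingHom) _ hπ a

/-- Domination would make `π` divide both `X 0 - c₀` and `X 1 - c₁`. Comparing first derivatives at
a zero of `π` excludes this. -/
theorem not_localRingAt_le_curveLocal {π : MvPolynomial (Fin 2) ℂ} (hπ : Prime π) (Q : Plane) :
    ¬ localRingAt Q ≤ curveLocal i hπ := by
  intro h
  have hi := rep_ne_zero_of_localRingAt_le h (chart_mem_curveLocal i hπ)
  have hdvd : ∀ a, π ∣ X a - C (affinePoint i Q.rep a) := by
    intro a
    have h1 := inv_chart_notMem_of_localRingAt_le h hi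
      (X_sub_C_ne_zero a (affinePoint i Q.rep a)) (by simp)
    by_contra hnot
    exact h1 (inv_map_mem_primeLocal (θ := (chart i).toRingHom) _ hπ hnot)
  obtain ⟨q, hq⟩ := exists_eval_eq_zero hπ.not_isUnit
  obtain ⟨a, ha⟩ := hdvd 0
  obtain ⟨b, hb⟩ := hdvd 1
  have h1 := congrArg (fun f => eval q (pderiv 0 f)) ha
  have h2 := congrArg (fun f => eval q (pderiv 1 f)) ha
  have h3 := congrArg (fun f => eval q (pderiv 1 f)) hb
  simp [Derivation.leibniz, hq, pderiv_X] at h1 h2 h3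
  rcases h2 with h2 | h2
  · rw [h2] at h1
    simp at h1
  · rw [h2] at h3
    simp at h3

theorem chart_mem_excLocal (hi : P.rep i ≠ 0) (a : MvPolynomial (Fin 2) ℂ) :
    chart i a ∈ (excLocal i P).toSubring :=
  localRingAt_toSubring_le_excLocal hi (chart_mem_localRingAt hi a)

theorem localRingAt_le_excLocal_iff (hi : P.rep i ≠ 0) {Q : Plane} :
    localRingAt Q ≤ excLocal i P ↔ Q = P := by
  constructor
  · intro h
    have hiQ := rep_ne_zero_of_localRingAt_le h (chart_mem_excLocal hi)
    refine affinePoint_injOn i hiQ hi (funext fun a => ?_)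
    have h1 := inv_chart_notMem_of_localRingAt_le h hiQ
      (X_sub_C_ne_zero a (affinePoint i Q.rep a)) (by simp)
    obtain ⟨ϖ, hϖ⟩ := exists_isDiscrete_excLocal i P
    have ha0 : chart i (X a - C (affinePoint i Q.rep a)) ≠ 0 :=
      (map_ne_zero_iff _ (chart_injective i)).2 (X_sub_C_ne_zero _ _)
    have h2 := (hϖ.ord_pos_iff ha0).2 h1
    have h3 := (ord_blowLocal_pos_iff i _ (X_sub_C_ne_zero _ _)).1 h2
    simp only [map_sub, eval_X, eval_C] at h3
    exact (sub_eq_zero.1 h3).symm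
  · rintro rfl
    exact localRingAt_le_excLocal hi

end Classification

/-! ### Coefficients of `K` and the representatives given by weights. -/

section Divisors

open MvPolynomial

variable {Z : Set (LocalSubring PlaneField)} {V : LocalSubring PlaneField} {ϖ : PlaneField}
  {i : Fin 3}

theorem ord_generic (hV : IsDiscrete V ϖ) (i : Fin 3) {k : ℕ} {A : MvPolynomial (Fin 3) ℂ}
    (hA : A.IsHomogeneous k) (h0 : A ≠ 0) :
    ord V (generic A) = k * ord V (coord i) + ord V (chart i (dehom i A)) := by
  have h1 : chart i (dehom i A) ≠ 0 :=
    (map_ne_zero_iff _ (chart_injective i)).2 (dehom_ne_zero i hA h0)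
  rw [generic_eq i hA, hV.ord_mul (pow_ne_zero _ (coord_ne_zero i)) h1,
    hV.ord_pow (coord_ne_zero i)]

theorem ord_chart_nonneg (hV : IsDiscrete V ϖ) (hi : ∀ a, chart i a ∈ V.toSubring) {k : ℕ}
    {A : MvPolynomial (Fin 3) ℂ} (hA : A.IsHomogeneous k) (h0 : A ≠ 0) :
    0 ≤ ord V (chart i (dehom i A)) := by
  have h1 : chart i (dehom i A) ≠ 0 :=
    (map_ne_zero_iff _ (chart_injective i)).2 (dehom_ne_zero i hA h0)
  exact (hV.ord_nonneg_iff h1).2 (hi _)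

theorem ord_coord_le (hV : IsDiscrete V ϖ) (hi : ∀ a, chart i a ∈ V.toSubring) (j : Fin 3) :
    ord V (coord i) ≤ ord V (coord j) := by
  have h : coord j / coord i ∈ V.toSubring := by
    obtain h1 | ⟨a, h1⟩ := coord_div_eq_one_or_chart i j
    · rw [h1]
      exact one_mem _
    · rw [h1]
      exact hi _
  rw [← hV.ord_nonneg_iff (div_ne_zero (coord_ne_zero j) (coord_ne_zero i)),
    hV.ord_div (coord_ne_zero j) (coord_ne_zero i)] at h
  omega

/-- When `V` contains the `i`-th chart, `coord i` has the least order among the coordinates, so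
dividing by its power gives the maximum in the definition. -/
theorem pullbackCurve_apply {V : PrimeDivisor Z} (hV : IsDiscrete V.1 ϖ)
    (hi : ∀ a, chart i a ∈ V.1.toSubring) {k : ℕ} {A : MvPolynomial (Fin 3) ℂ}
    (hA : A.IsHomogeneous k) (h0 : A ≠ 0) :
    pullbackCurve Z A V = (ord V.1 (chart i (dehom i A)) : ℚ) := by
  rw [pullbackCurve, Int.cast_inj]
  simp only [← chart_dehom]
  refine le_antisymm (Finset.sup'_le _ _ fun j _ => ?_) ?_
  · have h1 := ord_generic hV i hA h0
    have h2 := ord_generic hV j hA h0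
    have h3 := mul_le_mul_of_nonneg_left (ord_coord_le hV hi j) (Nat.cast_nonneg (α := ℤ) k)
    omega
  · exact Finset.le_sup' (fun j => ord V.1 (chart j (dehom j A))) (Finset.mem_univ i)

variable {d n τ : ℕ} {F : Fin τ → MvPolynomial (Fin 3) ℂ}

open Classical in
theorem multiplicity_eq_sum (P : Plane) :
    (multiplicity F P : ℚ) = ∑ j, if Vanishes (F j) P then 1 else 0 := by
  rw [Finset.sum_boole, multiplicity, Set.ncard_eq_toFinset_card', Set.toFinset_ofPred]

/-- The part of the divisor `divisorK` that is supported on the exceptional curves. -/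
def exceptionalPart (F : Fin τ → MvPolynomial (Fin 3) ℂ) (n : ℕ)
    (V : PrimeDivisor (blowUp (essentialSing F))) : ℚ :=
  (∑ᶠ P ∈ essentialSing F, exceptional _ P) V +
    (((n : ℚ) - 1) / n) * ((∑ᶠ P ∈ essentialSing F, exceptional _ P) V -
      (∑ᶠ P ∈ essentialSing F, (multiplicity F P : ℚ) • exceptional _ P) V)

theorem exceptionalPart_eq_zero (hF : IsTransversalArrangement d F)
    {V : PrimeDivisor (blowUp (essentialSing F))} (hV : ∀ P, ¬ localRingAt P ≤ V.1) :
    exceptionalPart F n V = 0 := by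
  have hS := finite_essentialSing hF
  rw [exceptionalPart, finsum_mem_eq_finite_toFinset_sum _ hS,
    finsum_mem_eq_finite_toFinset_sum _ hS]
  simp [exceptional, hV]

theorem exceptionalPart_eq (hF : IsTransversalArrangement d F)
    {V : PrimeDivisor (blowUp (essentialSing F))} {P : Plane} (hP : P ∈ essentialSing F)
    (hV : ∀ Q, localRingAt Q ≤ V.1 ↔ Q = P) :
    exceptionalPart F n V = 1 + (((n : ℚ) - 1) / n) * (1 - multiplicity F P) := by
  have hS := finite_essentialSing hF
  rw [exceptionalPart, finsum_mem_eq_finite_toFinset_sum _ hS,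
    finsum_mem_eq_finite_toFinset_sum _ hS]
  classical
  have h : ∀ Q, exceptional (blowUp (essentialSing F)) Q V = if Q = P then 1 else 0 := by
    intro Q
    rw [exceptional]
    exact if_congr (hV Q) rfl rfl
  simp [h, hP]

theorem divisorK_apply (hF : IsTransversalArrangement d F) {G : MvPolynomial (Fin 3) ℂ}
    (hG : G.IsHomogeneous 3) (hG0 : G ≠ 0) {V : PrimeDivisor (blowUp (essentialSing F))}
    (hV : IsDiscrete V.1 ϖ) (hi : ∀ a, chart i a ∈ V.1.toSubring) :
    divisorK F n G V = -(ord V.1 (chart i (dehom i G)) : ℚ) +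
      (((n : ℚ) - 1) / n) * ∑ j, (ord V.1 (chart i (dehom i (F j))) : ℚ) +
        exceptionalPart F n V := by
  simp only [divisorK, exceptionalPart, Pi.add_apply, Pi.neg_apply, Pi.smul_apply, Pi.sub_apply,
    Finset.sum_apply, smul_eq_mul, pullbackCurve_apply hV hi hG hG0,
    fun j => pullbackCurve_apply hV hi (hF.homogeneous j) (hF.ne_zero j)]
  ring

/-- Total degree zero cancels the powers of `coord i`, so the values at `(1 : x : y)` may be
replaced by local equations in any chart. -/
theorem ord_generic_mul_prod (hF : IsTransversalArrangement d F) (hV : IsDiscrete V ϖ)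
    (i : Fin 3) {k l m : ℕ} {A G : MvPolynomial (Fin 3) ℂ} (hA : A.IsHomogeneous k) (hA0 : A ≠ 0)
    (hG : G.IsHomogeneous l) (hG0 : G ≠ 0) (e : Fin τ → ℤ)
    (hdeg : (k : ℤ) + l * m + d * ∑ j, e j = 0) :
    ord V (generic A * generic G ^ m * ∏ j, generic (F j) ^ e j) =
      ord V (chart i (dehom i A)) + m * ord V (chart i (dehom i G)) +
        ∑ j, e j * ord V (chart i (dehom i (F j))) := by
  have hA1 := generic_ne_zero hA hA0
  have hG1 := generic_ne_zero hG hG0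
  have hF1 := hF.generic_ne_zero
  rw [hV.ord_mul (mul_ne_zero hA1 (pow_ne_zero _ hG1))
    (Finset.prod_ne_zero_iff.2 fun j _ => zpow_ne_zero _ (hF1 j)),
    hV.ord_mul hA1 (pow_ne_zero _ hG1), hV.ord_pow hG1,
    hV.ord_prod _ fun j _ => zpow_ne_zero _ (hF1 j)]
  simp only [hV.ord_zpow (hF1 _), ord_generic hV i hA hA0, ord_generic hV i hG hG0,
    fun j => ord_generic hV i (hF.homogeneous j) (hF.ne_zero j), mul_add,
    Finset.sum_add_distrib, ← mul_assoc, ← Finset.sum_mul]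
  linear_combination ord V (coord i) * hdeg

/-- Position of a prime divisor relative to an arrangement. -/
structure IsExceptionalOver (F : Fin τ → MvPolynomial (Fin 3) ℂ) (i : Fin 3)
    (V : LocalSubring PlaneField) (P : Plane) : Prop where
  mem : P ∈ essentialSing F
  le_iff : ∀ Q, localRingAt Q ≤ V ↔ Q = P
  ord_of_vanishes : ∀ j, Vanishes (F j) P → ord V (chart i (dehom i (F j))) = 1
  ord_of_not_vanishes : ∀ j, ¬ Vanishes (F j) P → ord V (chart i (dehom i (F j))) = 0

/-- Smoothness of the curves enters here: a smooth curve has order exactly one along the exceptional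
curve over each of its points. -/
theorem exists_chart_primeDivisor (hF : IsTransversalArrangement d F)
    (V : PrimeDivisor (blowUp (essentialSing F))) :
    ∃ i ϖ, IsDiscrete V.1 ϖ ∧ (∀ a, chart i a ∈ V.1.toSubring) ∧
      ((∃ P, IsExceptionalOver F i V.1 P) ∨
        ∃ (π : MvPolynomial (Fin 2) ℂ) (hπ : Prime π), V.1 = curveLocal i hπ) := by
  obtain ⟨i, ⟨P, hP, hi, hV⟩ | ⟨π, hπ, hV⟩⟩ := primeDivisor_cases V
  · obtain ⟨ϖ, hϖ⟩ := exists_isDiscrete_excLocal i P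
    rw [hV]
    refine ⟨i, ϖ, hϖ, chart_mem_excLocal hi, Or.inl ⟨P, hP, fun Q => localRingAt_le_excLocal_iff hi,
      fun j hj => ?_, fun j hj => ?_⟩⟩
    · rw [vanishes_iff hi (hF.homogeneous j)] at hj
      exact ord_blowLocal_eq_one i _ hj (hF.exists_pderiv_ne_zero i hj)
    · rw [vanishes_iff hi (hF.homogeneous j)] at hj
      exact ord_excLocal_chart_eq_zero hj
  · rw [hV]
    exact ⟨i, _, isDiscrete_curveLocal i hπ, chart_mem_curveLocal i hπ, Or.inr ⟨π, hπ, rfl⟩⟩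

open Classical in
theorem IsExceptionalOver.sum_mul_ord {V : LocalSubring PlaneField} {P : Plane}
    (h : IsExceptionalOver F i V P) (x : Fin τ → ℚ) :
    ∑ j, x j * (ord V (chart i (dehom i (F j))) : ℚ) =
      ∑ j, x j * if Vanishes (F j) P then 1 else 0 := by
  refine Finset.sum_congr rfl fun j _ => ?_
  by_cases hj : Vanishes (F j) P
  · rw [h.ord_of_vanishes j hj, if_pos hj, Int.cast_one]
  · rw [h.ord_of_not_vanishes j hj, if_neg hj, Int.cast_zero]

theorem exists_common_denominator (x : Fin τ → ℚ) :
    ∃ m : ℕ, 0 < m ∧ ∀ j, ∃ e : ℤ, (m : ℚ) * x j = e := by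
  refine ⟨∏ j, (x j).den, Finset.prod_pos fun j _ => (x j).den_pos, fun j => ?_⟩
  refine ⟨(∏ k ∈ Finset.univ.erase j, (x k).den : ℕ) * (x j).num, ?_⟩
  rw [← Finset.mul_prod_erase _ _ (Finset.mem_univ j)]
  push_cast
  have h := Rat.mul_den_eq_num (x j)
  linear_combination (∏ k ∈ Finset.univ.erase j, ((x k).den : ℚ)) * h

/-- With `m` clearing the denominators of `x_j - l`, the product `G^m ∏ F_j^(m (x_j - l))` has
degree zero by `hx`, so it is a rational function. Adding `1 / m` times its divisor to `K` cancels
`-div G` and replaces every weight `l` by `x_j`. -/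
theorem exists_qLinearlyEquivalent (hF : IsTransversalArrangement d F)
    {G : MvPolynomial (Fin 3) ℂ} (hG : G.IsHomogeneous 3) (hG0 : G ≠ 0) (x : Fin τ → ℚ)
    (hx : d * ∑ j, x j = d * τ * (((n : ℚ) - 1) / n) - 3) :
    ∃ B : QDivisor (blowUp (essentialSing F)), QLinearlyEquivalent B (divisorK F n G) ∧
      ∀ V i ϖ, IsDiscrete V.1 ϖ → (∀ a, chart i a ∈ V.1.toSubring) →
        B V = ∑ j, x j * (ord V.1 (chart i (dehom i (F j))) : ℚ) + exceptionalPart F n V := by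
  set l := ((n : ℚ) - 1) / n with hl
  obtain ⟨m, hm, hme⟩ := exists_common_denominator fun j => x j - l
  choose e he using hme
  have hm0 : (m : ℚ) ≠ 0 := Nat.cast_ne_zero.2 hm.ne'
  have hdeg : ((0 : ℕ) : ℤ) + (3 : ℕ) * m + d * ∑ j, e j = 0 := by
    have h1 : (∑ j, (e j : ℚ)) = m * (∑ j, x j - τ * l) := by
      rw [Finset.sum_congr rfl fun j _ => (he j).symm, ← Finset.mul_sum, Finset.sum_sub_distrib]
      simp
    have h2 : ((((0 : ℕ) : ℤ) + (3 : ℕ) * m + d * ∑ j, e j : ℤ) : ℚ) = 0 := by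
      push_cast
      rw [h1]
      linear_combination m * hx
    exact_mod_cast h2
  -- The constant form `1` only fills the place of `A` in `ord_generic_mul_prod`.
  let g := generic (1 : MvPolynomial (Fin 3) ℂ) * generic G ^ m * ∏ j, generic (F j) ^ e j
  refine ⟨fun V => divisorK F n G V + ord V.1 g / m, ⟨m, hm, g, ?_, fun V => ?_⟩,
    fun V i ϖ hV hi => ?_⟩
  · refine mul_ne_zero (mul_ne_zero ?_ (pow_ne_zero _ (generic_ne_zero hG hG0)))
      (Finset.prod_ne_zero_iff.2 fun j _ => zpow_ne_zero _ (hF.generic_ne_zero j))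
    simp [generic]
  · field_simp
  · simp only
    rw [divisorK_apply hF hG hG0 hV hi,
      ord_generic_mul_prod hF hV i (isHomogeneous_one _ _) one_ne_zero hG hG0 e hdeg]
    simp only [map_one, hV.ord_one]
    push_cast
    have h3 : ∑ j, (e j : ℚ) * (ord V.1 (chart i (dehom i (F j))) : ℚ) =
        m * (∑ j, x j * (ord V.1 (chart i (dehom i (F j))) : ℚ) -
          l * ∑ j, (ord V.1 (chart i (dehom i (F j))) : ℚ)) := by
      rw [Finset.mul_sum, ← Finset.sum_sub_distrib, Finset.mul_sum]
      refine Finset.sum_congr rfl fun j _ => ?_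
      rw [← he]
      ring
    rw [h3]
    field_simp
    ring

end Divisors

/-! ### Finite support and nefness of `K`. -/

section Positivity

open MvPolynomial

variable {d n τ : ℕ} {F : Fin τ → MvPolynomial (Fin 3) ℂ} {G : MvPolynomial (Fin 3) ℂ}

theorem finite_curveLocal_of_dvd (i : Fin 3) {a : MvPolynomial (Fin 2) ℂ} (ha : a ≠ 0) :
    {W | ∃ (π : MvPolynomial (Fin 2) ℂ) (hπ : Prime π), π ∣ a ∧ W = curveLocal i hπ}.Finite := by
  classical
  have h : (⋃ q ∈ ((UniqueFactorizationMonoid.factors a).toFinset :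
      Set (MvPolynomial (Fin 2) ℂ)), {W | ∃ hq : Prime q, W = curveLocal i hq}).Finite := by
    refine (Finset.finite_toSet _).biUnion fun q _ => Set.Subsingleton.finite ?_
    rintro _ ⟨_, rfl⟩ _ ⟨_, rfl⟩
    rfl
  refine h.subset ?_
  rintro _ ⟨π, hπ, hdvd, rfl⟩
  obtain ⟨q, hq, hπq⟩ := UniqueFactorizationMonoid.exists_mem_factors_of_dvd ha hπ.irreducible hdvd
  have hq' : Prime q := UniqueFactorizationMonoid.prime_of_factor q hq
  simp only [Set.mem_iUnion]
  exact ⟨q, by simpa using hq, hq', primeLocal_congr _ hπ hq' hπq⟩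

theorem ord_curveLocal_pos_iff (i : Fin 3) {π : MvPolynomial (Fin 2) ℂ} (hπ : Prime π)
    {a : MvPolynomial (Fin 2) ℂ} (ha : a ≠ 0) :
    0 < ord (curveLocal i hπ) (chart i a) ↔ π ∣ a :=
  ord_primeLocal_pos_iff _ hπ (exists_chart_div i) ha

theorem finite_support_divisorK (hF : IsTransversalArrangement d F) (hG : G.IsHomogeneous 3)
    (hG0 : G ≠ 0) : (Function.support (divisorK F n G)).Finite := by
  -- The possible members of the support: exceptional curves, components of `G`, and components of
  -- the `F j`.
  have hT : ((⋃ i, excLocal i '' essentialSing F) ∪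
      ((⋃ i, {W | ∃ (π : MvPolynomial (Fin 2) ℂ) (hπ : Prime π), π ∣ dehom i G ∧
        W = curveLocal i hπ}) ∪
      ⋃ (i) (j), {W | ∃ (π : MvPolynomial (Fin 2) ℂ) (hπ : Prime π), π ∣ dehom i (F j) ∧
        W = curveLocal i hπ})).Finite :=
    (Set.finite_iUnion fun i => (finite_essentialSing hF).image _).union
      ((Set.finite_iUnion fun i => finite_curveLocal_of_dvd i (dehom_ne_zero i hG hG0)).union
        (Set.finite_iUnion fun i => Set.finite_iUnion fun j =>
          finite_curveLocal_of_dvd i (hF.dehom_ne_zero i j)))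
  refine (hT.preimage (f := fun V : PrimeDivisor (blowUp (essentialSing F)) => V.1)
    Subtype.val_injective.injOn).subset fun V hV => ?_
  obtain ⟨i, ⟨P, hP, hi, h⟩ | ⟨π, hπ, h⟩⟩ := primeDivisor_cases V
  · exact Or.inl (Set.mem_iUnion.2 ⟨i, P, hP, h.symm⟩)
  · right
    by_cases h1 : π ∣ dehom i G
    · exact Or.inl (Set.mem_iUnion.2 ⟨i, π, hπ, h1, h⟩)
    by_cases h2 : ∃ j, π ∣ dehom i (F j)
    · obtain ⟨j, hj⟩ := h2
      exact Or.inr (Set.mem_iUnion.2 ⟨i, Set.mem_iUnion.2 ⟨j, π, hπ, hj, h⟩⟩)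
    · exfalso
      apply hV
      have hd : IsDiscrete V.1 (chart i π) := h ▸ isDiscrete_curveLocal i hπ
      have hc : ∀ a, chart i a ∈ V.1.toSubring := h ▸ chart_mem_curveLocal i hπ
      have hzero : ∀ a, a ≠ 0 → ¬ π ∣ a → ord V.1 (chart i a) = 0 := by
        intro a ha hdvd
        refine le_antisymm (not_lt.1 fun h3 => hdvd ?_) ?_
        · rw [h] at h3
          exact (ord_curveLocal_pos_iff i hπ ha).1 h3
        · exact (hd.ord_nonneg_iff ((map_ne_zero_iff _ (chart_injective i)).2 ha)).2 (hc a)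
      push Not at h2
      rw [divisorK_apply hF hG hG0 hd hc, hzero _ (dehom_ne_zero i hG hG0) h1,
        exceptionalPart_eq_zero hF (h ▸ not_localRingAt_le_curveLocal hπ)]
      simp [hzero _ (hF.dehom_ne_zero i _) (h2 _)]

/-- Local multiplicities are natural numbers, so every term of the sum is nonnegative. No
intersection number has to be computed. -/
theorem HasIntersectionNumber.of_effective {K : Type*} [Field K] {Z : Set (LocalSubring K)}
    {A B : QDivisor Z} {C : PrimeDivisor Z} (hBA : QLinearlyEquivalent B A)
    (hB : ∀ V, 0 ≤ B V) (hC : B C = 0) : ∃ q : ℚ, HasIntersectionNumber A C q ∧ 0 ≤ q :=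
  ⟨_, ⟨B, hBA, hC, rfl⟩, finsum_nonneg fun V => mul_nonneg (hB V) (Nat.cast_nonneg _)⟩

theorem ord_dehom_nonneg (hF : IsTransversalArrangement d F) {V : LocalSubring PlaneField}
    {ϖ : PlaneField} {i : Fin 3} (hV : IsDiscrete V ϖ) (hi : ∀ a, chart i a ∈ V.toSubring)
    (j : Fin τ) : (0 : ℚ) ≤ ord V (chart i (dehom i (F j))) :=
  Int.cast_nonneg (ord_chart_nonneg hV hi (hF.homogeneous j) (hF.ne_zero j))

open Classical in
/-- Effectivity of `∑ x_j π^* C_j` plus an exceptional divisor. -/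
theorem effective_of_weights (hF : IsTransversalArrangement d F) {x : Fin τ → ℚ}
    (hx : ∀ j, 0 ≤ x j)
    (hxP : ∀ P ∈ essentialSing F, (((n : ℚ) - 1) / n) * (multiplicity F P - 1) - 1 ≤
      ∑ j, x j * if Vanishes (F j) P then 1 else 0)
    (V : PrimeDivisor (blowUp (essentialSing F))) {ϖ : PlaneField} {i : Fin 3}
    (hV : IsDiscrete V.1 ϖ) (hi : ∀ a, chart i a ∈ V.1.toSubring)
    (hcases : (∃ P, IsExceptionalOver F i V.1 P) ∨
        ∃ (π : MvPolynomial (Fin 2) ℂ) (hπ : Prime π), V.1 = curveLocal i hπ) :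
    0 ≤ ∑ j, x j * (ord V.1 (chart i (dehom i (F j))) : ℚ) + exceptionalPart F n V := by
  rcases hcases with ⟨P, hP⟩ | ⟨π, hπ, h⟩
  · rw [hP.sum_mul_ord, exceptionalPart_eq hF hP.mem hP.le_iff]
    have := hxP P hP.mem
    linarith
  · rw [exceptionalPart_eq_zero hF (h ▸ not_localRingAt_le_curveLocal hπ), add_zero]
    exact Finset.sum_nonneg fun j _ => mul_nonneg (hx j) (ord_dehom_nonneg hF hV hi j)

-- The weights may depend on `C`: `hxP` is effectivity along the exceptional curves, and `hC` says
-- that the representative does not contain `C`.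
open Classical in
theorem exists_intersectionNumber_of_weights (hF : IsTransversalArrangement d F)
    (hG : G.IsHomogeneous 3) (hG0 : G ≠ 0) {x : Fin τ → ℚ} (hx : ∀ j, 0 ≤ x j)
    (hsum : d * ∑ j, x j = d * τ * (((n : ℚ) - 1) / n) - 3)
    (hxP : ∀ P ∈ essentialSing F, (((n : ℚ) - 1) / n) * (multiplicity F P - 1) - 1 ≤
      ∑ j, x j * if Vanishes (F j) P then 1 else 0)
    (C : PrimeDivisor (blowUp (essentialSing F))) {ϖ : PlaneField} {i : Fin 3}
    (hV : IsDiscrete C.1 ϖ) (hi : ∀ a, chart i a ∈ C.1.toSubring)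
    (hC : ∑ j, x j * (ord C.1 (chart i (dehom i (F j))) : ℚ) + exceptionalPart F n C = 0) :
    ∃ q : ℚ, HasIntersectionNumber (divisorK F n G) C q ∧ 0 ≤ q := by
  obtain ⟨B, hB, hBV⟩ := exists_qLinearlyEquivalent hF hG hG0 x hsum
  refine HasIntersectionNumber.of_effective hB (fun V => ?_) ?_
  · obtain ⟨i, ϖ, hV, hi, hc⟩ := exists_chart_primeDivisor hF V
    rw [hBV V i ϖ hV hi]
    exact effective_of_weights hF hx hxP V hV hi hc
  · rw [hBV C i ϖ hV hi, hC]

theorem three_le_multiplicity {P : Plane} (hP : P ∈ essentialSing F) :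
    (3 : ℚ) ≤ multiplicity F P := by
  have : 3 ≤ multiplicity F P := hP
  exact_mod_cast this

theorem multiplicity_add_one_le (ht : numPoints F τ = 0) (P : Plane) :
    (multiplicity F P : ℚ) + 1 ≤ τ := by
  exact_mod_cast multiplicity_lt_of_numPoints_eq_zero ht P

theorem half_le_weight (hn : 2 ≤ n) : (1 / 2 : ℚ) ≤ ((n : ℚ) - 1) / n := by
  have : (2 : ℚ) ≤ n := by exact_mod_cast hn
  rw [le_div_iff₀ (by linarith)]
  linarith

theorem weight_lt_one (hn : 2 ≤ n) : ((n : ℚ) - 1) / n < 1 := by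
  have : (2 : ℚ) ≤ n := by exact_mod_cast hn
  rw [div_lt_one (by linarith)]
  linarith

-- One index `j₀` gets weight zero so that `C` drops out of the support; the other curves share the
-- whole degree equally. A point loses at most one curve in this way, which effectivity can afford
-- since `k_P < τ` and `3 / d ≤ 1`.
open Classical in
theorem nef_at_curve (hd : 3 ≤ d) (hn : 2 ≤ n) (hτ : 4 ≤ τ) (hF : IsTransversalArrangement d F)
    (ht : numPoints F τ = 0) (hG : G.IsHomogeneous 3) (hG0 : G ≠ 0)
    (C : PrimeDivisor (blowUp (essentialSing F))) {i : Fin 3} {π : MvPolynomial (Fin 2) ℂ}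
    (hπ : Prime π) (hC : C.1 = curveLocal i hπ) :
    ∃ q : ℚ, HasIntersectionNumber (divisorK F n G) C q ∧ 0 ≤ q := by
  have hd' : (3 : ℚ) ≤ d := by exact_mod_cast hd
  have hτ' : (4 : ℚ) ≤ τ := by exact_mod_cast hτ
  have hl1 := half_le_weight hn
  have hl2 := weight_lt_one hn
  set l := ((n : ℚ) - 1) / n with hl
  have hdisc : IsDiscrete C.1 (chart i π) := hC ▸ isDiscrete_curveLocal i hπ
  have hc : ∀ a, chart i a ∈ C.1.toSubring := hC ▸ chart_mem_curveLocal i hπ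
  -- The curve `C` is a component of at most one `F j`; if it is a component of none, any index
  -- serves.
  obtain ⟨j₀, hj₀⟩ : ∃ j₀ : Fin τ, ∀ j, j ≠ j₀ → ord C.1 (chart i (dehom i (F j))) = 0 := by
    by_cases h : ∃ j, π ∣ dehom i (F j)
    · obtain ⟨j₀, hj₀⟩ := h
      refine ⟨j₀, fun j hj => le_antisymm (not_lt.1 fun h => ?_) ?_⟩
      · rw [hC, ord_curveLocal_pos_iff i hπ (hF.dehom_ne_zero i j)] at h
        exact hF.not_dvd_of_dvd i hj hπ h hj₀
      · exact ord_chart_nonneg hdisc hc (hF.homogeneous j) (hF.ne_zero j)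
    · push Not at h
      refine ⟨⟨0, by omega⟩, fun j _ => le_antisymm (not_lt.1 fun h' => ?_) ?_⟩
      · rw [hC, ord_curveLocal_pos_iff i hπ (hF.dehom_ne_zero i j)] at h'
        exact h j h'
      · exact ord_chart_nonneg hdisc hc (hF.homogeneous j) (hF.ne_zero j)
  set X : ℚ := (l * τ - 3 / d) / (τ - 1) with hX
  have hτ1 : (0 : ℚ) < τ - 1 := by linarith
  have h3d : 3 / (d : ℚ) ≤ 1 := by
    rw [div_le_one (by linarith)]
    exact hd'
  have hXτ : X * (τ - 1) = l * τ - 3 / d := div_mul_cancel₀ _ hτ1.ne'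
  have hX0 : 0 ≤ X := div_nonneg (by nlinarith) hτ1.le
  refine exists_intersectionNumber_of_weights hF hG hG0
    (x := fun j => X * (1 - if j = j₀ then 1 else 0)) (fun j => ?_) ?_ (fun P hP => ?_) C hdisc hc ?_
  · split_ifs <;> simp [hX0]
  · rw [← Finset.mul_sum, Finset.sum_sub_distrib]
    simp only [Finset.sum_const, Finset.card_univ, Fintype.card_fin, nsmul_eq_mul, mul_one,
      Finset.sum_ite_eq', Finset.mem_univ, if_true]
    rw [hXτ, mul_sub, mul_div_cancel₀ _ (by linarith : (d : ℚ) ≠ 0)]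
    ring
  · have hk3 := three_le_multiplicity hP
    have hkτ := multiplicity_add_one_le ht P
    have hsum : (multiplicity F P : ℚ) - 1 ≤
        ∑ j, (1 - if j = j₀ then (1 : ℚ) else 0) * if Vanishes (F j) P then 1 else 0 := by
      have h1 : ∑ j, (1 - if j = j₀ then (1 : ℚ) else 0) * (if Vanishes (F j) P then 1 else 0) =
          multiplicity F P - if Vanishes (F j₀) P then 1 else 0 := by
        simp only [sub_mul, one_mul, Finset.sum_sub_distrib, multiplicity_eq_sum, ite_mul,
          zero_mul, Finset.sum_ite_eq', Finset.mem_univ, if_true]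
      rw [h1]
      split_ifs <;> linarith
    simp only [mul_assoc, ← Finset.mul_sum]
    refine le_trans ?_ (mul_le_mul_of_nonneg_left hsum hX0)
    set k := (multiplicity F P : ℚ)
    -- The difference of the two sides is `l (k - 1) + (τ - 1) - (3 / d) (k - 1)`.
    have h2 : (l * (k - 1) - 1) * (τ - 1) ≤ X * (τ - 1) * (k - 1) := by
      rw [hXτ]
      nlinarith
    nlinarith
  · rw [exceptionalPart_eq_zero hF (hC ▸ not_localRingAt_le_curveLocal hπ), add_zero]
    refine Finset.sum_eq_zero fun j _ => ?_
    by_cases hj : j = j₀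
    · simp [hj]
    · simp [hj₀ j hj]

-- Curves through `P` get weight `y` and the others weight `z`. Here `y` is fixed by the vanishing
-- of the coefficient of `E_P`, and `z` by the degree condition; `t_τ = 0` makes the divisor `τ - k`
-- positive.
open Classical in
theorem nef_at_exceptional (hd : 3 ≤ d) (hn : 2 ≤ n) (hF : IsTransversalArrangement d F)
    (ht : numPoints F τ = 0) (hG : G.IsHomogeneous 3) (hG0 : G ≠ 0)
    (C : PrimeDivisor (blowUp (essentialSing F))) {i : Fin 3} {ϖ : PlaneField}
    (hdisc : IsDiscrete C.1 ϖ) (hc : ∀ a, chart i a ∈ C.1.toSubring) {P : Plane}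
    (hP : IsExceptionalOver F i C.1 P) :
    ∃ q : ℚ, HasIntersectionNumber (divisorK F n G) C q ∧ 0 ≤ q := by
  have hd' : (3 : ℚ) ≤ d := by exact_mod_cast hd
  have hl1 := half_le_weight hn
  set l := ((n : ℚ) - 1) / n with hl
  have hk3 := three_le_multiplicity hP.mem
  have hkτ := multiplicity_add_one_le ht P
  set k := (multiplicity F P : ℚ) with hk
  set y : ℚ := (l * (k - 1) - 1) / k with hy
  set z : ℚ := (l * (τ - k + 1) + 1 - 3 / d) / (τ - k) with hz
  have hyk : y * k = l * (k - 1) - 1 := div_mul_cancel₀ _ (by linarith)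
  have hzk : z * (τ - k) = l * (τ - k + 1) + 1 - 3 / d := div_mul_cancel₀ _ (by linarith)
  have h3d : 3 / (d : ℚ) ≤ 1 := by
    rw [div_le_one (by linarith)]
    exact hd'
  have hy0 : 0 ≤ y := div_nonneg (by nlinarith) (by linarith)
  have hzl : l ≤ z := by
    rw [hz, le_div_iff₀ (by linarith)]
    nlinarith
  have hz0 : 0 ≤ z := by linarith
  set v : Fin τ → ℚ := fun j => if Vanishes (F j) P then 1 else 0 with hv
  have hvsum : ∑ j, v j = k := (multiplicity_eq_sum P).symm
  have hvv : ∀ j, v j * v j = v j := by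
    intro j
    simp only [hv]
    split_ifs <;> simp
  have hv01 : ∀ j, 0 ≤ v j ∧ v j ≤ 1 := by
    intro j
    simp only [hv]
    split_ifs <;> simp
  refine exists_intersectionNumber_of_weights hF hG hG0
    (x := fun j => y * v j + z * (1 - v j)) (fun j => ?_) ?_ (fun Q hQ => ?_) C hdisc hc ?_
  · exact add_nonneg (mul_nonneg hy0 (hv01 j).1) (mul_nonneg hz0 (by linarith [(hv01 j).2]))
  · rw [Finset.sum_add_distrib, ← Finset.mul_sum, ← Finset.mul_sum, Finset.sum_sub_distrib, hvsum]
    simp only [Finset.sum_const, Finset.card_univ, Fintype.card_fin, nsmul_eq_mul, mul_one]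
    rw [hyk, hzk]
    have h3 : (d : ℚ) * (3 / d) = 3 := mul_div_cancel₀ _ (by linarith)
    linear_combination -h3
  · set w : Fin τ → ℚ := fun j => if Vanishes (F j) Q then 1 else 0 with hw
    have hwsum : ∑ j, w j = multiplicity F Q := (multiplicity_eq_sum Q).symm
    have hw01 : ∀ j, 0 ≤ w j ∧ w j ≤ 1 := by
      intro j
      simp only [hw]
      split_ifs <;> simp
    set s := ∑ j, v j * w j with hs
    have hsk : s ≤ k := by
      rw [← hvsum]
      exact Finset.sum_le_sum fun j _ => by nlinarith [(hv01 j).1, (hw01 j).2]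
    have hsm : s ≤ multiplicity F Q := by
      rw [← hwsum]
      exact Finset.sum_le_sum fun j _ => by nlinarith [(hv01 j).2, (hw01 j).1]
    have h1 : ∑ j, (y * v j + z * (1 - v j)) * w j = y * s + z * (multiplicity F Q - s) := by
      rw [← hwsum, hs, Finset.mul_sum, ← Finset.sum_sub_distrib, Finset.mul_sum,
        ← Finset.sum_add_distrib]
      exact Finset.sum_congr rfl fun j _ => by ring
    change _ ≤ ∑ j, (y * v j + z * (1 - v j)) * w j
    rw [h1]
    have h2 : l * (multiplicity F Q - s) ≤ z * (multiplicity F Q - s) :=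
      mul_le_mul_of_nonneg_right hzl (by linarith)
    -- By the choice of `y`, `y - l = -(l + 1) / k`, and the number `s` of curves through both `P`
    -- and `Q` is at most `k`. Together with `z ≥ l` this gives effectivity at every `Q`.
    have h3 : 0 ≤ (y - l) * s + l + 1 := by
      have h4 : 0 ≤ ((y - l) * s + l + 1) * k := by
        have : ((y - l) * s + l + 1) * k = (l + 1) * (k - s) := by
          linear_combination s * hyk
        rw [this]
        exact mul_nonneg (by linarith) (by linarith)
      exact nonneg_of_mul_nonneg_left h4 (by linarith)
    linarith
  · rw [hP.sum_mul_ord, exceptionalPart_eq hF hP.mem hP.le_iff]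
    change ∑ j, (y * v j + z * (1 - v j)) * v j + (1 + l * (1 - k)) = 0
    have h1 : ∑ j, (y * v j + z * (1 - v j)) * v j = y * k := by
      rw [← hvsum, Finset.mul_sum]
      refine Finset.sum_congr rfl fun j _ => ?_
      linear_combination (y - z) * hvv j
    rw [h1, hyk]
    ring

theorem isNef_divisorK (hd : 3 ≤ d) (hn : 2 ≤ n) (hτ : 4 ≤ τ) (hF : IsTransversalArrangement d F)
    (ht : numPoints F τ = 0) (hG : G.IsHomogeneous 3) (hG0 : G ≠ 0) :
    IsNef (divisorK F n G) := by
  intro C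
  obtain ⟨i, ϖ, hV, hi, ⟨P, hP⟩ | ⟨π, hπ, h⟩⟩ := exists_chart_primeDivisor hF C
  · exact nef_at_exceptional hd hn hF ht hG hG0 C hV hi hP
  · exact nef_at_curve hd hn hτ hF ht hG hG0 C hπ h

/-! ### Bigness of `K`. -/

theorem algebraicIndependent_coord : AlgebraicIndependent ℂ ![coord 1, coord 2] := by
  have h := (algebraicIndependent_X (Fin 2) ℂ).map'
    (f := IsScalarTower.toAlgHom ℂ (MvPolynomial (Fin 2) ℂ) PlaneField)
    (IsFractionRing.injective (MvPolynomial (Fin 2) ℂ) PlaneField)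
  convert h using 1
  funext j
  fin_cases j <;> simp [coord]

/-- The degree of the movable part of `nτ` times the canonical divisor of the cover. -/
theorem movableDegree_pos (hd : 3 ≤ d) (hn : 2 ≤ n) (hτ : 4 ≤ τ) :
    0 < τ * d * (2 * n - 1) - 3 * n * τ := by
  have h1 : 3 * (2 * n - 1) ≤ d * (2 * n - 1) := Nat.mul_le_mul_right _ hd
  have h2 : τ * (3 * n + 1) ≤ τ * (d * (2 * n - 1)) := Nat.mul_le_mul_left τ (by omega)
  have h3 : 3 * n * τ + τ = τ * (3 * n + 1) := by ring
  have h4 : τ * d * (2 * n - 1) = τ * (d * (2 * n - 1)) := by ring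
  omega

/-- Since `n τ (1 + l) / τ = 2n - 1`, adding the divisor of this function to `n τ K` leaves `div A`
plus `n τ` times the divisor with all weights `l - (1 + l) / τ`. The power of `G` cancels. -/
theorem isSection_divisorK (hd : 3 ≤ d) (hn : 2 ≤ n) (hτ : 4 ≤ τ)
    (hF : IsTransversalArrangement d F) (ht : numPoints F τ = 0) (hG : G.IsHomogeneous 3)
    (hG0 : G ≠ 0) {A : MvPolynomial (Fin 3) ℂ}
    (hA : A.IsHomogeneous (τ * d * (2 * n - 1) - 3 * n * τ)) (hA0 : A ≠ 0) :
    IsSection (((n * τ : ℕ) : ℚ) • divisorK F n G)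
      (generic A * generic G ^ (n * τ) * ∏ j, generic (F j) ^ (-(2 * n - 1 : ℤ))) := by
  classical
  right
  intro V
  obtain ⟨i, ϖ, hV, hi, hcases⟩ := exists_chart_primeDivisor hF V
  have hn' : (2 : ℚ) ≤ n := by exact_mod_cast hn
  have hτ' : (4 : ℚ) ≤ τ := by exact_mod_cast hτ
  have hdeg : ((τ * d * (2 * n - 1) - 3 * n * τ : ℕ) : ℤ) + (3 : ℕ) * (n * τ : ℕ) +
      d * ∑ _j : Fin τ, (-(2 * n - 1 : ℤ)) = 0 := by
    have := movableDegree_pos hd hn hτ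
    rw [Nat.cast_sub (by omega)]
    push_cast [Nat.cast_sub (show 1 ≤ 2 * n by omega)]
    simp only [Finset.sum_const, Finset.card_univ, Fintype.card_fin, nsmul_eq_mul]
    ring
  rw [ord_generic_mul_prod hF hV i hA hA0 hG hG0 _ hdeg, Pi.smul_apply, smul_eq_mul,
    divisorK_apply hF hG hG0 hV hi, ← Finset.mul_sum]
  push_cast
  have hAnn : (0 : ℚ) ≤ ord V.1 (chart i (dehom i A)) :=
    Int.cast_nonneg (ord_chart_nonneg hV hi hA hA0)
  set l := ((n : ℚ) - 1) / n with hl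
  have hl1 := half_le_weight hn
  have hnl : n * l = n - 1 := mul_div_cancel₀ _ (by linarith)
  have hx0 : 0 ≤ l - (1 + l) / τ := by
    rw [sub_nonneg, div_le_iff₀ (by linarith)]
    nlinarith
  -- With these weights the coefficient of `E_P` is `(1 + l) (1 - k_P / τ)`.
  have heff := effective_of_weights (n := n) hF (x := fun _ => l - (1 + l) / τ)
    (fun _ => hx0) (fun P hP => by
      rw [← Finset.mul_sum, ← multiplicity_eq_sum, ← hl]
      have hkτ := multiplicity_add_one_le ht P
      have h1 : (1 + l) / τ * multiplicity F P ≤ 1 + l := by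
        rw [div_mul_eq_mul_div, div_le_iff₀ (by linarith)]
        exact mul_le_mul_of_nonneg_left (by linarith) (by linarith)
      linarith) V hV hi hcases
  rw [← Finset.mul_sum] at heff
  have hnτ : (0 : ℚ) ≤ n * τ := by positivity
  have h2 := mul_nonneg hnτ heff
  have h3 : (n : ℚ) * τ * ((1 + l) / τ) = 2 * n - 1 := by
    rw [mul_assoc, mul_div_cancel₀ _ (by linarith : (τ : ℚ) ≠ 0)]
    linear_combination hnl
  set T := ∑ j, (ord V.1 (chart i (dehom i (F j))) : ℚ)
  have h4 : (n : ℚ) * τ * ((l - (1 + l) / τ) * T + exceptionalPart F n V) =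
      n * τ * l * T - (2 * n - 1) * T + n * τ * exceptionalPart F n V := by
    linear_combination -T * h3
  rw [h4] at h2
  linarith

/-- The factor `n` alone clears the denominators; `τ` is there to match `isSection_divisorK`. -/
theorem exists_int_eq_mul_divisorK (hn : 2 ≤ n) (hF : IsTransversalArrangement d F)
    (hG : G.IsHomogeneous 3) (hG0 : G ≠ 0) (V : PrimeDivisor (blowUp (essentialSing F))) :
    ∃ a : ℤ, ((n * τ : ℕ) : ℚ) * divisorK F n G V = a := by
  obtain ⟨i, ϖ, hV, hi, hcases⟩ := exists_chart_primeDivisor hF V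
  have hn' : (n : ℚ) ≠ 0 := by
    have : n ≠ 0 := by omega
    exact_mod_cast this
  obtain ⟨b, hb⟩ : ∃ b : ℤ, n * exceptionalPart F n V = b := by
    rcases hcases with ⟨P, hP⟩ | ⟨π, hπ, h⟩
    · refine ⟨n + (n - 1) * (1 - multiplicity F P), ?_⟩
      rw [exceptionalPart_eq hF hP.mem hP.le_iff]
      push_cast
      field_simp
    · exact ⟨0, by
        rw [exceptionalPart_eq_zero hF (h ▸ not_localRingAt_le_curveLocal hπ)]
        simp⟩
  refine ⟨τ * (-(n * ord V.1 (chart i (dehom i G))) +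
    (n - 1) * ∑ j, ord V.1 (chart i (dehom i (F j))) + b), ?_⟩
  rw [divisorK_apply hF hG hG0 hV hi]
  push_cast
  rw [← hb]
  field_simp

theorem isBig_divisorK (hd : 3 ≤ d) (hn : 2 ≤ n) (hτ : 4 ≤ τ) (hF : IsTransversalArrangement d F)
    (ht : numPoints F τ = 0) (hG : G.IsHomogeneous 3) (hG0 : G ≠ 0) :
    IsBig (divisorK F n G) := by
  obtain ⟨E, hE⟩ := Nat.exists_eq_add_of_lt (movableDegree_pos (n := n) hd hn hτ)
  have hsec := fun {A} => isSection_divisorK (A := A) hd hn hτ hF ht hG hG0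
  rw [hE, zero_add] at hsec
  -- The leftover degree is at least one, and because `coord 0 = 1` these forms take the values `1`,
  -- `x`, `y` at the generic point.
  have hhom : ∀ j : Fin 3, (X j * X 0 ^ E : MvPolynomial (Fin 3) ℂ).IsHomogeneous (E + 1) := by
    intro j
    rw [add_comm]
    exact (isHomogeneous_X _ _).mul (isHomogeneous_X_pow _ _)
  have hne : ∀ j : Fin 3, (X j * X 0 ^ E : MvPolynomial (Fin 3) ℂ) ≠ 0 := fun j =>
    mul_ne_zero (X_ne_zero _) (pow_ne_zero _ (X_ne_zero _))
  have hgen : ∀ j : Fin 3, generic (X j * X 0 ^ E) = coord j := by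
    intro j
    simp [generic, coord]
  set g := generic G ^ (n * τ) * ∏ j, generic (F j) ^ (-(2 * n - 1 : ℤ)) with hg
  have hg0 : g ≠ 0 := mul_ne_zero (pow_ne_zero _ (generic_ne_zero hG hG0))
    (Finset.prod_ne_zero_iff.2 fun j _ => zpow_ne_zero _ (hF.generic_ne_zero j))
  have hs : ∀ j : Fin 3, IsSection (((n * τ : ℕ) : ℚ) • divisorK F n G) (coord j * g) := by
    intro j
    have := hsec (hhom j) (hne j)
    rwa [hgen, mul_assoc] at this
  refine ⟨n * τ, Nat.mul_pos (by omega) (by omega), exists_int_eq_mul_divisorK hn hF hG hG0,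
    coord 0 * g, coord 1 * g, coord 2 * g, hs 0, hs 1, hs 2,
    mul_ne_zero (coord_ne_zero 0) hg0, ?_⟩
  have h0 : coord 0 = 1 := rfl
  rw [mul_div_mul_right _ _ hg0, mul_div_mul_right _ _ hg0, h0, div_one, div_one]
  exact algebraicIndependent_coord

end Positivity

/-! ### Wedge products of differentials and regularity of pluricanonical forms. -/

section DifferentialForms

open MvPolynomial

variable {L : Type*} [Field L] [Algebra ℂ L]

/-- The 2-form `da ∧ db`. -/
def wedge (a b : L) : ⋀[L]^2 (Ω[L⁄ℂ]) :=
  exteriorPower.ιMulti L 2 ![KaehlerDifferential.D ℂ L a, KaehlerDifferential.D ℂ L b]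

theorem update_pair_zero {M : Type*} (x y z : M) : Function.update ![x, y] 0 z = ![z, y] := by
  funext j
  fin_cases j <;> rfl

theorem update_pair_one {M : Type*} (x y z : M) : Function.update ![x, y] 1 z = ![x, z] := by
  funext j
  fin_cases j <;> rfl

/-- The wedge product of two 1-forms, as a bilinear map. -/
def wedgeHom : Ω[L⁄ℂ] →ₗ[L] Ω[L⁄ℂ] →ₗ[L] ⋀[L]^2 (Ω[L⁄ℂ]) :=
  LinearMap.mk₂ L (fun x y => exteriorPower.ιMulti L 2 ![x, y])
    (fun x x' y => by
      have := (exteriorPower.ιMulti L 2 (M := Ω[L⁄ℂ])).map_update_add ![x, y] 0 x x'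
      simpa only [update_pair_zero] using this)
    (fun c x y => by
      have := (exteriorPower.ιMulti L 2 (M := Ω[L⁄ℂ])).map_update_smul ![x, y] 0 c x
      simpa only [update_pair_zero] using this)
    (fun x y y' => by
      have := (exteriorPower.ιMulti L 2 (M := Ω[L⁄ℂ])).map_update_add ![x, y] 1 y y'
      simpa only [update_pair_one] using this)
    (fun c x y => by
      have := (exteriorPower.ιMulti L 2 (M := Ω[L⁄ℂ])).map_update_smul ![x, y] 1 c y
      simpa only [update_pair_one] using this)

theorem wedge_eq (a b : L) :
    wedge a b = wedgeHom (KaehlerDifferential.D ℂ L a) (KaehlerDifferential.D ℂ L b) := rfl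

theorem wedgeHom_self (x : Ω[L⁄ℂ]) : wedgeHom x x = 0 :=
  (exteriorPower.ιMulti L 2).map_eq_zero_of_eq ![x, x] (i := 0) (j := 1) rfl (by decide)

theorem wedgeHom_swap (x y : Ω[L⁄ℂ]) : wedgeHom y x = -wedgeHom x y := by
  have h := wedgeHom_self (x + y)
  simp only [map_add, LinearMap.add_apply, wedgeHom_self, zero_add, add_zero] at h
  rw [eq_neg_iff_add_eq_zero, ← h]

theorem D_aeval (Θ : MvPolynomial (Fin 2) ℂ →ₐ[ℂ] L) (a : MvPolynomial (Fin 2) ℂ) :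
    KaehlerDifferential.D ℂ L (Θ a) =
      Θ (pderiv 0 a) • KaehlerDifferential.D ℂ L (Θ (X 0)) +
        Θ (pderiv 1 a) • KaehlerDifferential.D ℂ L (Θ (X 1)) := by
  induction a using MvPolynomial.induction_on with
  | C c =>
    have : Θ (C c) = algebraMap ℂ L c := Θ.commutes c
    rw [this]
    simp
  | add a b ha hb =>
    simp only [map_add, ha, hb, add_smul]
    abel
  | mul_X a j ha =>
    rw [map_mul, Derivation.leibniz, ha]
    fin_cases j
    · simp [Derivation.leibniz, pderiv_X]
      module
    · simp [Derivation.leibniz, pderiv_X]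
      module

/-- The Jacobian determinant. -/
def jacobian (a b : MvPolynomial (Fin 2) ℂ) : MvPolynomial (Fin 2) ℂ :=
  pderiv 0 a * pderiv 1 b - pderiv 1 a * pderiv 0 b

theorem wedge_aeval (Θ : MvPolynomial (Fin 2) ℂ →ₐ[ℂ] L) (a b : MvPolynomial (Fin 2) ℂ) :
    wedge (Θ a) (Θ b) = Θ (jacobian a b) • wedge (Θ (X 0)) (Θ (X 1)) := by
  rw [wedge_eq, wedge_eq, D_aeval Θ a, D_aeval Θ b, jacobian]
  simp only [map_add, map_smul, LinearMap.add_apply, LinearMap.smul_apply, wedgeHom_self,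
    wedgeHom_swap (KaehlerDifferential.D ℂ L (Θ (X 0))) (KaehlerDifferential.D ℂ L (Θ (X 1))),
    map_sub, map_mul]
  module

/-- The 2-forms that are regular at the valuation ring `A`. -/
def formsAt (A : ValuationSubring L) : Submodule A.toSubring (⋀[L]^2 (Ω[L⁄ℂ])) :=
  Submodule.span A.toSubring {v | ∃ a b : L, a ∈ A ∧ b ∈ A ∧ v = wedge a b}

theorem wedge_mem_formsAt {A : ValuationSubring L} {a b : L} (ha : a ∈ A) (hb : b ∈ A) :
    wedge a b ∈ formsAt A := Submodule.subset_span ⟨a, b, ha, hb, rfl⟩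

theorem smul_mem_formsAt {A : ValuationSubring L} {c : L} (hc : c ∈ A) {v : ⋀[L]^2 (Ω[L⁄ℂ])}
    (hv : v ∈ formsAt A) : c • v ∈ formsAt A :=
  (formsAt A).smul_mem (⟨c, hc⟩ : A.toSubring) hv

/-- Expansion by multilinearity, one slot at a time. In the induction, `s` contains the slots that
need not yet be single wedge products. -/
theorem isRegularAt_tprod {A : ValuationSubring L} {m : ℕ} (v : Fin m → ⋀[L]^2 (Ω[L⁄ℂ]))
    (hv : ∀ i, v i ∈ formsAt A) : IsRegularAt L A (PiTensorProduct.tprod L v) := by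
  classical
  suffices h : ∀ (s : Finset (Fin m)) (v : Fin m → ⋀[L]^2 (Ω[L⁄ℂ])), (∀ i, v i ∈ formsAt A) →
      (∀ i ∉ s, ∃ a b : L, a ∈ A ∧ b ∈ A ∧ v i = wedge a b) →
      IsRegularAt L A (PiTensorProduct.tprod L v) from
    h Finset.univ v hv fun i hi => absurd (Finset.mem_univ i) hi
  intro s
  induction s using Finset.induction_on with
  | empty =>
    intro v _ hv'
    choose a b ha hb hab using fun i => hv' i (Finset.notMem_empty i)
    refine Submodule.subset_span ⟨a, b, ha, hb, ?_⟩
    rw [funext hab]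
    rfl
  | insert i s _ ih =>
    intro v hv hv'
    have key : ∀ w ∈ formsAt A,
        IsRegularAt L A (PiTensorProduct.tprod L (Function.update v i w)) := by
      intro w hw
      induction hw using Submodule.span_induction with
      | mem w hw =>
        refine ih _ (fun j => ?_) fun j hj => ?_
        · rcases eq_or_ne j i with rfl | hji
          · rw [Function.update_self]
            exact Submodule.subset_span hw
          · rw [Function.update_of_ne hji]
            exact hv j
        · rcases eq_or_ne j i with rfl | hji
          · rw [Function.update_self]
            exact hw
          · rw [Function.update_of_ne hji]
            exact hv' j (by simp [hji, hj])
      | zero =>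
        rw [MultilinearMap.map_update_zero]
        exact Submodule.zero_mem _
      | add w w' _ _ h h' =>
        rw [MultilinearMap.map_update_add]
        exact Submodule.add_mem _ h h'
      | smul c w _ h =>
        change IsRegularAt L A (PiTensorProduct.tprod L (Function.update v i ((c : L) • w)))
        rw [MultilinearMap.map_update_smul]
        exact Submodule.smul_mem _ c h
    have := key (v i) (hv i)
    rwa [Function.update_eq_self] at this

theorem isRegularAt_smul_tprod {A : ValuationSubring L} {m : ℕ} {c a : L}
    {η v : ⋀[L]^2 (Ω[L⁄ℂ])} (hη : η = a • v) (hv : v ∈ formsAt A) (hc : c * a ^ m ∈ A) :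
    IsRegularAt L A (c • PiTensorProduct.tprod L fun _ : Fin m => η) := by
  have h1 : (PiTensorProduct.tprod L fun _ : Fin m => η) =
      a ^ m • PiTensorProduct.tprod L fun _ : Fin m => v := by
    rw [hη, MultilinearMap.map_smul_univ]
    simp
  rw [h1, smul_smul]
  exact Submodule.smul_mem _ (⟨c * a ^ m, hc⟩ : A.toSubring) (isRegularAt_tprod _ fun _ => hv)

/-- The functional `φ ⊗ ⋯ ⊗ φ` takes the value `(φ η)^m`. -/
theorem tprod_const_ne_zero {m : ℕ} {η : ⋀[L]^2 (Ω[L⁄ℂ])} (φ : ⋀[L]^2 (Ω[L⁄ℂ]) →ₗ[L] L)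
    (hφ : φ η ≠ 0) : (PiTensorProduct.tprod L fun _ : Fin m => η) ≠ 0 := by
  intro h
  have h1 := congrArg (PiTensorProduct.lift
    ((MultilinearMap.mkPiAlgebra L (Fin m) L).compLinearMap fun _ => φ)) h
  rw [PiTensorProduct.lift.tprod, map_zero] at h1
  simp only [MultilinearMap.compLinearMap_apply, MultilinearMap.mkPiAlgebra_apply,
    Finset.prod_const, Finset.card_univ, Fintype.card_fin] at h1
  exact pow_ne_zero m hφ h1

end DifferentialForms

/-! ### Nonvanishing of `dx ∧ dy` on a separable extension. -/

section Etale

open MvPolynomial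

variable (L : Type*) [Field L] [Algebra ℂ L] [Algebra PlaneField L] [IsScalarTower ℂ PlaneField L]
  [Algebra.IsSeparable PlaneField L]

/-- Localizations and separable algebraic extensions are formally étale, so `dx` and `dy` remain a
basis of the differentials of `L`. The functional is the determinant in this basis. -/
theorem exists_dual_wedge_ne_zero :
    ∃ φ : ⋀[L]^2 (Ω[L⁄ℂ]) →ₗ[L] L,
      φ (wedge (algebraMap PlaneField L (coord 1)) (algebraMap PlaneField L (coord 2))) ≠ 0 := by
  let _ : Algebra (MvPolynomial (Fin 2) ℂ) L :=
    ((algebraMap PlaneField L).comp (algebraMap (MvPolynomial (Fin 2) ℂ) PlaneField)).toAlgebra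
  have : IsScalarTower (MvPolynomial (Fin 2) ℂ) PlaneField L := .of_algebraMap_eq fun _ => rfl
  have : IsScalarTower ℂ (MvPolynomial (Fin 2) ℂ) L := .of_algebraMap_eq fun c => by
    rw [IsScalarTower.algebraMap_apply ℂ PlaneField L,
      IsScalarTower.algebraMap_apply ℂ (MvPolynomial (Fin 2) ℂ) PlaneField]
    rfl
  have : Algebra.FormallyEtale (MvPolynomial (Fin 2) ℂ) PlaneField :=
    .of_isLocalization (nonZeroDivisors (MvPolynomial (Fin 2) ℂ))
  have : Algebra.FormallyEtale PlaneField L := .of_isSeparable _ _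
  have : Algebra.FormallyEtale (MvPolynomial (Fin 2) ℂ) L := .comp _ PlaneField L
  let b := ((KaehlerDifferential.mvPolynomialBasis ℂ (Fin 2)).baseChange L).map
    (KaehlerDifferential.tensorKaehlerEquivOfFormallyEtale ℂ (MvPolynomial (Fin 2) ℂ) L)
  have hb : ∀ j, b j = KaehlerDifferential.D ℂ L (algebraMap (MvPolynomial (Fin 2) ℂ) L (X j)) := by
    intro j
    simp [b, KaehlerDifferential.mvPolynomialBasis_apply]
  refine ⟨exteriorPower.alternatingMapLinearEquiv b.det, ?_⟩
  have h : ![KaehlerDifferential.D ℂ L (algebraMap PlaneField L (coord 1)),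
      KaehlerDifferential.D ℂ L (algebraMap PlaneField L (coord 2))] = b := by
    funext j
    rw [hb]
    fin_cases j <;> rfl
  rw [wedge, exteriorPower.alternatingMapLinearEquiv_apply_ιMulti, h, b.det_self]
  exact one_ne_zero

end Etale

/-! ### Poles of `dx ∧ dy` on the cover at an arbitrary valuation ring. -/

section LocalForms

open MvPolynomial

theorem mem_of_pow_mem {L : Type*} [Field L] {A : ValuationSubring L} {n : ℕ} {w : L} (hn : n ≠ 0) (h : w ^ n ∈ A) : w ∈ A := by
  rw [← A.valuation_le_one_iff, map_pow] at h
  rw [← A.valuation_le_one_iff]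
  exact (pow_le_one_iff hn).1 h

theorem natCast_mul_mem {L : Type*} [Field L] {A : ValuationSubring L} {g : L} (hg : g ∈ A) (k : ℕ) : (k : L) * g ∈ A :=
  mul_mem (natCast_mem A k) hg

variable {L : Type*} [Field L] [Algebra ℂ L]

theorem wedge_mul_pow (g w h : L) (k : ℕ) :
    wedge (g * w ^ (k + 1)) h = w ^ k • (((k + 1 : ℕ) * g) • wedge w h + w • wedge g h) := by
  rw [wedge_eq, Derivation.leibniz, Derivation.leibniz_pow, add_tsub_cancel_right, wedge_eq,
    wedge_eq]
  simp only [map_add, map_smul, LinearMap.add_apply, LinearMap.smul_apply,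
    ← Nat.cast_smul_eq_nsmul L]
  module

theorem wedge_swap (a b : L) : wedge b a = -wedge a b := wedgeHom_swap _ _

theorem wedge_pow_right (a s : L) (k : ℕ) :
    wedge a (s ^ (k + 1)) = (s ^ k * (k + 1 : ℕ)) • wedge a s := by
  have h := wedge_mul_pow 1 s a k
  rw [one_mul, wedge_swap a (s ^ (k + 1)), wedge_swap a s] at h
  have h1 : wedge (1 : L) a = 0 := by
    rw [wedge_eq]
    simp
  rw [h1] at h
  rw [← neg_inj, h]
  module

theorem wedge_mul_right_self (a t : L) : wedge a (a * t) = a • wedge a t := by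
  simp only [wedge_eq, Derivation.leibniz, map_add, map_smul, wedgeHom_self, smul_zero, add_zero]

/-- Two polynomials with nonzero Jacobian generate the ideal of the point locally. Concretely this
is Cramer's rule for the first order Taylor expansions, with `Δ` the determinant. -/
theorem exists_combination {q : Fin 2 → ℂ} {f g h : MvPolynomial (Fin 2) ℂ}
    (hf : eval q f = 0) (hg : eval q g = 0) (hh : eval q h = 0)
    (hJ : eval q (jacobian f g) ≠ 0) :
    ∃ Δ α β : MvPolynomial (Fin 2) ℂ, eval q Δ ≠ 0 ∧ Δ * h = α * f + β * g := by
  obtain ⟨f₀, f₁, hf'⟩ := exists_taylor q f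
  obtain ⟨g₀, g₁, hg'⟩ := exists_taylor q g
  obtain ⟨h₀, h₁, hh'⟩ := exists_taylor q h
  have hf2 := eval_pderiv_of_taylor hf'
  have hg2 := eval_pderiv_of_taylor hg'
  rw [hf, C_0, zero_add] at hf'
  rw [hg, C_0, zero_add] at hg'
  rw [hh, C_0, zero_add] at hh'
  refine ⟨f₀ * g₁ - f₁ * g₀, h₀ * g₁ - h₁ * g₀, h₁ * f₀ - h₀ * f₁, ?_, ?_⟩
  · rw [jacobian, map_sub, map_mul, map_mul, hf2.1, hf2.2, hg2.1, hg2.2] at hJ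
    rwa [map_sub, map_mul, map_mul]
  · rw [hf', hg', hh']
    ring

variable {A : ValuationSubring L} {Θ : MvPolynomial (Fin 2) ℂ →ₐ[ℂ] L} {q : Fin 2 → ℂ}
  {n τ : ℕ} {f : Fin τ → MvPolynomial (Fin 2) ℂ}

theorem form_of_unit_smul {v : ⋀[L]^2 (Ω[L⁄ℂ])} {u a : L} (hu : A.valuation u = 1)
    (h : u • wedge (Θ (X 0)) (Θ (X 1)) = a • v) (hv : v ∈ formsAt A) :
    ∃ v' ∈ formsAt A, wedge (Θ (X 0)) (Θ (X 1)) = a • v' := by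
  have hu0 : u ≠ 0 := by
    rintro rfl
    simp at hu
  refine ⟨u⁻¹ • v, smul_mem_formsAt ?_ hv, ?_⟩
  · rw [← A.valuation_le_one_iff, map_inv₀, hu, inv_one]
  · rw [smul_comm, ← h, smul_smul, inv_mul_cancel₀ hu0, one_smul]

/-- Local equations of an arrangement at the center of a valuation ring. -/
structure IsLocalArrangement (A : ValuationSubring L) (Θ : MvPolynomial (Fin 2) ℂ →ₐ[ℂ] L)
    (q : Fin 2 → ℂ) (n : ℕ) (f : Fin τ → MvPolynomial (Fin 2) ℂ) : Prop where
  mem : ∀ a, Θ a ∈ A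
  valuation_eq_one : ∀ a, eval q a ≠ 0 → A.valuation (Θ a) = 1
  ne_zero : ∀ j, Θ (f j) ≠ 0
  exists_pderiv : ∀ j, eval q (f j) = 0 → ∃ a, eval q (pderiv a (f j)) ≠ 0
  jacobian : ∀ j k, j ≠ k → eval q (f j) = 0 → eval q (f k) = 0 →
    eval q (PlaneArrangement.jacobian (f j) (f k)) ≠ 0
  exists_root : ∀ j k, ∃ w : L, w ^ n = Θ (f j) / Θ (f k)

/-- The bound on poles that makes the pluricanonical forms in question regular. -/
def HasLocalForm (A : ValuationSubring L) (Θ : MvPolynomial (Fin 2) ℂ →ₐ[ℂ] L) (n : ℕ)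
    (f : Fin τ → MvPolynomial (Fin 2) ℂ) : Prop :=
  ∃ (a : L), ∃ v ∈ formsAt A, wedge (Θ (X 0)) (Θ (X 1)) = a • v ∧
    A.valuation a ^ (n * τ) ≤ ∏ j, A.valuation (Θ (f j)) ^ (2 * n - 1)

namespace IsLocalArrangement

theorem hasLocalForm_of_forall_ne (h : IsLocalArrangement A Θ q n f)
    (hq : ∀ j, eval q (f j) ≠ 0) : HasLocalForm A Θ n f := by
  refine ⟨1, _, wedge_mem_formsAt (h.mem (X 0)) (h.mem (X 1)), (one_smul _ _).symm, ?_⟩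
  simp [h.valuation_eq_one _ (hq _)]

/-- Up to the unit `f j₀`, the local equation `f j₁` is an `n`-th power `w^n`, and differentiating
it gives `a = w^(n-1)`. The bound amounts to `n (2n - 1) ≤ (n - 1) n τ`, which holds for `n ≥ 2` and
`τ ≥ 4`. -/
theorem hasLocalForm_of_unique (h : IsLocalArrangement A Θ q n f) (hn : 2 ≤ n) (hτ : 4 ≤ τ)
    {j₀ j₁ : Fin τ} (hj₀ : eval q (f j₀) ≠ 0) (hj₁ : eval q (f j₁) = 0)
    (hq : ∀ j, j ≠ j₁ → eval q (f j) ≠ 0) : HasLocalForm A Θ n f := by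
  obtain ⟨w, hw⟩ := h.exists_root j₁ j₀
  have hφ : Θ (f j₁) = Θ (f j₀) * w ^ n := by
    rw [hw, mul_div_cancel₀ _ (h.ne_zero j₀)]
  have hval : A.valuation (Θ (f j₁)) = A.valuation w ^ n := by
    rw [hφ, map_mul, h.valuation_eq_one _ hj₀, one_mul, map_pow]
  have hwA : w ∈ A := by
    refine mem_of_pow_mem (n := n) (by omega) ?_
    rw [← A.valuation_le_one_iff, map_pow, ← hval, A.valuation_le_one_iff]
    exact h.mem _
  -- One of the affine coordinates completes `f j₁` to local coordinates at `q`.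
  obtain ⟨b, hb⟩ : ∃ b : Fin 2, eval q (PlaneArrangement.jacobian (f j₁) (X b)) ≠ 0 := by
    obtain ⟨a, ha⟩ := h.exists_pderiv j₁ hj₁
    fin_cases a
    · exact ⟨1, by simpa [PlaneArrangement.jacobian, pderiv_X] using ha⟩
    · exact ⟨0, by simpa [PlaneArrangement.jacobian, pderiv_X] using ha⟩
  obtain ⟨k, rfl⟩ : ∃ k, n = k + 1 := ⟨n - 1, by omega⟩
  have hform := (wedge_aeval Θ (f j₁) (X b)).symm
  rw [hφ, wedge_mul_pow] at hform
  obtain ⟨v, hv, hη⟩ := form_of_unit_smul (h.valuation_eq_one _ hb) hform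
    (add_mem (smul_mem_formsAt (natCast_mul_mem (h.mem _) _)
      (wedge_mem_formsAt hwA (h.mem (X b))))
      (smul_mem_formsAt hwA (wedge_mem_formsAt (h.mem (f j₀)) (h.mem (X b)))))
  refine ⟨w ^ k, v, hv, hη, ?_⟩
  rw [Finset.prod_eq_single j₁ (fun j _ hj => by rw [h.valuation_eq_one _ (hq j hj), one_pow])
    (by simp), hval, map_pow, ← pow_mul, ← pow_mul]
  refine pow_le_pow_right_of_le_one' ((A.valuation_le_one_iff w).2 hwA) ?_
  obtain ⟨l, rfl⟩ : ∃ l, k = l + 1 := ⟨k - 1, by omega⟩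
  have h1 : 2 * (l + 1 + 1) - 1 = 2 * l + 3 := by omega
  rw [h1]
  nlinarith [Nat.mul_le_mul_left ((l + 1) * (l + 1 + 1)) hτ]

/-- Here `f j₁` and `f j₂` are local coordinates at `q`. Substituting `f j₁ = f j₀ w^n` and `f j₂ =
f j₁ s^n`, as on a blow-up followed by a branched cover, gives `a = w^(2n-1) s^(n-1)`. If `r`
equations vanish at `q`, the product of all the `f j` has the valuation of `w^(nr) s^n`. The
exponents of `w` compare because `r ≤ τ`, those of `s` by the inequality `n (2n - 1) ≤ (n - 1) n τ`.
-/
theorem hasLocalForm_of_pair (h : IsLocalArrangement A Θ q n f) (hn : 2 ≤ n) (hτ : 4 ≤ τ)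
    {j₀ j₁ j₂ : Fin τ} (hj₀ : eval q (f j₀) ≠ 0) (hj₁ : eval q (f j₁) = 0)
    (hj₂ : eval q (f j₂) = 0) (h12 : j₁ ≠ j₂)
    (hle : A.valuation (Θ (f j₂)) ≤ A.valuation (Θ (f j₁)))
    (hq : ∀ j, j ≠ j₂ → eval q (f j) = 0 → A.valuation (Θ (f j)) = A.valuation (Θ (f j₁))) :
    HasLocalForm A Θ n f := by
  classical
  obtain ⟨w, hw⟩ := h.exists_root j₁ j₀
  obtain ⟨s, hs⟩ := h.exists_root j₂ j₁
  have hφ : Θ (f j₁) = Θ (f j₀) * w ^ n := by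
    rw [hw, mul_div_cancel₀ _ (h.ne_zero j₀)]
  have hφ₂ : Θ (f j₂) = Θ (f j₁) * s ^ n := by
    rw [hs, mul_div_cancel₀ _ (h.ne_zero j₁)]
  have hval : A.valuation (Θ (f j₁)) = A.valuation w ^ n := by
    rw [hφ, map_mul, h.valuation_eq_one _ hj₀, one_mul, map_pow]
  have hwA : w ∈ A := by
    refine mem_of_pow_mem (n := n) (by omega) ?_
    rw [← A.valuation_le_one_iff, map_pow, ← hval, A.valuation_le_one_iff]
    exact h.mem _
  have hsA : s ∈ A := by
    refine mem_of_pow_mem (n := n) (by omega) ?_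
    rw [hs, ← A.valuation_le_one_iff, map_div₀]
    exact div_le_one_of_le₀ hle zero_le
  obtain ⟨k, rfl⟩ : ∃ k, n = k + 1 := ⟨n - 1, by omega⟩
  have hform := (wedge_aeval Θ (f j₁) (f j₂)).symm
  rw [hφ₂, wedge_mul_right_self, wedge_pow_right, hφ, wedge_mul_pow] at hform
  set v₀ := ((k + 1 : ℕ) * Θ (f j₀)) • wedge w s + w • wedge (Θ (f j₀)) s with hv₀
  have hv₀A : v₀ ∈ formsAt A :=
    add_mem (smul_mem_formsAt (natCast_mul_mem (h.mem _) _) (wedge_mem_formsAt hwA hsA))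
      (smul_mem_formsAt hwA (wedge_mem_formsAt (h.mem (f j₀)) hsA))
  have hform' : Θ (PlaneArrangement.jacobian (f j₁) (f j₂)) • wedge (Θ (X 0)) (Θ (X 1)) =
      (w ^ (2 * k + 1) * s ^ k) • (((k + 1 : ℕ) * Θ (f j₀)) • v₀) := by
    rw [hform]
    simp only [smul_smul]
    congr 1
    ring
  obtain ⟨v, hv, hη⟩ := form_of_unit_smul
    (h.valuation_eq_one _ (h.jacobian j₁ j₂ h12 hj₁ hj₂)) hform'
    (smul_mem_formsAt (natCast_mul_mem (h.mem _) _) hv₀A)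
  refine ⟨_, v, hv, hη, ?_⟩
  have hw1 := (A.valuation_le_one_iff w).2 hwA
  have hs1 := (A.valuation_le_one_iff s).2 hsA
  set I := Finset.univ.filter fun j => eval q (f j) = 0 with hI
  have hcard : I.card ≤ τ := (Finset.card_le_univ I).trans (by simp)
  have hprod : ∏ j, A.valuation (Θ (f j)) ^ (2 * (k + 1) - 1) =
      (A.valuation w ^ ((k + 1) * I.card) * A.valuation s ^ (k + 1)) ^ (2 * (k + 1) - 1) := by
    rw [Finset.prod_pow]
    congr 1
    have h2 : ∀ j, A.valuation (Θ (f j)) =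
        (if eval q (f j) = 0 then A.valuation w ^ (k + 1) else 1) *
          if j = j₂ then A.valuation s ^ (k + 1) else 1 := by
      intro j
      by_cases hj : j = j₂
      · rw [hj, if_pos hj₂, if_pos rfl, hφ₂, map_mul, hval, map_pow]
      · rw [if_neg hj, mul_one]
        split_ifs with h0
        · rw [hq j hj h0, hval]
        · exact h.valuation_eq_one _ h0
    rw [Finset.prod_congr rfl fun j _ => h2 j, Finset.prod_mul_distrib, Finset.prod_ite_eq',
      if_pos (Finset.mem_univ _), ← Finset.prod_filter, Finset.prod_const, ← pow_mul]
  rw [hprod, map_mul, map_pow, map_pow, mul_pow, mul_pow, ← pow_mul, ← pow_mul, ← pow_mul,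
    ← pow_mul]
  refine mul_le_mul' (pow_le_pow_right_of_le_one' hw1 ?_) (pow_le_pow_right_of_le_one' hs1 ?_)
  · have h1 : 2 * (k + 1) - 1 = 2 * k + 1 := by omega
    rw [h1]
    calc (k + 1) * I.card * (2 * k + 1) ≤ (k + 1) * τ * (2 * k + 1) := by gcongr
      _ = (2 * k + 1) * ((k + 1) * τ) := by ring
  · obtain ⟨l, rfl⟩ : ∃ l, k = l + 1 := ⟨k - 1, by omega⟩
    have h1 : 2 * (l + 1 + 1) - 1 = 2 * l + 3 := by omega
    rw [h1]
    nlinarith [Nat.mul_le_mul_left ((l + 1) * (l + 1 + 1)) hτ]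

/-- Among the equations vanishing at `q`, let `f j₁` have the largest valuation, that is, vanish
least. At most one other can vanish more: any two of them generate the ideal of the point, so `f j₁`
is, up to a unit, a combination of them. That one, or an arbitrary second equation, is taken as `f
j₂`. -/
theorem hasLocalForm (h : IsLocalArrangement A Θ q n f) (hn : 2 ≤ n) (hτ : 4 ≤ τ)
    {j₀ : Fin τ} (hj₀ : eval q (f j₀) ≠ 0) : HasLocalForm A Θ n f := by
  classical
  set I := Finset.univ.filter fun j => eval q (f j) = 0 with hI
  have memI : ∀ {j}, j ∈ I ↔ eval q (f j) = 0 := fun {j} => by simp [hI]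
  rcases I.eq_empty_or_nonempty with he | hne
  · refine h.hasLocalForm_of_forall_ne fun j hj => ?_
    have := memI.2 hj
    rw [he] at this
    exact Finset.notMem_empty j this
  obtain ⟨j₁, hj₁, hmax⟩ := I.exists_max_image (fun j => A.valuation (Θ (f j))) hne
  by_cases huniq : ∀ j, j ≠ j₁ → eval q (f j) ≠ 0
  · exact h.hasLocalForm_of_unique hn hτ hj₀ (memI.1 hj₁) huniq
  push Not at huniq
  by_cases hlt : ∃ j ∈ I, A.valuation (Θ (f j)) < A.valuation (Θ (f j₁))
  · obtain ⟨j₂, hj₂, hlt₂⟩ := hlt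
    have h12 : j₁ ≠ j₂ := by
      rintro rfl
      exact lt_irrefl _ hlt₂
    refine h.hasLocalForm_of_pair hn hτ hj₀ (memI.1 hj₁) (memI.1 hj₂) h12 hlt₂.le
      fun j hj hj0 => le_antisymm (hmax j (memI.2 hj0)) ?_
    by_contra! hltj
    -- If `f j` and `f j₂` both had smaller valuation than `f j₁`, so would their combination `Δ * f
    -- j₁`, where `Δ` is a unit.
    obtain ⟨Δ, α, β, hΔ, he⟩ := exists_combination hj0 (memI.1 hj₂) (memI.1 hj₁)
      (h.jacobian j j₂ hj hj0 (memI.1 hj₂))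
    have h1 := congrArg (fun x => A.valuation (Θ x)) he
    simp only [map_mul, map_add, h.valuation_eq_one _ hΔ, one_mul] at h1
    have h2 : A.valuation (Θ α * Θ (f j) + Θ β * Θ (f j₂)) < A.valuation (Θ (f j₁)) := by
      refine A.valuation.map_add_lt ?_ ?_
      · rw [map_mul]
        exact lt_of_le_of_lt (mul_le_of_le_one_left' ((A.valuation_le_one_iff _).2 (h.mem α))) hltj
      · rw [map_mul]
        exact lt_of_le_of_lt (mul_le_of_le_one_left' ((A.valuation_le_one_iff _).2 (h.mem β))) hlt₂
    rw [← h1] at h2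
    exact lt_irrefl _ h2
  · push Not at hlt
    obtain ⟨j₂, h21, hj₂⟩ := huniq
    exact h.hasLocalForm_of_pair hn hτ hj₀ (memI.1 hj₁) hj₂ h21.symm (hmax j₂ (memI.2 hj₂))
      fun j _ hj0 => le_antisymm (hmax j (memI.2 hj0)) (hlt j (memI.2 hj0))

end IsLocalArrangement

end LocalForms

/-! ### Global regular pluricanonical forms on the cover. -/

section GeneralTypeOfCover

open MvPolynomial

theorem wedge_inv_div {L : Type*} [Field L] [Algebra ℂ L] {x : L} (hx : x ≠ 0) (y : L) :
    wedge x y = (-x ^ 3) • wedge x⁻¹ (y / x) := by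
  rw [div_eq_mul_inv]
  simp only [wedge_eq, Derivation.leibniz, map_add, map_smul, wedgeHom_self, Derivation.leibniz_inv,
    LinearMap.smul_apply, smul_zero, zero_add]
  refine Eq.symm ((congrArg _ (smul_smul _ _ _)).trans ((smul_smul _ _ _).trans ?_))
  rw [show -x ^ 3 * (x⁻¹ * -x⁻¹ ^ 2) = 1 by field_simp, one_smul]

/-- The contraction of the maximal ideal of `A` is a prime ideal, possibly that of a curve or zero.
Any closed point in its zero set will do, since functions not vanishing at that point are not in the
contraction. -/
theorem exists_center {L : Type*} [Field L] [Algebra ℂ L] {A : ValuationSubring L}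
    {Θ : MvPolynomial (Fin 2) ℂ →ₐ[ℂ] L} (hΘ : ∀ a, Θ a ∈ A) :
    ∃ q, ∀ b, eval q b ≠ 0 → A.valuation (Θ b) = 1 := by
  let p := (IsLocalRing.maximalIdeal A).comap (Θ.toRingHom.codRestrict A.toSubring hΘ)
  have hp : p.IsPrime := Ideal.comap_isPrime _ _
  obtain ⟨M, hM, hpM⟩ := Ideal.exists_le_maximal p hp.ne_top
  obtain ⟨q, rfl⟩ := exists_eq_pointIdeal hM
  refine ⟨q, fun b hb => ?_⟩
  refine le_antisymm ((A.valuation_le_one_iff _).2 (hΘ b)) ?_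
  by_contra! hlt
  apply hb
  rw [← mem_pointIdeal]
  exact hpM ((A.valuation_lt_one_iff ⟨Θ b, hΘ b⟩).2 hlt)

variable (L : Type*) [Field L] [Algebra ℂ L] [Algebra PlaneField L] [IsScalarTower ℂ PlaneField L]

/-- The `i`-th affine chart of the plane, mapped to an extension of the function field. -/
def chartTo (i : Fin 3) : MvPolynomial (Fin 2) ℂ →ₐ[ℂ] L :=
  (IsScalarTower.toAlgHom ℂ PlaneField L).comp (chart i)

theorem chartTo_apply (i : Fin 3) (a : MvPolynomial (Fin 2) ℂ) :
    chartTo L i a = algebraMap PlaneField L (chart i a) := rfl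

theorem chartTo_ne_zero (i : Fin 3) {a : MvPolynomial (Fin 2) ℂ} (ha : a ≠ 0) :
    chartTo L i a ≠ 0 := by
  rw [chartTo_apply, map_ne_zero_iff _ (algebraMap PlaneField L).injective,
    map_ne_zero_iff _ (chart_injective i)]
  exact ha

theorem chartTo_X (i : Fin 3) (a : Fin 2) :
    chartTo L i (X a) =
      algebraMap PlaneField L (coord (i.succAbove a)) / algebraMap PlaneField L (coord i) := by
  rw [chartTo_apply, chart, aeval_X, map_div₀]

/-- The exponent `3` reflects that the canonical sheaf of the plane is `𝒪(-3)`. -/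
theorem wedge_coord (i : Fin 3) :
    ∃ ε : L, (ε = 1 ∨ ε = -1) ∧
      wedge (algebraMap PlaneField L (coord 1)) (algebraMap PlaneField L (coord 2)) =
        (ε * algebraMap PlaneField L (coord i) ^ 3) •
          wedge (chartTo L i (X 0)) (chartTo L i (X 1)) := by
  have hc : ∀ j, algebraMap PlaneField L (coord j) ≠ 0 := fun j =>
    (map_ne_zero_iff _ (algebraMap PlaneField L).injective).2 (coord_ne_zero j)
  have h0 : algebraMap PlaneField L (coord 0) = 1 := map_one _
  rw [chartTo_X, chartTo_X]
  fin_cases i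
  · refine ⟨1, Or.inl rfl, ?_⟩
    change _ = (1 * algebraMap PlaneField L (coord 0) ^ 3) •
      wedge (algebraMap PlaneField L (coord 1) / algebraMap PlaneField L (coord 0))
        (algebraMap PlaneField L (coord 2) / algebraMap PlaneField L (coord 0))
    rw [h0, div_one, div_one, one_pow, one_mul, one_smul]
  · refine ⟨-1, Or.inr rfl, ?_⟩
    change _ = (-1 * algebraMap PlaneField L (coord 1) ^ 3) •
      wedge (algebraMap PlaneField L (coord 0) / algebraMap PlaneField L (coord 1))
        (algebraMap PlaneField L (coord 2) / algebraMap PlaneField L (coord 1))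
    rw [h0, one_div, neg_one_mul, ← wedge_inv_div (hc 1)]
  · refine ⟨1, Or.inl rfl, ?_⟩
    change _ = (1 * algebraMap PlaneField L (coord 2) ^ 3) •
      wedge (algebraMap PlaneField L (coord 0) / algebraMap PlaneField L (coord 2))
        (algebraMap PlaneField L (coord 1) / algebraMap PlaneField L (coord 2))
    rw [h0, one_div, one_mul, wedge_swap, wedge_inv_div (hc 2)]
    exact neg_eq_iff_eq_neg.2
      (neg_smul (algebraMap PlaneField L (coord 2) ^ 3) (wedge _ _))

variable {L} {A : ValuationSubring L}

/-- Dividing by a homogeneous coordinate of largest valuation makes all affine coordinates integral,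
as in the valuative criterion for the properness of the plane. -/
theorem exists_chartTo_mem (hA : ∀ c : ℂ, algebraMap ℂ L c ∈ A) :
    ∃ i, ∀ a, chartTo L i a ∈ A := by
  obtain ⟨i, -, hi⟩ := Finset.univ.exists_max_image
    (fun j : Fin 3 => A.valuation (algebraMap PlaneField L (coord j))) Finset.univ_nonempty
  refine ⟨i, fun a => ?_⟩
  induction a using MvPolynomial.induction_on with
  | C c =>
    have : chartTo L i (C c) = algebraMap ℂ L c := (chartTo L i).commutes c
    rw [this]
    exact hA c
  | add a b ha hb =>
    rw [map_add]
    exact add_mem ha hb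
  | mul_X a j ha =>
    rw [map_mul]
    refine mul_mem ha ?_
    rw [chartTo_X, ← A.valuation_le_one_iff, map_div₀]
    exact div_le_one_of_le₀ (hi _ (Finset.mem_univ _)) zero_le

variable {d n τ : ℕ} {F : Fin τ → MvPolynomial (Fin 3) ℂ}

theorem isLocalArrangement (hF : IsTransversalArrangement d F) {i : Fin 3} {q : Fin 2 → ℂ}
    (hroot : ∀ j k, ∃ w : L, w ^ n = algebraMap PlaneField L (generic (F j) / generic (F k)))
    (hi : ∀ a, chartTo L i a ∈ A)
    (hq : ∀ b, eval q b ≠ 0 → A.valuation (chartTo L i b) = 1) :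
    IsLocalArrangement A (chartTo L i) q n fun j => dehom i (F j) where
  mem := hi
  valuation_eq_one := hq
  ne_zero j := chartTo_ne_zero L i (hF.dehom_ne_zero i j)
  exists_pderiv j hj := hF.exists_pderiv_ne_zero i hj
  jacobian j k hjk hj hk := by
    rw [jacobian, map_sub, map_mul, map_mul]
    exact hF.jacobian_ne_zero i hjk hj hk
  exists_root j k := by
    obtain ⟨w, hw⟩ := hroot j k
    refine ⟨w, ?_⟩
    rw [hw, generic_div_generic i (hF.homogeneous j) (hF.homogeneous k), map_div₀]
    rfl

/-- The forms `ℓ / ∏ F_j ^ (2n - 1) (dx ∧ dy) ^ (nτ)` are regular. -/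
theorem isRegularForm_generic (hd : 3 ≤ d) (hn : 2 ≤ n) (hτ : 4 ≤ τ)
    (hF : IsTransversalArrangement d F) (ht : numPoints F τ = 0)
    (hroot : ∀ j k, ∃ w : L, w ^ n = algebraMap PlaneField L (generic (F j) / generic (F k)))
    {B : MvPolynomial (Fin 3) ℂ} (hB : B.IsHomogeneous (τ * d * (2 * n - 1) - 3 * n * τ)) :
    IsRegularForm L (algebraMap PlaneField L (generic B / ∏ j, generic (F j) ^ (2 * n - 1)) •
      PiTensorProduct.tprod L fun _ : Fin (n * τ) =>
        wedge (algebraMap PlaneField L (coord 1)) (algebraMap PlaneField L (coord 2))) := by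
  intro A hA
  obtain ⟨i, hi⟩ := exists_chartTo_mem hA
  obtain ⟨q, hq⟩ := exists_center hi
  obtain ⟨P, hP, rfl⟩ := exists_affinePoint_eq i q
  obtain ⟨j₀, hj₀⟩ := exists_not_vanishes ht P
  rw [vanishes_iff hP (hF.homogeneous j₀)] at hj₀
  obtain ⟨a, v, hv, hη, hval⟩ := (isLocalArrangement hF hroot hi hq).hasLocalForm hn hτ hj₀
  obtain ⟨ε, hε, hw⟩ := wedge_coord L i
  rw [hη, smul_smul] at hw
  refine isRegularAt_smul_tprod hw hv ?_
  set c := algebraMap PlaneField L (coord i) with hc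
  have hc0 : c ≠ 0 := (map_ne_zero_iff _ (algebraMap PlaneField L).injective).2 (coord_ne_zero i)
  have hφ0 : ∏ j, chartTo L i (dehom i (F j)) ^ (2 * n - 1) ≠ 0 :=
    Finset.prod_ne_zero_iff.2 fun j _ => pow_ne_zero _ (chartTo_ne_zero L i (hF.dehom_ne_zero i j))
  have hprod : algebraMap PlaneField L (∏ j, generic (F j) ^ (2 * n - 1)) =
      c ^ (τ * d * (2 * n - 1)) * ∏ j, chartTo L i (dehom i (F j)) ^ (2 * n - 1) := by
    simp only [generic_eq i (hF.homogeneous _), map_prod, map_pow, map_mul, mul_pow,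
      Finset.prod_mul_distrib, Finset.prod_const, Finset.card_univ, Fintype.card_fin,
      ← chartTo_apply, ← hc, ← pow_mul]
    congr 2
    ring
  -- The `n τ` factors `c^3` from `wedge_coord` make up exactly for the excess of the degree of the
  -- denominator over that of `B`, so all powers of `c` cancel.
  have hdeg : τ * d * (2 * n - 1) = (τ * d * (2 * n - 1) - 3 * n * τ) + 3 * (n * τ) := by
    have := movableDegree_pos hd hn hτ
    rw [← mul_assoc]
    omega
  have hval_eq : algebraMap PlaneField L (generic B / ∏ j, generic (F j) ^ (2 * n - 1)) *
      (ε * c ^ 3 * a) ^ (n * τ) = ε ^ (n * τ) * chartTo L i (dehom i B) *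
        (a ^ (n * τ) / ∏ j, chartTo L i (dehom i (F j)) ^ (2 * n - 1)) := by
    rw [map_div₀, hprod, generic_eq i hB, map_mul, map_pow, ← chartTo_apply, ← hc, hdeg, pow_add,
      mul_pow, mul_pow, ← pow_mul, ← hdeg]
    have h1 := pow_ne_zero (τ * d * (2 * n - 1) - 3 * n * τ) hc0
    have h2 := pow_ne_zero (3 * (n * τ)) hc0
    field_simp
  rw [hval_eq]
  refine mul_mem (mul_mem (pow_mem ?_ _) (hi _)) ?_
  · rcases hε with rfl | rfl
    · exact one_mem A
    · exact neg_mem (one_mem A)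
  · rw [← A.valuation_le_one_iff, map_div₀, map_pow, map_prod]
    simp only [map_pow]
    exact div_le_one_of_le₀ hval zero_le

/-- As for bigness, the forms `X j * X 0 ^ E` produce three regular pluricanonical forms in the
ratio `1 : x : y`. -/
theorem isOfGeneralType_of_roots [Algebra.IsSeparable PlaneField L] (hd : 3 ≤ d) (hn : 2 ≤ n)
    (hτ : 4 ≤ τ) (hF : IsTransversalArrangement d F) (ht : numPoints F τ = 0)
    (hroot : ∀ j k, ∃ w : L, w ^ n = algebraMap PlaneField L (generic (F j) / generic (F k))) :
    IsOfGeneralType L := by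
  obtain ⟨E, hE⟩ := Nat.exists_eq_add_of_lt (movableDegree_pos (n := n) hd hn hτ)
  have hreg := fun {B} => isRegularForm_generic (B := B) hd hn hτ hF ht hroot
  rw [hE, zero_add] at hreg
  have hhom : ∀ j : Fin 3, (X j * X 0 ^ E : MvPolynomial (Fin 3) ℂ).IsHomogeneous (E + 1) := by
    intro j
    rw [add_comm]
    exact (isHomogeneous_X _ _).mul (isHomogeneous_X_pow _ _)
  have hgen : ∀ j : Fin 3, generic (X j * X 0 ^ E) = coord j := by
    intro j
    simp [generic, coord]
  set t := PiTensorProduct.tprod L fun _ : Fin (n * τ) =>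
    wedge (algebraMap PlaneField L (coord 1)) (algebraMap PlaneField L (coord 2)) with ht'
  set c := algebraMap PlaneField L (coord 0 / ∏ j, generic (F j) ^ (2 * n - 1)) with hc
  have hregc : ∀ j : Fin 3, IsRegularForm L (algebraMap PlaneField L (coord j) • c • t) := by
    intro j
    have h1 := hreg (hhom j)
    have h0 : coord 0 = 1 := rfl
    rwa [hgen, ← mul_one (coord j), ← h0, mul_div_assoc, map_mul, mul_smul] at h1
  have hc0 : c ≠ 0 := by
    refine (map_ne_zero_iff _ (algebraMap PlaneField L).injective).2
      (div_ne_zero (coord_ne_zero 0) ?_)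
    exact Finset.prod_ne_zero_iff.2 fun j _ => pow_ne_zero _ (hF.generic_ne_zero j)
  obtain ⟨φ, hφ⟩ := exists_dual_wedge_ne_zero L
  refine ⟨n * τ, Nat.mul_pos (by omega) (by omega), c • t, algebraMap PlaneField L (coord 1),
    algebraMap PlaneField L (coord 2), smul_ne_zero hc0 (tprod_const_ne_zero φ hφ), ?_,
    hregc 1, hregc 2, ?_⟩
  · have := hregc 0
    rwa [show coord 0 = 1 from rfl, map_one, one_smul] at this
  · have h := algebraicIndependent_coord.map' (f := IsScalarTower.toAlgHom ℂ PlaneField L)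
      (algebraMap PlaneField L).injective
    convert h using 1
    funext j
    fin_cases j <;> rfl

theorem isOfGeneralType_coverField (hd : 3 ≤ d) (hn : 2 ≤ n) (hτ : 4 ≤ τ)
    (hF : IsTransversalArrangement d F) (ht : numPoints F τ = 0) :
    IsOfGeneralType (coverField F n) := by
  refine isOfGeneralType_of_roots hd hn hτ hF ht fun j k => ?_
  obtain ⟨w, hw⟩ := IsAlgClosed.exists_pow_nat_eq
    (algebraMap PlaneField (AlgebraicClosure PlaneField) (generic (F j) / generic (F k)))
    (show 0 < n by omega)
  exact ⟨⟨w, IntermediateField.subset_adjoin _ _ ⟨j, k, hw⟩⟩, Subtype.ext hw⟩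

end GeneralTypeOfCover

end PlaneArrangement

end

theorem mainTheorem5 (d n τ : ℕ) (hd : 3 ≤ d) (hn : 2 ≤ n) (hτ : 4 ≤ τ)
    (F : Fin τ → MvPolynomial (Fin 3) ℂ) (hF : PlaneArrangement.IsTransversalArrangement d F)
    (ht : PlaneArrangement.numPoints F τ = 0)
    (G : MvPolynomial (Fin 3) ℂ) (hG : G.IsHomogeneous 3) (hG0 : G ≠ 0) :
    (Function.support (PlaneArrangement.divisorK F n G)).Finite ∧
      PlaneArrangement.IsNef (PlaneArrangement.divisorK F n G) ∧
      PlaneArrangement.IsBig (PlaneArrangement.divisorK F n G) ∧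
      PlaneArrangement.IsOfGeneralType (PlaneArrangement.coverField F n) :=
  ⟨PlaneArrangement.finite_support_divisorK hF hG hG0,
    PlaneArrangement.isNef_divisorK hd hn hτ hF ht hG hG0,
    PlaneArrangement.isBig_divisorK hd hn hτ hF ht hG hG0,
    PlaneArrangement.isOfGeneralType_coverField hd hn hτ hF ht⟩
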